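/- For $f:\{0,1\}^n\to\{-1,1\}$ let $\widehat f(z)=2^{-n/2}\sum_{x\in\{0,1\}^n}(-1)^{x\cdot z}f(x)$. An oracle $A\subseteq\{0,1\}^*$ encodes, for every $n$, Boolean functions $f_{n1},\dots,f_{nn}:\{0,1\}^n\to\{-1,1\}$, with $f_{n,i+1}(x)=-1$ if and only if $1^i0^{n-i}x\in A$ (for $0\le i<n$). A random oracle contains each string independently with probability $1/2$, so that the $f_{ni}$ are independent and uniformly random. The strings $z_1,\dots,z_n\in\{0,1\}^n$ (output as their concatenation) *solve Fourier Fishing for $n$ relative to $A$* if at least $\frac34 n$ of the indices $i$ satisfy $|\widehat f_{ni}(z_i)|\ge1$ and at least $\frac14n$ of them satisfy $|\widehat f_{ni}(z_i)|\ge2$. As a relation problem, Fourier Fishing has the inputs $0^n$, the valid outputs being the solutions for $n$; every output is valid on inputs of another form and on $0^n$ if there is no solution for $n$. $\mathsf{FBPP}^B$ is the class of relations $R\subseteq\{0,1\}^*\times\{0,1\}^*$ such that every $x$ has some $y$ with $(x,y)\in R$ and some probabilistic polynomial-time machine with oracle $B$ outputs, on every $x\in\{0,1\}^n$, a $y$ with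 $(x,y)\in R$ with probability $1-o(1)$ as $n\to\infty$. $\mathsf{FBQP}^B$ is defined in the same way with quantum polynomial-time algorithms (polynomial-time uniform quantum circuits with oracle gates, with polynomial-time classical pre- and postprocessing). Let $\Sigma_0^A=\mathsf P^A$ and $\Sigma_{k+1}^A=\bigcup_{L\in\Sigma_k^A}\mathsf{NP}^L$; then $\mathsf{PH}^A=\bigcup_k\Sigma_k^A$ and $\mathsf{FBPP}^{\mathsf{PH}^A}=\bigcup_{B\in\mathsf{PH}^A}\mathsf{FBPP}^B$. An $\mathsf{FBPP}^{\mathsf{PH}}$ machine consists of a probabilistic polynomial-time machine and the machines of finitely many levels of the hierarchy below it, all of them independent of $A$. **Theorem.** Let $A$ be a random oracle. 1. There are a quantum polynomial-time algorithm $Q$ and a constant $c>0$ such that, for all sufficiently large $n$, $Q^A(0^n)$ solves Fourier Fishing for $n$ with probability at least $1-e^{-cn}$ over $A$ and the quantum randomness. Moreover, with probability $1$ over $A$, for all sufficiently large $n$, $Q^A(0^n)$ solves it with probability at least $1-e^{-cn}$ over the quantum randomness alone. 2. For every $\mathsf{FBPP}^{\mathsf{PH}}$ machine $M$ and all sufficiently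 large $n$, $M^A(0^n)$ solves Fourier Fishing for $n$ with probability less than $0.99$ over $A$ and the randomness of $M$. Moreover, with probability $1$ over $A$, for every $B\in\mathsf{PH}^A$ and every probabilistic polynomial-time machine $M$ there are infinitely many $n$ for which $M^B(0^n)$ solves it with probability less than $0.99$ over the randomness of $M$ alone. 3. With probability $1$ over $A$, Fourier Fishing belongs to $\mathsf{FBQP}^A$ but not to $\mathsf{FBPP}^{\mathsf{PH}^A}$. In particular, with probability $1$, $\mathsf{FBQP}^A\not\subseteq\mathsf{FBPP}^{\mathsf{PH}^A}$. -/

import Mathlib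

namespace BQPvsPH

/-! ## Oracles and the random oracle -/

/-- An oracle, or a language: the characteristic function of a set of bit strings. -/
abbrev Oracle := List Bool → Bool

/-- The law of a random oracle: every bit string belongs to the oracle with probability `1/2`,
independently of all the others. -/
noncomputable def randomOracle : MeasureTheory.Measure Oracle :=
  MeasureTheory.Measure.infinitePi
    (fun _ : List Bool => (PMF.uniformOfFintype Bool).toMeasure)

/-! ## Deterministic polynomial-time oracle machines

A machine has finitely many stacks of bits and a finite program. One step is one instruction. -/

/-- The instructions. `push s b` pushes the bit `b` on stack `s` and proceeds to the next
instruction. `pop s e f t` removes the top bit of stack `s` and jumps to instruction `e`, `f` or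
`t` if the stack was empty, if the bit was `false`, or if the bit was `true`. `query s f t` asks
the oracle about the string on stack `s` (read from the top) and jumps to `f` or `t` according to
the answer. -/
inductive Instr where
  | push (s : ℕ) (b : Bool)
  | pop (s e f t : ℕ)
  | query (s f t : ℕ)

/-- A configuration: the current instruction and the contents of the stacks (top first). -/
structure Config where
  pc : ℕ
  stack : ℕ → List Bool

/-- One step. The machine has halted when the program counter is beyond the program. -/
def step (A : Oracle) (P : List Instr) (c : Config) : Config :=
  match P[c.pc]? with
  | none => c
  | some (.push s b) => ⟨c.pc + 1, Function.update c.stack s (b :: c.stack s)⟩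
  | some (.pop s e f t) =>
    match c.stack s with
    | [] => ⟨e, c.stack⟩
    | false :: l => ⟨f, Function.update c.stack s l⟩
    | true :: l => ⟨t, Function.update c.stack s l⟩
  | some (.query s f t) => ⟨if A (c.stack s) then t else f, c.stack⟩

/-- The polynomials `n ^ k + k`; every polynomial is bounded by one of them. -/
def polyBound (k n : ℕ) : ℕ := n ^ k + k

/-- A clocked polynomial-time oracle machine: it is stopped after `n ^ k + k` steps on inputs of
total length `n`. -/
structure Machine where
  program : List Instr
  k : ℕ

/-- The start: the two inputs are on stacks `0` and `1`, and all other stacks are empty. -/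
def startConfig (x y : List Bool) : Config :=
  ⟨0, fun s => if s = 0 then x else if s = 1 then y else []⟩

/-- The output on the inputs `x` and `y` (the second one is empty, a witness, a string of random
bits, or a measurement outcome): the content of stack `2` when the machine stops. -/
def Machine.eval (M : Machine) (A : Oracle) (x y : List Bool) : List Bool :=
  ((step A M.program)^[polyBound M.k (x.length + y.length)] (startConfig x y)).stack 2

/-- The machine accepts if its output is the one-bit string `1`. -/
def Machine.Accepts (M : Machine) (A : Oracle) (x y : List Bool) : Prop :=
  M.eval A x y = [true]

/-! ## The polynomial hierarchy relative to an oracle -/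

/-- `P^A`. -/
def P (A : Oracle) : Set Oracle :=
  {L | ∃ M : Machine, ∀ x, L x = true ↔ M.Accepts A x []}

/-- A nondeterministic polynomial-time oracle machine: a verifier, with witnesses of length
`n ^ wit + wit` on inputs of length `n`. -/
structure NPMachine where
  verifier : Machine
  wit : ℕ

/-- Some witness makes the verifier accept `x`. -/
def NPMachine.Accepts (N : NPMachine) (A : Oracle) (x : List Bool) : Prop :=
  ∃ w : List Bool, w.length = polyBound N.wit x.length ∧ N.verifier.Accepts A x w

/-- `NP^A`. -/
def NP (A : Oracle) : Set Oracle :=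
  {L | ∃ N : NPMachine, ∀ x, L x = true ↔ N.Accepts A x}

/-- The levels `Σ_0^A = P^A` and `Σ_{k+1}^A = NP^{Σ_k^A}` of the polynomial hierarchy. -/
def SigmaP (A : Oracle) : ℕ → Set Oracle
  | 0 => P A
  | k + 1 => {L | ∃ B ∈ SigmaP A k, L ∈ NP B}

/-- `PH^A`. -/
def PH (A : Oracle) : Set Oracle := {L | ∃ k, L ∈ SigmaP A k}

/-- A machine for a language in the relativized polynomial hierarchy, given independently of the
oracle: a deterministic machine, or a nondeterministic machine that queries the language of a
machine of the level below. -/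
inductive PHMachine where
  | base (M : Machine)
  | next (N : NPMachine) (S : PHMachine)

open Classical in
/-- The language that a machine of the hierarchy decides relative to `A`. -/
noncomputable def PHMachine.lang (A : Oracle) : PHMachine → Oracle
  | .base M => fun x => decide (M.Accepts A x [])
  | .next N S => fun x => decide (N.Accepts (S.lang A) x)

/-! ## `FBPP` and `FBPP^PH` -/

/-- A relation problem: the set of valid outputs for each input. -/
abbrev Relation := List Bool → Set (List Bool)

/-- A probabilistic polynomial-time oracle machine: it tosses `n ^ coins + coins` fair coins on
inputs of length `n`. -/
structure ProbMachine where
  machine : Machine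
  coins : ℕ

open Classical in
/-- The probability that `M`, with oracle `A` and input `x`, outputs an element of `S`. -/
noncomputable def ProbMachine.prob (M : ProbMachine) (A : Oracle) (x : List Bool)
    (S : Set (List Bool)) : ℝ :=
  ((Finset.univ.filter fun r : Fin (polyBound M.coins x.length) → Bool =>
    M.machine.eval A x (List.ofFn r) ∈ S).card : ℝ) / 2 ^ polyBound M.coins x.length

/-- `FBPP^A`: every input has a valid output, and some probabilistic polynomial-time machine
outputs a valid one with probability `1 - o(1)` as the length of the input grows. -/
def FBPP (A : Oracle) : Set Relation :=
  {R | (∀ x, (R x).Nonempty) ∧ ∃ (M : ProbMachine) (ε : ℕ → ℝ),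
    Filter.Tendsto ε Filter.atTop (nhds 0) ∧ ∀ x, 1 - ε x.length ≤ M.prob A x (R x)}

/-- `FBPP^{PH^A}`, the union of the classes `FBPP^{Σ_k^A}`. -/
def FBPPwithPH (A : Oracle) : Set Relation :=
  {R | ∃ B ∈ PH A, R ∈ FBPP B}

/-! ## Quantum oracle circuits and `FBQP` -/

/-- The gates on `m` qubits: Hadamard, `T = diag(1, e^{iπ/4})`, controlled NOT, and queries to the
oracle about the string held by the qubits `qs`, the answer being added to qubit `t`. -/
inductive Gate (m : ℕ) where
  | hadamard (q : Fin m)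
  | phaseT (q : Fin m)
  | cnot (c t : Fin m)
  | query (qs : List (Fin m)) (t : Fin m)

open Classical in
/-- The unitary action of a gate on state vectors. A controlled NOT with equal control and target
and a query whose target is among the queried qubits are no gates: they do nothing. -/
noncomputable def Gate.apply {m : ℕ} (A : Oracle) (g : Gate m)
    (ψ : (Fin m → Bool) → ℂ) : (Fin m → Bool) → ℂ :=
  match g with
  | .hadamard q => fun w =>
      (ψ (Function.update w q false) +
        (if w q then -1 else 1) * ψ (Function.update w q true)) / (Real.sqrt 2 : ℂ)
  | .phaseT q => fun w =>
      (if w q then Complex.exp (Real.pi / 4 * Complex.I) else 1) * ψ w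
  | .cnot c t => fun w =>
      if c = t then ψ w else ψ (Function.update w t (xor (w t) (w c)))
  | .query qs t => fun w =>
      if t ∈ qs then ψ w else ψ (Function.update w t (xor (w t) (A (qs.map w))))

/-- A circuit on `last + 1` qubits; the first gate of the list acts first. -/
structure Circuit where
  last : ℕ
  gates : List (Gate (last + 1))

/-- The final state of a circuit that starts in the basis state `|0...0⟩`. -/
noncomputable def Circuit.state (C : Circuit) (A : Oracle) : (Fin (C.last + 1) → Bool) → ℂ :=
  C.gates.foldl (fun ψ g => g.apply A ψ) (Pi.single (fun _ => false) 1)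

/-- Read a bit string as a list of natural numbers in unary: `1^a 0 1^b 0 ...` is `[a, b, ...]`.
The first argument is the number of ones just read. -/
def readNumbers : ℕ → List Bool → List ℕ
  | _, [] => []
  | a, true :: l => readNumbers (a + 1) l
  | a, false :: l => a :: readNumbers 0 l

/-- Read a list of numbers as a list of gates; indices of qubits are taken modulo `m`. -/
def readGates (m : ℕ) [NeZero m] : List ℕ → List (Gate m)
  | 0 :: q :: l => .hadamard (Fin.ofNat m q) :: readGates m l
  | 1 :: q :: l => .phaseT (Fin.ofNat m q) :: readGates m l
  | 2 :: c :: t :: l => .cnot (Fin.ofNat m c) (Fin.ofNat m t) :: readGates m l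
  | 3 :: t :: j :: l =>
      .query ((l.take j).map (Fin.ofNat m)) (Fin.ofNat m t) :: readGates m (l.drop j)
  | _ => []
termination_by l => l.length
decreasing_by all_goals simp <;> omega

/-- The circuit described by a bit string: its first number is the number of qubits minus one. -/
def readCircuit (s : List Bool) : Circuit :=
  match readNumbers 0 s with
  | [] => ⟨0, []⟩
  | a :: l => ⟨a, readGates (a + 1) l⟩

/-- A quantum polynomial-time algorithm: a classical polynomial-time machine that writes down a
circuit, and one that computes the output from the input and the outcome of measuring all qubits
of the circuit in the computational basis. -/
structure QuantumMachine where
  pre : Machine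
  post : Machine

open Classical in
/-- The probability that `M`, with oracle `A` and input `x`, outputs an element of `S`. -/
noncomputable def QuantumMachine.prob (M : QuantumMachine) (A : Oracle) (x : List Bool)
    (S : Set (List Bool)) : ℝ :=
  ∑ w : Fin ((readCircuit (M.pre.eval A x [])).last + 1) → Bool,
    if M.post.eval A x (List.ofFn w) ∈ S then
      ‖(readCircuit (M.pre.eval A x [])).state A w‖ ^ 2
    else 0

/-- `FBQP^A`: as `FBPP^A`, with quantum instead of probabilistic machines. -/
def FBQP (A : Oracle) : Set Relation :=
  {R | (∀ x, (R x).Nonempty) ∧ ∃ (M : QuantumMachine) (ε : ℕ → ℝ),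
    Filter.Tendsto ε Filter.atTop (nhds 0) ∧ ∀ x, 1 - ε x.length ≤ M.prob A x (R x)}

/-! ## Fourier Fishing -/

/-- The inner product `x · z` of bit strings, as the number of common ones. -/
def dot {n : ℕ} (x z : Fin n → Bool) : ℕ :=
  (Finset.univ.filter fun j => x j = true ∧ z j = true).card

/-- The Fourier coefficient of `f` at `z`, with the normalization `1 / √(2 ^ n)`. -/
noncomputable def fourier {n : ℕ} (f : (Fin n → Bool) → ℝ) (z : Fin n → Bool) : ℝ :=
  1 / Real.sqrt (2 ^ n) * ∑ x, (-1) ^ dot x z * f x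

/-- The Boolean functions `f_1, ..., f_n : {0,1}^n → {-1,1}` encoded by an oracle, with indices
starting at `0`: the value of the `i`-th one at `x` is given by the string `1^i 0^{n-i} x`. -/
noncomputable def oracleFun (A : Oracle) (n : ℕ) (i : Fin n) (x : Fin n → Bool) : ℝ :=
  if A (List.replicate i true ++ List.replicate (n - i) false ++ List.ofFn x) then -1 else 1

/-- The strings `z_1, ..., z_n` solve Fourier Fishing for the functions `f_1, ..., f_n`. -/
def IsCatch {n : ℕ} (f : Fin n → (Fin n → Bool) → ℝ) (z : Fin n → Fin n → Bool) : Prop :=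
  (3 / 4 : ℝ) * n ≤ {i | 1 ≤ |fourier (f i) (z i)|}.ncard ∧
  (1 / 4 : ℝ) * n ≤ {i | 2 ≤ |fourier (f i) (z i)|}.ncard

/-- The concatenations `z_1 z_2 ... z_n` of the solutions for the functions encoded by `A`. -/
def catches (A : Oracle) (n : ℕ) : Set (List Bool) :=
  {y | ∃ z : Fin n → Fin n → Bool,
    y = (List.ofFn fun i => List.ofFn (z i)).flatten ∧ IsCatch (oracleFun A n) z}

/-- Fourier Fishing as a relation problem with the instances `0^n`. Every output is valid on the
other inputs, and for those `n` that have no solution at all. -/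
def FourierFishing (A : Oracle) : Relation := fun x =>
  {y | ∀ n, x = List.replicate n false → (catches A n).Nonempty → y ∈ catches A n}

end BQPvsPH

set_option linter.unusedSectionVars false

namespace BQPvsPH
open Finset
open scoped BigOperators

/-! ## Averages over functions on a finite set -/

section Averages

variable {V κ : Type*} [Fintype V] [DecidableEq V] [Fintype κ] [DecidableEq κ] [Nonempty κ]

/-! Quantum half. Hadamard gates, phase queries to all the functions, and Hadamard gates again
produce strings `z_i` that are independent, each drawn with probability `f̂_i(z_i)² / 2^n`
(`runGates_fishing`, `QuantumMachine.prob_fishing`). For a random function every coefficient is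
distributed like a normalized sum of `2^n` signs, so the coefficient at a sampled string follows the
size-biased law, which by the central limit theorem approaches `x² φ(x) dx` with `φ` the Gaussian
density. That law gives mass above 0.79 to `|x| ≥ 1` and above 0.255 to `|x| ≥ 2`, more than the
required 3/4 and 1/4. A Chernoff bound makes failure exponentially unlikely
(`eventually_expect_not_isCatch_le`), and Borel–Cantelli gives the almost sure version. The
algorithm is an explicit stack program that writes down the circuit.

Classical half. Only second moments are compared. A catch forces `∑ f̂_i(z_i)² ≥ (3/4 + 3 · 1/4) n =
3n/2` (`IsCatch.sum_sq_ge`), whereas a machine with an oracle from the hierarchy reaches only `n (1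
+ o(1))` on average. One random restriction per level, controlled by `switching_lemma`, turns its
output into a decision tree of polynomial depth `t` on a random set `Λ` of inverse polynomial
density `P` (`exists_restriction`). A tree that has read `t` bits can choose a character whose sum
over the free part of a block `B` has second moment at most `|Λ ∩ B| + t²`
(`HasDepth.expect_sq_le`). Since `Λ` is independent of the function, hence of the chosen character,
averaging over `Λ` recovers the sum over all of `B`: the square becomes `(P - P²)|B|` plus `P²`
times the full square (`setAvg_sq`). Comparing the two bounds the full second moment by `|B|` plus a
polynomial, that is, `1 + o(1)` after normalization, and Markov's inequality finishes.

Almost sure failure infinitely often uses blocks so far apart that earlier runs do not see later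
blocks: conditional success bounds multiply, and their product tends to zero. There are only
countably many machines, so the null sets can be united. -/

theorem piecewise_insert_eq_update (S : Finset V) (v : V) (a g : V → κ) :
    (insert v S).piecewise a g = S.piecewise a (Function.update g v (a v)) := by
  rw [Finset.piecewise_insert]
  funext u
  by_cases hu : u = v
  · subst hu; by_cases h : u ∈ S <;> simp [h]
  · by_cases h : u ∈ S <;> simp [h, hu]

/-- Each value of `g v` has the same fibre of functions on the remaining points, and the left side
sees only these points. -/
theorem expect_update (v : V) (b : κ) (h : (V → κ) → ℝ) :
    𝔼 g : V → κ, h (Function.update g v b)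
      = Fintype.card κ * 𝔼 g : V → κ, if g v = b then h g else 0 := by
  have key : ∑ g : V → κ, h (Function.update g v b)
      = Fintype.card κ * ∑ g : V → κ, if g v = b then h g else 0 := by
    rw [← (Equiv.funSplitAt v κ).symm.sum_comp, ← (Equiv.funSplitAt v κ).symm.sum_comp,
      Fintype.sum_prod_type, Fintype.sum_prod_type]
    have h1 : ∀ c r, Function.update ((Equiv.funSplitAt v κ).symm (c, r)) v b
        = (Equiv.funSplitAt v κ).symm (b, r) := by
      intro c r
      funext u
      by_cases hu : u = v
      · subst hu; simp [Equiv.funSplitAt, Equiv.piSplitAt]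
      · simp [Equiv.funSplitAt, Equiv.piSplitAt, hu]
    have h2 : ∀ c r, (Equiv.funSplitAt v κ).symm (c, r) v = c := by
      intro c r; simp [Equiv.funSplitAt, Equiv.piSplitAt]
    simp only [h1, h2, Finset.sum_const, Finset.card_univ, nsmul_eq_mul]
    congr 1
    rw [Finset.sum_comm]
    simp
  simp only [Finset.expect_eq_sum_div_card, key, mul_div_assoc]

/-- Conditioning a uniformly random function on its values on `S`. -/
theorem expect_indicator_eq (S : Finset V) (a : V → κ) (h : (V → κ) → ℝ) :
    𝔼 g : V → κ, (if ∀ v ∈ S, g v = a v then h g else 0)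
      = ((Fintype.card κ : ℝ)⁻¹) ^ S.card * 𝔼 g : V → κ, h (S.piecewise a g) := by
  induction S using Finset.induction_on generalizing h with
  | empty => simp
  | insert v S hv ih =>
    have h0 : (Fintype.card κ : ℝ) ≠ 0 := by simp
    have e1 : ∀ g : V → κ, (if ∀ u ∈ insert v S, g u = a u then h g else 0)
        = if ∀ u ∈ S, g u = a u then (if g v = a v then h g else 0) else 0 := by
      intro g
      by_cases h1 : g v = a v <;> by_cases h2 : ∀ u ∈ S, g u = a u <;> simp [h1, h2]
    simp only [e1]
    rw [ih (fun g => if g v = a v then h g else 0), Finset.card_insert_of_notMem hv, pow_succ,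
      mul_assoc]
    congr 1
    simp only [Finset.piecewise_eq_of_notMem _ _ _ hv, piecewise_insert_eq_update]
    rw [expect_update v (a v) (fun g => h (S.piecewise a g))]
    rw [← mul_assoc, inv_mul_cancel₀ h0, one_mul]

/-- Rerandomizing a uniformly random function on `Λ` does not change its law. -/
theorem expect_expect_piecewise (Λ : Finset V) (h : (V → κ) → ℝ) :
    𝔼 f : V → κ, 𝔼 g : V → κ, h (Λ.piecewise g f) = 𝔼 f : V → κ, h f := by
  have e : 𝔼 p : (V → κ) × (V → κ), h (Λ.piecewise p.2 p.1)
      = 𝔼 p : (V → κ) × (V → κ), h p.1 := by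
    -- Exchanging the values of the two independent functions on `Λ` is an involution of the space
    -- of pairs.
    have hinv : Function.Involutive
        (fun p : (V → κ) × (V → κ) => (Λ.piecewise p.2 p.1, Λ.piecewise p.1 p.2)) := by
      rintro ⟨f, g⟩
      ext v <;> by_cases hv : v ∈ Λ <;> simp [hv]
    exact Fintype.expect_equiv hinv.toPerm _ _ (fun p => rfl)
  have e2 := Finset.expect_product (s := (univ : Finset (V → κ))) (t := (univ : Finset (V → κ)))
    (f := fun p => h (Λ.piecewise p.2 p.1))
  have e3 := Finset.expect_product (s := (univ : Finset (V → κ))) (t := (univ : Finset (V → κ)))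
    (f := fun p => h p.1)
  rw [Finset.univ_product_univ] at e2 e3
  rw [← e2, e, e3]
  simp

theorem expect_le_of_le {α : Type*} [Fintype α] [Nonempty α] {h : α → ℝ} {c : ℝ}
    (hc : ∀ a, h a ≤ c) : 𝔼 a, h a ≤ c :=
  Finset.expect_le univ_nonempty fun a _ => hc a

end Averages

/-! ## Decision trees -/

section DecisionTrees

variable {V α β : Type*} [DecidableEq V]

/-- The function `F` of the bits `f v` is computed by a decision tree of depth at most `t`. -/
inductive HasDepth : ℕ → ((V → Bool) → α) → Prop
  | const (t : ℕ) (a : α) : HasDepth t fun _ => a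
  | query {t : ℕ} {F : (V → Bool) → α} (v : V)
      (h : ∀ b, HasDepth t fun f => F (Function.update f v b)) : HasDepth (t + 1) F

theorem HasDepth.mono {t t' : ℕ} {F : (V → Bool) → α} (h : HasDepth t F) (ht : t ≤ t') :
    HasDepth t' F := by
  induction h generalizing t' with
  | const t a => exact .const _ a
  | query v _ ih =>
    obtain ⟨s, rfl⟩ : ∃ s, t' = s + 1 := ⟨t' - 1, by omega⟩
    exact .query v fun b => ih b (by omega)

/-- A query inside `Λ` remains a query; one outside is answered by `f` for free. -/
theorem HasDepth.restrict {t : ℕ} {F : (V → Bool) → α} (h : HasDepth t F) (Λ : Finset V)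
    (f : V → Bool) : HasDepth t fun g => F (Λ.piecewise g f) := by
  induction h with
  | const t a => exact .const _ a
  | @query t F v _ ih =>
    by_cases hv : v ∈ Λ
    · refine .query v fun b => ?_
      convert ih b using 3 with g
      funext u
      by_cases hu : u = v
      · subst hu; simp [hv]
      · by_cases h : u ∈ Λ <;> simp [h, hu]
    · have h1 := (ih (f v)).mono (Nat.le_succ t)
      convert h1 using 3 with g
      funext u
      by_cases hu : u = v
      · subst hu; simp [hv]
      · simp [hu]

theorem HasDepth.update {t : ℕ} {F : (V → Bool) → α} (h : HasDepth t F) [Fintype V] (v : V)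
    (b : Bool) : HasDepth t fun f => F (Function.update f v b) := by
  convert h.restrict {v}ᶜ (fun _ => b) using 3 with g
  funext u
  by_cases hu : u = v
  · subst hu; simp
  · simp [hu]

/-- At every leaf of the tree for `Q` the tree for the corresponding `G b` is attached, so the
depths add. -/
theorem HasDepth.bind [Fintype V] {t s : ℕ} {Q : (V → Bool) → β} (hQ : HasDepth t Q)
    {G : β → (V → Bool) → α} (hG : ∀ b, HasDepth s (G b)) :
    HasDepth (t + s) fun f => G (Q f) f := by
  induction hQ generalizing G with
  | const t a => exact (hG a).mono (by omega)
  | @query t Q v _ ih =>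
    rw [Nat.add_right_comm]
    exact .query v fun b => ih b fun c => (hG c).update v b

theorem HasDepth.map [Fintype V] {t : ℕ} {Q : (V → Bool) → β} (hQ : HasDepth t Q) (φ : β → α) :
    HasDepth t fun f => φ (Q f) := by
  simpa using hQ.bind (s := 0) (G := fun b _ => φ b) fun b => .const _ _

/-- Querying all variables of a set `S`. -/
theorem hasDepth_of_forall_piecewise {t : ℕ} {F : (V → Bool) → α} {f : V → Bool} {S Λ : Finset V}
    (hS : S ⊆ Λ)
    (h : ∀ π : V → Bool, HasDepth t fun g => F ((Λ \ S).piecewise g (S.piecewise π f))) :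
    HasDepth (t + S.card) fun g => F (Λ.piecewise g f) := by
  induction S using Finset.induction_on generalizing Λ f with
  | empty =>
    rw [card_empty, add_zero]
    convert h f using 3 with g
    funext u
    by_cases h1 : u ∈ Λ <;> simp [h1]
  | insert v S hv ih =>
    rw [Finset.card_insert_of_notMem hv, ← add_assoc]
    refine .query v fun b => ?_
    have hvΛ : v ∈ Λ := hS (mem_insert_self v S)
    have h1 := ih (Λ := Λ.erase v) (f := Function.update f v b) (fun u hu =>
      mem_erase.2 ⟨fun h => hv (h ▸ hu), hS (mem_insert_of_mem hu)⟩) (fun π => by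
        convert h (Function.update π v b) using 3 with g
        funext u
        by_cases hu : u = v
        · subst hu; simp [hv]
        · by_cases h1 : u ∈ S <;> by_cases h2 : u ∈ Λ <;> simp [h1, h2, hu])
    convert h1 using 3 with g
    funext u
    by_cases hu : u = v
    · subst hu; simp [hvΛ]
    · by_cases h2 : u ∈ Λ <;> simp [h2, hu]

/-! ## Disjunctive normal forms -/

/-- The partial assignment `τ` is satisfied by `f`. -/
def Sat (τ : Finset V × (V → Bool)) (f : V → Bool) : Prop := ∀ v ∈ τ.1, f v = τ.2 v

instance (τ : Finset V × (V → Bool)) (f : V → Bool) : Decidable (Sat τ f) :=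
  inferInstanceAs (Decidable (∀ v ∈ τ.1, f v = τ.2 v))

/-- A function with a disjunctive normal form of width `W`. -/
def HasDNF (W : ℕ) (F : (V → Bool) → Bool) : Prop :=
  ∃ l : List (Finset V × (V → Bool)), (∀ τ ∈ l, τ.1.card ≤ W) ∧
    ∀ f, F f = true ↔ ∃ τ ∈ l, Sat τ f

/-- The terms are the paths of the tree that lead to the value `true`; a path fixes at most as many
bits as the tree is deep. -/
theorem HasDepth.hasDNF {W : ℕ} {F : (V → Bool) → Bool} (h : HasDepth W F) : HasDNF W F := by
  induction h with
  | const t a =>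
    cases a
    · exact ⟨[], by simp, by simp⟩
    · exact ⟨[(∅, fun _ => true)], by simp, by simp [Sat]⟩
  | @query t F v _ ih =>
    choose l hl hF using ih
    have key : ∀ b, ∃ l' : List (Finset V × (V → Bool)), (∀ τ ∈ l', τ.1.card ≤ t + 1) ∧
        ∀ f, (f v = b ∧ F f = true) ↔ ∃ τ ∈ l', Sat τ f := by
      intro b
      -- The terms of the subtree after the answer `b` may still mention `v`. Those that contradict
      -- `b` are dropped, and the others receive the literal `v = b`.
      refine ⟨((l b).filter fun τ => decide (v ∈ τ.1 → τ.2 v = b)).map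
        fun τ => (insert v τ.1, Function.update τ.2 v b), ?_, ?_⟩
      · intro τ' h'
        simp only [List.mem_map, List.mem_filter] at h'
        obtain ⟨τ, ⟨h1, -⟩, rfl⟩ := h'
        exact (card_insert_le _ _).trans (Nat.succ_le_succ (hl b τ h1))
      · intro f
        constructor
        · rintro ⟨h1, h2⟩
          have h3 : Function.update f v b = f := by rw [← h1]; simp
          obtain ⟨τ, hτ, hs⟩ := (hF b f).1 (by simpa [h3] using h2)
          refine ⟨_, List.mem_map.2 ⟨τ, List.mem_filter.2 ⟨hτ, ?_⟩, rfl⟩, ?_⟩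
          · exact decide_eq_true fun hv => (hs v hv).symm.trans h1
          · intro u hu
            by_cases huv : u = v
            · subst huv; simp [h1]
            · simp [huv] at hu ⊢
              exact hs u hu
        · rintro ⟨τ', hτ', hs⟩
          simp only [List.mem_map, List.mem_filter, decide_eq_true_eq] at hτ'
          obtain ⟨τ, ⟨h1, h2⟩, rfl⟩ := hτ'
          have hb : f v = b := by simpa using hs v (by simp)
          refine ⟨hb, ?_⟩
          have h3 : Function.update f v b = f := by rw [← hb]; simp
          have := (hF b f).2 ⟨τ, h1, fun u hu => by
            by_cases huv : u = v
            · subst huv; rw [hb, h2 hu]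
            · simpa [huv] using hs u (by simp [hu])⟩
          simpa [h3] using this
    choose l' hl' hF' using key
    refine ⟨l' false ++ l' true, ?_, ?_⟩
    · intro τ hτ
      rcases List.mem_append.1 hτ with h | h
      exacts [hl' _ _ h, hl' _ _ h]
    · intro f
      simp only [List.mem_append, or_and_right, exists_or, ← hF']
      cases f v <;> simp

theorem hasDNF_exists {ι : Type*} [Finite ι] {W : ℕ} {F : ι → (V → Bool) → Bool}
    (h : ∀ i, HasDNF W (F i)) {G : (V → Bool) → Bool} (hG : ∀ f, G f = true ↔ ∃ i, F i f = true) :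
    HasDNF W G := by
  choose l hl hF using h
  obtain ⟨m, ⟨e⟩⟩ := Finite.exists_equiv_fin ι
  refine ⟨(List.ofFn fun j => l (e.symm j)).flatten, ?_, ?_⟩
  · intro τ hτ
    simp only [List.mem_flatten, List.mem_ofFn, exists_exists_eq_and] at hτ
    obtain ⟨i, hi⟩ := hτ
    exact hl _ _ hi
  · intro f
    simp only [hG, hF, List.mem_flatten, List.mem_ofFn, exists_exists_eq_and]
    constructor
    · rintro ⟨i, τ, h1, h2⟩
      exact ⟨τ, ⟨e i, by simpa using h1⟩, h2⟩
    · rintro ⟨τ, ⟨j, h1⟩, h2⟩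
      exact ⟨_, τ, h1, h2⟩

end DecisionTrees
end BQPvsPH

namespace BQPvsPH
open Finset
open scoped BigOperators

/-! ## A switching lemma -/

section Switching

variable {V : Type*} [Fintype V] [DecidableEq V]

/-- The random set of the zeros of a uniformly random function into `Fin (K + 1)`. -/
def zeros {K : ℕ} (c : V → Fin (K + 1)) : Finset V := univ.filter fun v => c v = 0

/-- The number of ways, weighted by the inverse probability that `f` on the free variables is
as prescribed, to satisfy `k` terms one after the other by fixing free variables. -/
noncomputable def chains (l : List (Finset V × (V → Bool))) :
    ℕ → (V → Bool) → Finset V → ℝ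
  | 0, _, _ => 1
  | k + 1, f, Λ =>
    match l.find? fun τ => decide (Sat τ f) with
    | none => 0
    | some τ => ∑ S ∈ τ.1.powerset.erase ∅, if S ⊆ Λ then
        4 ^ S.card * 𝔼 π : V → Bool, chains l k (S.piecewise π f) (Λ \ S) else 0

theorem chains_nonneg (l : List (Finset V × (V → Bool))) (k : ℕ) (f : V → Bool) (Λ : Finset V) :
    0 ≤ chains l k f Λ := by
  induction k generalizing f Λ with
  | zero => simp [chains]
  | succ k ih =>
    rw [chains]
    split
    · exact le_rfl
    · refine sum_nonneg fun S _ => ?_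
      split_ifs
      · exact mul_nonneg (by positivity) (expect_nonneg fun π _ => ih _ _)
      · exact le_rfl

/-- The first satisfied term depends on `f` alone, not on the random set. A set `S` of its variables
is free with probability `(K + 1)^{-|S|}` and carries the weight `4^{|S|}`, so a round contributes
at most `∑_{S ≠ ∅} (4 / (K + 1))^{|S|}`, which the binomial theorem evaluates. The set `U` records
which variables remain available in later rounds. -/
theorem expect_chains_le (l : List (Finset V × (V → Bool))) {W K : ℕ}
    (hl : ∀ τ ∈ l, τ.1.card ≤ W) (k : ℕ) (f : V → Bool) (U : Finset V) :
    𝔼 c : V → Fin (K + 1), chains l k f (zeros c ∩ U) ≤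
      ((1 + 4 / (K + 1)) ^ W - 1) ^ k := by
  induction k generalizing f U with
  | zero => simp [chains]
  | succ k ih =>
    have hB : (0 : ℝ) ≤ (1 + 4 / (K + 1)) ^ W - 1 := by
      have : (1 : ℝ) ≤ (1 + 4 / (K + 1)) ^ W := one_le_pow₀ (by
        have : (0 : ℝ) ≤ 4 / (K + 1) := by positivity
        linarith)
      linarith
    simp only [chains]
    split
    · simpa using pow_nonneg hB _
    · rename_i τ hτ
      have hτW : τ.1.card ≤ W := hl τ (List.mem_of_find?_eq_some hτ)
      rw [expect_sum_comm]
      have hterm : ∀ S ∈ τ.1.powerset.erase ∅,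
          (𝔼 c : V → Fin (K + 1), if S ⊆ zeros c ∩ U then
            4 ^ S.card * 𝔼 π : V → Bool, chains l k (S.piecewise π f) ((zeros c ∩ U) \ S) else 0)
          ≤ (4 / (K + 1)) ^ S.card * ((1 + 4 / (K + 1)) ^ W - 1) ^ k := by
        intro S _
        set H : Finset V → ℝ := fun Λ => 𝔼 π : V → Bool, chains l k (S.piecewise π f) Λ with hH
        have hH0 : ∀ Λ, 0 ≤ H Λ := fun Λ => expect_nonneg fun π _ => chains_nonneg _ _ _ _
        have h1 : ∀ c : V → Fin (K + 1), (if S ⊆ zeros c ∩ U then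
            4 ^ S.card * H ((zeros c ∩ U) \ S) else 0) ≤
            if ∀ v ∈ S, c v = 0 then 4 ^ S.card * H (zeros c ∩ (U \ S)) else 0 := by
          intro c
          have e : (zeros c ∩ U) \ S = zeros c ∩ (U \ S) := by
            ext; simp only [mem_sdiff, mem_inter]; tauto
          rw [e]
          by_cases h : S ⊆ zeros c ∩ U
          · have : ∀ v ∈ S, c v = 0 := fun v hv => by
              have := (mem_inter.1 (h hv)).1
              simpa [zeros] using this
            rw [if_pos h, if_pos this]
          · rw [if_neg h]
            split_ifs
            · exact mul_nonneg (by positivity) (hH0 _)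
            · exact le_rfl
        refine (expect_le_expect fun c _ => h1 c).trans ?_
        -- Conditioning on `c = 0` on `S` leaves `c` uniform elsewhere, and the rest of the chain
        -- looks only at `U \ S`.
        rw [expect_indicator_eq S (fun _ => (0 : Fin (K + 1)))
          (fun c => 4 ^ S.card * H (zeros c ∩ (U \ S)))]
        have h2 : ∀ c : V → Fin (K + 1),
            zeros (S.piecewise (fun _ => (0 : Fin (K + 1))) c) ∩ (U \ S) = zeros c ∩ (U \ S) := by
          intro c
          ext v
          by_cases hv : v ∈ S <;> simp [zeros, hv]
        simp only [h2]
        rw [← mul_expect, ← mul_assoc, ← mul_pow]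
        have h3 : ((Fintype.card (Fin (K + 1)) : ℝ)⁻¹ * 4) = 4 / (K + 1) := by
          simp; ring
        rw [h3]
        refine mul_le_mul_of_nonneg_left ?_ (by positivity)
        rw [hH, expect_comm]
        exact expect_le_of_le fun π => ih _ _
      refine (sum_le_sum hterm).trans ?_
      rw [← sum_mul, pow_succ']
      refine mul_le_mul_of_nonneg_right ?_ (pow_nonneg hB _)
      have h4 : ∑ S ∈ τ.1.powerset, (4 / (K + 1) : ℝ) ^ S.card = (1 + 4 / (K + 1)) ^ τ.1.card := by
        have := Finset.sum_pow_mul_eq_add_pow (4 / (K + 1) : ℝ) 1 τ.1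
        simpa [add_comm] using this
      rw [Finset.sum_erase_eq_sub (by simp), h4]
      simp only [card_empty, pow_zero, tsub_le_iff_right, sub_add_cancel]
      exact pow_le_pow_right₀ (by
        have : (0 : ℝ) ≤ 4 / (K + 1) := by positivity
        linarith) hτW

theorem find?_eq_of_imp {α : Type*} {p q : α → Bool} {l : List α} {a : α}
    (h : l.find? p = some a) (hq : q a = true) (hqp : ∀ x, q x = true → p x = true) :
    l.find? q = some a := by
  induction l with
  | nil => simp at h
  | cons x l ih =>
    rw [List.find?_cons] at h ⊢
    by_cases hx : p x = true
    · rw [hx] at h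
      simp only [Option.some.injEq] at h
      subst h
      simp [hq]
    · have hqx : ¬ q x = true := fun h => hx (hqp x h)
      simp only [Bool.not_eq_true] at hx hqx
      rw [hx] at h
      rw [hqx]
      exact ih h

/-- A restriction to `Λ` under which a disjunctive normal form is not a shallow decision tree
admits a chain. -/
theorem one_le_expect_chains (l : List (Finset V × (V → Bool))) {W : ℕ}
    (hl : ∀ τ ∈ l, τ.1.card ≤ W) {F : (V → Bool) → Bool}
    (hF : ∀ f, F f = true ↔ ∃ τ ∈ l, Sat τ f) (k : ℕ) (f : V → Bool) (Λ : Finset V)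
    (hbad : ¬ HasDepth (k * W) fun g => F (Λ.piecewise g f)) :
    1 ≤ 𝔼 g : V → Bool, chains l k (Λ.piecewise g f) Λ := by
  induction k generalizing f Λ with
  | zero => simp [chains]
  | succ k ih =>
    -- The terms not yet falsified by the restriction. If there is none the restricted function is
    -- constantly `false`; if the first one has no free variable it is constantly `true`.
    let p : Finset V × (V → Bool) → Bool := fun τ => decide (∀ v ∈ τ.1, v ∉ Λ → f v = τ.2 v)
    have hp : ∀ g τ, Sat τ (Λ.piecewise g f) → p τ = true := by
      intro g τ h
      refine decide_eq_true fun v hv hvΛ => ?_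
      simpa [hvΛ] using h v hv
    cases hτ : l.find? p with
    | none =>
      exfalso
      apply hbad
      have : (fun g => F (Λ.piecewise g f)) = fun _ => false := by
        funext g
        rw [Bool.eq_false_iff, ne_eq, hF]
        rintro ⟨τ, h1, h2⟩
        exact (List.find?_eq_none.1 hτ τ h1) (hp g τ h2)
      rw [this]
      exact .const _ _
    | some τ =>
      have hmem := List.mem_of_find?_eq_some hτ
      have hpτ : ∀ v ∈ τ.1, v ∉ Λ → f v = τ.2 v := by
        simpa [p] using List.find?_some hτ
      set S := τ.1 ∩ Λ with hS
      have hSΛ : S ⊆ Λ := inter_subset_right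
      have hsat : ∀ g : V → Bool, (∀ v ∈ S, g v = τ.2 v) → Sat τ (Λ.piecewise g f) := by
        intro g hg v hv
        by_cases h : v ∈ Λ
        · simpa [h] using hg v (mem_inter.2 ⟨hv, h⟩)
        · simpa [h] using hpτ v hv h
      have hSne : S ≠ ∅ := by
        intro h0
        apply hbad
        have : (fun g => F (Λ.piecewise g f)) = fun _ => true := by
          funext g
          rw [hF]
          exact ⟨τ, hmem, hsat g (by simp [h0])⟩
        rw [this]
        exact .const _ _
      have hScard : S.card ≤ W := (card_le_card inter_subset_left).trans (hl τ hmem)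
      -- If every assignment to `S` left depth at most `k * W`, querying the at most `W` variables
      -- of `S` first would contradict `hbad`. So some assignment `π` leaves a bad restriction.
      obtain ⟨π, hπ⟩ : ∃ π : V → Bool,
          ¬ HasDepth (k * W) fun g => F ((Λ \ S).piecewise g (S.piecewise π f)) := by
        by_contra! h
        exact hbad ((hasDepth_of_forall_piecewise hSΛ h).mono (by rw [Nat.succ_mul]; omega))
      have h1 := ih (S.piecewise π f) (Λ \ S) hπ
      refine h1.trans ?_
      set H : (V → Bool) → ℝ := fun y => chains l k y (Λ \ S) with hH
      have hH0 : ∀ y, 0 ≤ H y := fun y => chains_nonneg _ _ _ _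
      -- A uniform guess agrees with the bad assignment `π` on `S` with probability `2^{-|S|}`. This
      -- is one half of the weight `4^{|S|}`; the other half pays for a random `g` agreeing with the
      -- term on `S`.
      have h2 : ∀ y : V → Bool, (2⁻¹ : ℝ) ^ S.card * H (S.piecewise π y)
          ≤ 𝔼 π' : V → Bool, H (S.piecewise π' y) := by
        intro y
        have := expect_indicator_eq S π (fun π' => H (S.piecewise π' y))
        have e : ∀ g : V → Bool, S.piecewise (S.piecewise π g) y = S.piecewise π y := by
          intro g; ext v; by_cases hv : v ∈ S <;> simp [hv]
        simp only [e, Fintype.card_bool, expect_const univ_nonempty] at this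
        push_cast at this
        rw [← this]
        refine expect_le_expect fun g _ => ?_
        split_ifs
        · exact le_rfl
        · exact hH0 _
      have h3 : ∀ g : V → Bool, (if ∀ v ∈ S, g v = τ.2 v then
          4 ^ S.card * 𝔼 π' : V → Bool, H (S.piecewise π' (Λ.piecewise g f)) else 0)
          ≤ chains l (k + 1) (Λ.piecewise g f) Λ := by
        intro g
        split_ifs with hg
        -- A satisfied term is never falsified by the restriction. So the first unfalsified term,
        -- once satisfied, is also the first satisfied one, and it can be read off from the full
        -- assignment.
        · have hfind : l.find? (fun τ' => decide (Sat τ' (Λ.piecewise g f))) = some τ :=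
            find?_eq_of_imp hτ (decide_eq_true (hsat g hg)) fun x hx =>
              hp g x (of_decide_eq_true hx)
          rw [chains, hfind]
          have := single_le_sum (f := fun S => if S ⊆ Λ then 4 ^ S.card *
              𝔼 π' : V → Bool, chains l k (S.piecewise π' (Λ.piecewise g f)) (Λ \ S) else 0)
            (s := τ.1.powerset.erase ∅) (fun S _ => by
              split_ifs
              · exact mul_nonneg (by positivity) (expect_nonneg fun π _ => chains_nonneg _ _ _ _)
              · exact le_rfl)
            (mem_erase.2 ⟨hSne, mem_powerset.2 (inter_subset_left : S ⊆ τ.1)⟩)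
          simpa [hSΛ] using this
        · exact chains_nonneg _ _ _ _
      refine le_trans ?_ (expect_le_expect fun g _ => h3 g)
      rw [expect_indicator_eq S τ.2 (fun g =>
        4 ^ S.card * 𝔼 π' : V → Bool, H (S.piecewise π' (Λ.piecewise g f)))]
      have e : ∀ g π' : V → Bool, S.piecewise π' (Λ.piecewise (S.piecewise τ.2 g) f)
          = S.piecewise π' (Λ.piecewise g f) := by
        intro g π'; ext v; by_cases hv : v ∈ S <;> by_cases h : v ∈ Λ <;> simp [hv, h]
      simp only [e, Fintype.card_bool]
      rw [← mul_expect, ← mul_assoc, ← mul_pow, mul_expect]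
      refine expect_le_expect fun g _ => ?_
      have e2 : (Λ \ S).piecewise g (S.piecewise π f) = S.piecewise π (Λ.piecewise g f) := by
        ext v; by_cases hv : v ∈ S <;> by_cases h : v ∈ Λ <;> simp [hv, h]
      rw [e2]
      have h5 := mul_le_mul_of_nonneg_left (h2 (Λ.piecewise g f))
        (show (0 : ℝ) ≤ ((2 : ℕ) : ℝ)⁻¹ ^ S.card * 4 ^ S.card * 1 by positivity)
      rw [mul_one] at h5
      rw [mul_pow]
      refine le_trans (le_of_eq ?_) h5
      rw [← mul_assoc, ← mul_pow, ← mul_pow]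
      norm_num
      rfl

open Classical in
/-- A disjunctive normal form of width `W` becomes a shallow decision tree under a random
restriction. -/
theorem switching_lemma {W K : ℕ} {F : (V → Bool) → Bool} (h : HasDNF W F) (k : ℕ) :
    𝔼 c : V → Fin (K + 1), 𝔼 f : V → Bool,
      (if HasDepth (k * W) fun g => F ((zeros c).piecewise g f) then (0 : ℝ) else 1) ≤
      ((1 + 4 / (K + 1)) ^ W - 1) ^ k := by
  obtain ⟨l, hl, hF⟩ := h
  calc _ ≤ 𝔼 c : V → Fin (K + 1), 𝔼 f : V → Bool, 𝔼 g : V → Bool,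
        chains l k ((zeros c).piecewise g f) (zeros c) := by
        -- A bad restriction has average chain weight at least 1, so that weight dominates its
        -- indicator. Afterwards `f` rerandomized on the free set is again uniform.
        refine expect_le_expect fun c _ => expect_le_expect fun f _ => ?_
        split_ifs with hd
        · exact expect_nonneg fun g _ => chains_nonneg _ _ _ _
        · exact one_le_expect_chains l hl hF k f _ hd
    _ = 𝔼 c : V → Fin (K + 1), 𝔼 f : V → Bool, chains l k f (zeros c) := by
        refine expect_congr rfl fun c _ => ?_
        exact expect_expect_piecewise (zeros c) fun f => chains l k f (zeros c)
    _ = 𝔼 f : V → Bool, 𝔼 c : V → Fin (K + 1), chains l k f (zeros c) := expect_comm _ _ _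
    _ ≤ _ := expect_le_of_le fun f => by
        simpa using expect_chains_le (K := K) l hl k f univ

end Switching
end BQPvsPH

namespace BQPvsPH
open Finset
open scoped BigOperators

/-! ## Iterated random restrictions -/

section RandomSets

variable {V : Type*} [Fintype V] [DecidableEq V]

/-- The average over the random set that is the intersection of independent sets, one for each
`K` of the list, that contain every element with probability `1 / (K + 1)`. -/
noncomputable def setAvg : List ℕ → (Finset V → ℝ) → ℝ
  | [], h => h univ
  | K :: Ks, h => setAvg Ks fun Λ => 𝔼 c : V → Fin (K + 1), h (Λ ∩ zeros c)

theorem setAvg_mono {Ks : List ℕ} {h h' : Finset V → ℝ} (H : ∀ Λ, h Λ ≤ h' Λ) :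
    setAvg Ks h ≤ setAvg Ks h' := by
  induction Ks generalizing h h' with
  | nil => exact H _
  | cons K Ks ih => exact ih fun Λ => expect_le_expect fun c _ => H _

theorem setAvg_add (Ks : List ℕ) (h h' : Finset V → ℝ) :
    setAvg Ks (fun Λ => h Λ + h' Λ) = setAvg Ks h + setAvg Ks h' := by
  induction Ks generalizing h h' with
  | nil => rfl
  | cons K Ks ih => simp only [setAvg, expect_add_distrib, ih]

theorem setAvg_mul (Ks : List ℕ) (a : ℝ) (h : Finset V → ℝ) :
    setAvg Ks (fun Λ => a * h Λ) = a * setAvg Ks h := by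
  induction Ks generalizing h with
  | nil => rfl
  | cons K Ks ih => simp only [setAvg, ← mul_expect, ih]

theorem setAvg_const (Ks : List ℕ) (a : ℝ) :
    setAvg Ks (fun _ : Finset V => a) = a := by
  induction Ks with
  | nil => rfl
  | cons K Ks ih => simpa [setAvg, expect_const univ_nonempty] using ih

theorem setAvg_expect {ι : Type*} (s : Finset ι) (Ks : List ℕ) (h : ι → Finset V → ℝ) :
    setAvg Ks (fun Λ => 𝔼 i ∈ s, h i Λ) = 𝔼 i ∈ s, setAvg Ks (h i) := by
  induction Ks generalizing h with
  | nil => rfl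
  | cons K Ks ih =>
    simp only [setAvg]
    rw [← ih]
    congr 1
    funext Λ
    exact expect_comm _ _ _

theorem setAvg_sum {ι : Type*} (s : Finset ι) (Ks : List ℕ) (h : ι → Finset V → ℝ) :
    setAvg Ks (fun Λ => ∑ i ∈ s, h i Λ) = ∑ i ∈ s, setAvg Ks (h i) := by
  induction Ks generalizing h with
  | nil => rfl
  | cons K Ks ih =>
    simp only [setAvg]
    rw [← ih]
    congr 1
    funext Λ
    exact expect_sum_comm _ _ _

/-- The probability that an element belongs to the random set of `setAvg`. -/
noncomputable def survival (Ks : List ℕ) : ℝ := (((Ks.map (· + 1)).prod : ℕ) : ℝ)⁻¹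

theorem setAvg_subset (Ks : List ℕ) (S : Finset V) :
    setAvg Ks (fun Λ => if S ⊆ Λ then (1 : ℝ) else 0) = survival Ks ^ S.card := by
  induction Ks with
  | nil => simp [setAvg, survival]
  | cons K Ks ih =>
    have h1 : ∀ Λ : Finset V, (𝔼 c : V → Fin (K + 1), if S ⊆ Λ ∩ zeros c then (1 : ℝ) else 0)
        = ((K : ℝ) + 1)⁻¹ ^ S.card * if S ⊆ Λ then 1 else 0 := by
      intro Λ
      have := expect_indicator_eq S (fun _ => (0 : Fin (K + 1)))
        (fun _ => if S ⊆ Λ then (1 : ℝ) else 0)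
      rw [expect_const univ_nonempty, Fintype.card_fin] at this
      push_cast at this
      rw [← this]
      refine expect_congr rfl fun c _ => ?_
      have : S ⊆ Λ ∩ zeros c ↔ (∀ v ∈ S, c v = 0) ∧ S ⊆ Λ := by
        rw [subset_inter_iff, and_comm]
        simp [zeros, Finset.subset_iff]
      simp only [this, ite_and]
    simp only [setAvg, h1, setAvg_mul, ih]
    simp [survival, mul_pow, mul_comm]

end RandomSets

/-! ## Oracle machines as decision trees -/

/-- Separates the oracle from the machine: the next configuration is chosen from two fixed ones by
one oracle bit, and equal ones serve for instructions without a query. The stack bound limits the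
lengths of later queries. -/
theorem step_eq_ite (P : List Instr) (c : Config) : ∃ (s : ℕ) (c₀ c₁ : Config),
    (∀ A, step A P c = if A (c.stack s) then c₁ else c₀) ∧
    ∀ r, (c₀.stack r).length ≤ (c.stack r).length + 1 ∧
      (c₁.stack r).length ≤ (c.stack r).length + 1 := by
  have key : ∀ c', (∀ A, step A P c = c') →
      (∀ r, (c'.stack r).length ≤ (c.stack r).length + 1) → ∃ (s : ℕ) (c₀ c₁ : Config),
    (∀ A, step A P c = if A (c.stack s) then c₁ else c₀) ∧
    ∀ r, (c₀.stack r).length ≤ (c.stack r).length + 1 ∧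
      (c₁.stack r).length ≤ (c.stack r).length + 1 :=
    fun c' h h' => ⟨0, c', c', fun A => by simp [h], fun r => ⟨h' r, h' r⟩⟩
  rcases hi : P[c.pc]? with _ | i
  · exact key c (fun A => by simp [step, hi]) fun r => Nat.le_succ _
  · rcases i with ⟨s, b⟩ | ⟨s, e, f, t⟩ | ⟨s, f, t⟩
    · refine key _ (fun A => by simp only [step, hi]; rfl) fun r => ?_
      by_cases h : r = s
      · subst h; simp
      · simp [h]
    · rcases hs : c.stack s with _ | ⟨_ | _, l⟩
      · exact key ⟨e, c.stack⟩ (fun A => by simp [step, hi, hs]) fun r => Nat.le_succ _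
      · refine key ⟨f, Function.update c.stack s l⟩ (fun A => by simp [step, hi, hs]) fun r => ?_
        by_cases h : r = s
        · subst h; simp [hs]; omega
        · simp [h]
      · refine key ⟨t, Function.update c.stack s l⟩ (fun A => by simp [step, hi, hs]) fun r => ?_
        by_cases h : r = s
        · subst h; simp [hs]; omega
        · simp [h]
    · refine ⟨s, ⟨f, c.stack⟩, ⟨t, c.stack⟩, fun A => ?_, fun r => ⟨Nat.le_succ _, Nat.le_succ _⟩⟩
      simp only [step, hi]
      split_ifs <;> rfl

/-- A stack gains at most one bit per step, so all queries within the remaining time have length at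
most `L`. -/
theorem step_iterate_congr {A B : Oracle} {L : ℕ} (h : ∀ s : List Bool, s.length ≤ L → A s = B s)
    (P : List Instr) (T : ℕ) (c : Config) (hc : ∀ r, (c.stack r).length + T ≤ L) :
    (step A P)^[T] c = (step B P)^[T] c := by
  induction T generalizing c with
  | zero => rfl
  | succ T ih =>
    obtain ⟨s, c₀, c₁, h1, h2⟩ := step_eq_ite P c
    rw [Function.iterate_succ_apply, Function.iterate_succ_apply, h1 A, h1 B,
      h _ (by have := hc s; omega)]
    refine ih _ fun r => ?_
    have := hc r
    have := h2 r
    split_ifs <;> omega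

theorem startConfig_length (x y : List Bool) (r : ℕ) :
    ((startConfig x y).stack r).length ≤ x.length + y.length := by
  simp only [startConfig]
  split_ifs <;> simp

theorem Machine.eval_congr {A B : Oracle} (M : Machine) (x y : List Bool)
    (h : ∀ s : List Bool,
      s.length ≤ x.length + y.length + polyBound M.k (x.length + y.length) → A s = B s) :
    M.eval A x y = M.eval B x y := by
  rw [Machine.eval, Machine.eval, step_iterate_congr h]
  intro r
  have := startConfig_length x y r
  omega

theorem polyBound_mono (k : ℕ) {n m : ℕ} (h : n ≤ m) : polyBound k n ≤ polyBound k m :=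
  Nat.add_le_add_right (Nat.pow_le_pow_left h k) k

theorem PHMachine.lang_base (M : Machine) (A : Oracle) (x : List Bool) :
    (PHMachine.base M).lang A x = decide (M.eval A x [] = [true]) := by
  rw [PHMachine.lang]
  exact @Bool.decide_congr _ _ (Classical.propDecidable _) _ Iff.rfl

theorem PHMachine.lang_next (N : NPMachine) (S : PHMachine) (A : Oracle) (x : List Bool) :
    (PHMachine.next N S).lang A x = true ↔ N.Accepts (S.lang A) x := by
  simp [PHMachine.lang]

/-- A machine of the hierarchy depends, on inputs of bounded length, only on the oracle at strings
of bounded length. -/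
theorem PHMachine.exists_lang_congr (S : PHMachine) (l : ℕ) : ∃ L, ∀ A B : Oracle,
    (∀ s : List Bool, s.length ≤ L → A s = B s) →
      ∀ x : List Bool, x.length ≤ l → S.lang A x = S.lang B x := by
  induction S generalizing l with
  | base M =>
    refine ⟨l + polyBound M.k l, fun A B h x hx => ?_⟩
    rw [PHMachine.lang_base, PHMachine.lang_base, M.eval_congr (A := A) (B := B)]
    intro s hs
    refine h s (hs.trans ?_)
    simp only [List.length_nil, add_zero]
    exact Nat.add_le_add hx (polyBound_mono _ hx)
  | next N S ih =>
    set l' := l + polyBound N.wit l with hl'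
    obtain ⟨L, hL⟩ := ih (l' + polyBound N.verifier.k l')
    refine ⟨L, fun A B h x hx => ?_⟩
    rw [Bool.eq_iff_iff, PHMachine.lang_next, PHMachine.lang_next]
    refine (exists_congr fun w => and_congr_right fun hw => ?_)
    rw [Machine.Accepts, Machine.Accepts, N.verifier.eval_congr]
    intro s hs
    refine hL A B h s (hs.trans ?_)
    have : x.length + w.length ≤ l' := by
      rw [hw]; exact Nat.add_le_add hx (polyBound_mono _ hx)
    exact Nat.add_le_add this (polyBound_mono _ this)

/-! ### Restricting one level of the hierarchy after another -/

section

variable {V : Type*} [Fintype V] [DecidableEq V]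

/-- Each of the `T` steps consults at most one string of the oracle, whose bit costs a tree of depth
`d`; the trees are composed by `HasDepth.bind`. -/
theorem hasDepth_step_iterate {O : (V → Bool) → Oracle} {d L : ℕ}
    (hO : ∀ s : List Bool, s.length ≤ L → HasDepth d fun f => O f s)
    (P : List Instr) (T : ℕ) (c : Config) (hc : ∀ r, (c.stack r).length + T ≤ L) :
    HasDepth (T * d) fun f => (step (O f) P)^[T] c := by
  induction T generalizing c with
  | zero => exact .const _ _
  | succ T ih =>
    obtain ⟨s, c₀, c₁, h1, h2⟩ := step_eq_ite P c
    have hs := hO (c.stack s) (by have := hc s; omega)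
    have := hs.bind (s := T * d)
      (G := fun b f => (step (O f) P)^[T] (if b = true then c₁ else c₀)) fun b => by
        refine ih _ fun r => ?_
        have := hc r
        have := h2 r
        split_ifs <;> omega
    rw [Nat.succ_mul, add_comm]
    simpa only [Function.iterate_succ_apply, h1] using this

theorem hasDepth_eval {O : (V → Bool) → Oracle} {d l L : ℕ} (M : Machine) {x y : List Bool}
    (hl : x.length + y.length ≤ l) (hL : l + polyBound M.k l ≤ L)
    (hO : ∀ s : List Bool, s.length ≤ L → HasDepth d fun f => O f s) :
    HasDepth (polyBound M.k l * d) fun f => M.eval (O f) x y := by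
  have h := (hasDepth_step_iterate hO M.program (polyBound M.k (x.length + y.length))
    (startConfig x y) fun r => by
      have := startConfig_length x y r
      have := polyBound_mono M.k hl
      omega).map fun c => c.stack 2
  exact h.mono (Nat.mul_le_mul_right _ (polyBound_mono _ hl))

/-- Under the restriction to `Λ` by `f`, the machine `S` decides strings of length at most `l` by
decision trees of depth `d`. -/
def Shallow (S : PHMachine) (O : (V → Bool) → Oracle) (l d : ℕ) (f : V → Bool) (Λ : Finset V) :
    Prop :=
  ∀ x : List Bool, x.length ≤ l → HasDepth d fun g => S.lang (O (Λ.piecewise g f)) x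

/-- The choice `K = 12 W` makes `4 W / (K + 1) ≤ 1/3`, and `exp (1/3) ≤ 1 / (1 - 1/3) = 3/2`. Thus
each round of the switching lemma gains a factor 1/2. -/
theorem pow_sub_one_le (W : ℕ) : (1 + 4 / (((12 * W : ℕ) : ℝ) + 1)) ^ W - 1 ≤ (1 / 2 : ℝ) := by
  set x : ℝ := 4 / (((12 * W : ℕ) : ℝ) + 1) with hx
  have hW : (W : ℝ) * x ≤ 1 / 3 := by
    rw [hx, mul_div_assoc', div_le_div_iff₀ (by positivity) (by norm_num)]
    push_cast
    linarith
  have h0 : 0 ≤ (W : ℝ) * x := by positivity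
  have h1 : (1 + x) ^ W ≤ Real.exp (W * x) := by
    rw [Real.exp_nat_mul]
    have := Real.add_one_le_exp x
    exact pow_le_pow_left₀ (by positivity) (by linarith) _
  have h2 := Real.exp_bound_div_one_sub_of_interval h0 (by linarith)
  have h3 : 1 / (1 - (W : ℝ) * x) ≤ 3 / 2 := by
    rw [div_le_div_iff₀ (by linarith) (by norm_num)]; linarith
  linarith

open Classical in
-- The induction step over the hierarchy. If `S` is shallow on all strings the verifier can query,
-- then acceptance of a fixed input is a disjunction over witnesses of trees of depth `W`, hence a
-- normal form of width `W`. A further restriction makes it shallow, and a union bound covers the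
-- inputs of length at most `l`.
theorem expect_not_shallow_le {S : PHMachine} {N : NPMachine} {O : (V → Bool) → Oracle}
    {l m L d n : ℕ} (hm : l + polyBound N.wit l ≤ m) (hL : m + polyBound N.verifier.k m ≤ L)
    (Λ : Finset V) :
    𝔼 c : V → Fin (12 * (polyBound N.verifier.k m * d) + 1), 𝔼 f : V → Bool,
      (if Shallow (.next N S) O l ((l + 1 + 2 * n) * (polyBound N.verifier.k m * d)) f
        (Λ ∩ zeros c) then (0 : ℝ) else 1) ≤
    (𝔼 f : V → Bool, if Shallow S O L d f Λ then (0 : ℝ) else 1) + 1 / 4 ^ n := by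
  set W := polyBound N.verifier.k m * d with hW
  -- There are fewer than `2^(l+1)` inputs and each fails with probability at most `2^{-k}`, which
  -- leaves `4^{-n}` in total.
  set k := l + 1 + 2 * n with hk
  have hpw : ∀ (f g h : V → Bool) (Θ : Finset V),
      (Λ ∩ Θ).piecewise h (Λ.piecewise g f) = Λ.piecewise (Θ.piecewise h g) f := by
    intro f g h Θ
    ext v
    by_cases h1 : v ∈ Λ <;> by_cases h2 : v ∈ Θ <;> simp [h1, h2]
  rw [expect_comm]
  -- Shallowness under `Λ` depends only on `f` off `Λ`. With these values fixed, the values on `Λ`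
  -- are drawn afresh for the next restriction.
  rw [← expect_expect_piecewise Λ (fun f => 𝔼 c : V → Fin (12 * W + 1),
    if Shallow (.next N S) O l (k * W) f (Λ ∩ zeros c) then (0 : ℝ) else 1)]
  have hrhs : (𝔼 f : V → Bool, if Shallow S O L d f Λ then (0 : ℝ) else 1) + 1 / 4 ^ n
      = 𝔼 f : V → Bool, ((if Shallow S O L d f Λ then (0 : ℝ) else 1) + 1 / 4 ^ n) := by
    rw [expect_add_distrib, expect_const univ_nonempty]
  rw [hrhs]
  refine expect_le_expect fun f _ => ?_
  by_cases hf : Shallow S O L d f Λ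
  · rw [if_pos hf, zero_add]
    -- the language of `S` is given by narrow normal forms
    have hdnf : ∀ x : List Bool, x.length ≤ l →
        HasDNF W fun g => (PHMachine.next N S).lang (O (Λ.piecewise g f)) x := by
      intro x hx
      refine hasDNF_exists (ι := Fin (polyBound N.wit x.length) → Bool)
        (F := fun w g => decide (N.verifier.eval (S.lang (O (Λ.piecewise g f))) x (List.ofFn w) = [true]))
        (fun w => ?_) (fun g => ?_)
      · have hl : x.length + (List.ofFn w).length ≤ m := by
          rw [List.length_ofFn]
          exact (Nat.add_le_add hx (polyBound_mono _ hx)).trans hm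
        exact ((hasDepth_eval (O := fun g => S.lang (O (Λ.piecewise g f))) N.verifier hl hL
          hf).map fun o => decide (o = [true])).hasDNF
      · simp only [PHMachine.lang_next, NPMachine.Accepts, Machine.Accepts, decide_eq_true_eq]
        constructor
        · rintro ⟨w, hw, h⟩
          refine ⟨fun i => w.get (i.cast hw.symm), ?_⟩
          convert h
          apply List.ext_get (by simp [hw])
          intro i h1 h2
          simp
        · rintro ⟨w, h⟩
          exact ⟨_, List.length_ofFn, h⟩
    have hunion : ∀ (g : V → Bool) (c : V → Fin (12 * W + 1)),
        (if Shallow (.next N S) O l (k * W) (Λ.piecewise g f) (Λ ∩ zeros c) then (0 : ℝ) else 1) ≤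
        ∑ j ∈ range (l + 1), ∑ x : Fin j → Bool,
          if HasDepth (k * W) fun h => (PHMachine.next N S).lang
            (O (Λ.piecewise ((zeros c).piecewise h g) f)) (List.ofFn x) then (0 : ℝ) else 1 := by
      intro g c
      have h0 : ∀ j ∈ range (l + 1), 0 ≤ ∑ x : Fin j → Bool,
          if HasDepth (k * W) fun h => (PHMachine.next N S).lang
            (O (Λ.piecewise ((zeros c).piecewise h g) f)) (List.ofFn x) then (0 : ℝ) else 1 :=
        fun j _ => sum_nonneg fun x _ => by split_ifs <;> norm_num
      split_ifs with hS
      · exact sum_nonneg h0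
      · simp only [Shallow, hpw] at hS
        push Not at hS
        obtain ⟨x, hx, hd⟩ := hS
        refine le_trans ?_ (single_le_sum h0 (mem_range.2 (Nat.lt_succ_of_le hx)))
        refine le_trans ?_ (single_le_sum (fun x _ => by split_ifs <;> norm_num)
          (mem_univ (fun i => x.get i)))
        rw [if_neg]
        simpa using hd
    calc _ ≤ 𝔼 g : V → Bool, 𝔼 c : V → Fin (12 * W + 1), ∑ j ∈ range (l + 1),
            ∑ x : Fin j → Bool, (if HasDepth (k * W) fun h => (PHMachine.next N S).lang
            (O (Λ.piecewise ((zeros c).piecewise h g) f)) (List.ofFn x) then (0 : ℝ) else 1) :=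
          expect_le_expect fun g _ => expect_le_expect fun c _ => hunion g c
      _ = ∑ j ∈ range (l + 1), ∑ x : Fin j → Bool, 𝔼 c : V → Fin (12 * W + 1), 𝔼 g : V → Bool,
            (if HasDepth (k * W) fun h => (PHMachine.next N S).lang
            (O (Λ.piecewise ((zeros c).piecewise h g) f)) (List.ofFn x) then (0 : ℝ) else 1) := by
          rw [expect_comm]
          simp only [expect_sum_comm]
      _ ≤ ∑ j ∈ range (l + 1), ∑ x : Fin j → Bool, (1 / 2 : ℝ) ^ k := by
          refine sum_le_sum fun j hj => sum_le_sum fun x _ => ?_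
          refine (switching_lemma (hdnf (List.ofFn x) ?_) k).trans ?_
          · rw [List.length_ofFn]; exact Nat.lt_succ_iff.1 (mem_range.1 hj)
          · refine pow_le_pow_left₀ ?_ (pow_sub_one_le W) k
            have : (1 : ℝ) ≤ (1 + 4 / (((12 * W : ℕ) : ℝ) + 1)) ^ W := one_le_pow₀ (by
              have : (0 : ℝ) ≤ 4 / (((12 * W : ℕ) : ℝ) + 1) := by positivity
              linarith)
            linarith
      _ ≤ 2 ^ (l + 1) * (1 / 2 : ℝ) ^ k := by
          simp only [sum_const, card_univ, Fintype.card_pi, Fintype.card_bool, prod_const,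
            Fintype.card_fin, nsmul_eq_mul, ← sum_mul]
          refine mul_le_mul_of_nonneg_right ?_ (by positivity)
          have : ∑ j ∈ range (l + 1), 2 ^ j ≤ 2 ^ (l + 1) := (Nat.geomSum_lt (le_refl 2)
            (fun j hj => mem_range.1 hj)).le
          exact_mod_cast this
      _ = 1 / 4 ^ n := by
          rw [hk, pow_add _ (l + 1), pow_mul, ← mul_assoc, ← mul_pow]
          norm_num
          rw [one_div, inv_pow]
  · rw [if_neg hf]
    have h1 : (0 : ℝ) ≤ 1 / 4 ^ n := by positivity
    have : 𝔼 g : V → Bool, 𝔼 c : V → Fin (12 * W + 1),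
        (if Shallow (.next N S) O l (k * W) (Λ.piecewise g f) (Λ ∩ zeros c) then (0 : ℝ) else 1)
        ≤ 1 := expect_le_of_le fun g => expect_le_of_le fun c => by split_ifs <;> norm_num
    linarith

end

open Polynomial in
open Classical in
/-- Random restrictions with polynomially small survival probability turn every machine of the
polynomial hierarchy into decision trees of polynomial depth. -/
theorem exists_restriction (S : PHMachine) (q : ℕ[X]) : ∃ (d κ : ℕ[X]) (D : ℕ), ∀ n : ℕ,
    ∃ Ks : List ℕ, (Ks.map (· + 1)).prod ≤ κ.eval n ∧
      ∀ (V : Type) [Fintype V] [DecidableEq V] (O : (V → Bool) → Oracle),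
        (∀ s, HasDepth 1 fun f => O f s) →
        setAvg Ks (fun Λ : Finset V => 𝔼 f : V → Bool,
          if Shallow S O (q.eval n) (d.eval n) f Λ then (0 : ℝ) else 1) ≤ D / 4 ^ n := by
  induction S generalizing q with
  | base M =>
    -- A deterministic machine is a tree without any restriction: the empty list, and no error.
    refine ⟨q ^ M.k + C M.k, 1, 0, fun n => ⟨[], by simp, fun V _ _ O hO => ?_⟩⟩
    have h : ∀ f Λ, Shallow (.base M) O (q.eval n) ((q ^ M.k + C M.k).eval n) f Λ := by
      intro f Λ x hx
      have := (hasDepth_eval (O := fun g => O (Λ.piecewise g f)) (d := 1) M (x := x) (y := [])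
        (l := q.eval n) (by simpa using hx) le_rfl fun s _ => (hO s).restrict Λ f).map
          fun o => decide (o = [true])
      simpa only [PHMachine.lang_base, polyBound, mul_one, eval_add, eval_pow, eval_C] using this
    simp only [h, setAvg, if_true]
    simp
  | next N S ih =>
    -- `m` bounds the length of an input with its witness and `τ` the running time of the verifier,
    -- so `m + τ` bounds the strings it asks the level below.
    set m : ℕ[X] := q + (q ^ N.wit + C N.wit) with hm
    set τ : ℕ[X] := m ^ N.verifier.k + C N.verifier.k with hτ
    obtain ⟨d, κ, D, h⟩ := ih (m + τ)
    -- The new width is `τ * d`: the new depth is `k` times it, the density drops by the factor `12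
    -- τ d + 1`, and the level adds one more `1 / 4^n` to the error.
    refine ⟨(q + 1 + 2 * X) * (τ * d), (12 * (τ * d) + 1) * κ, D + 1, fun n => ?_⟩
    obtain ⟨Ks, hKs, hV⟩ := h n
    have hτn : polyBound N.verifier.k (m.eval n) = τ.eval n := by simp [hτ, polyBound]
    refine ⟨12 * (polyBound N.verifier.k (m.eval n) * d.eval n) :: Ks, ?_, fun V _ _ O hO => ?_⟩
    · rw [List.map_cons, List.prod_cons, hτn]
      simp only [eval_mul, eval_add, eval_one, eval_ofNat]
      exact Nat.mul_le_mul_left _ hKs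
    · have h1 := expect_not_shallow_le (V := V) (S := S) (N := N) (O := O) (l := q.eval n)
        (m := m.eval n) (L := (m + τ).eval n) (d := d.eval n) (n := n)
        (by simp [hm, polyBound]) (by simp [hτ, polyBound])
      have h2 : ((q + 1 + 2 * X) * (τ * d)).eval n = (q.eval n + 1 + 2 * n) *
          (polyBound N.verifier.k (m.eval n) * d.eval n) := by
        rw [hτn]; simp
      rw [h2, setAvg]
      refine (setAvg_mono h1).trans ?_
      rw [setAvg_add, setAvg_const]
      have := hV V O hO
      push_cast
      rw [add_div]
      linarith
end BQPvsPH

namespace BQPvsPH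
open Finset
open scoped BigOperators

/-! ## Second moments of Fourier coefficients found by decision trees -/

/-- The sign that encodes a bit. -/
def sgn (b : Bool) : ℝ := if b then -1 else 1

theorem sgn_sq (b : Bool) : sgn b ^ 2 = 1 := by cases b <;> simp [sgn]

section SecondMoment

variable {V α : Type*} [Fintype V] [DecidableEq V]

theorem expect_eq_update (v : V) (h : (V → Bool) → ℝ) :
    𝔼 g : V → Bool, h g = ((𝔼 g : V → Bool, h (Function.update g v true)) +
      𝔼 g : V → Bool, h (Function.update g v false)) / 2 := by
  rw [expect_update, expect_update, ← mul_add, ← expect_add_distrib]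
  simp only [Fintype.card_bool, Nat.cast_ofNat]
  rw [mul_div_assoc, mul_div_left_comm, div_self two_ne_zero, mul_one]
  refine expect_congr rfl fun g _ => ?_
  cases g v <;> simp

theorem expect_sq_const (χ : V → ℝ) (hχ : ∀ v, χ v ^ 2 = 1) (Λ : Finset V) (c : ℝ) :
    𝔼 g : V → Bool, (c + ∑ v ∈ Λ, χ v * sgn (g v)) ^ 2 = Λ.card + c ^ 2 := by
  induction Λ using Finset.induction_on generalizing c with
  | empty => simp
  | insert v Λ hv ih =>
    rw [expect_eq_update v]
    have h : ∀ b, 𝔼 g : V → Bool,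
        (c + ∑ u ∈ insert v Λ, χ u * sgn (Function.update g v b u)) ^ 2
        = Λ.card + (c + χ v * sgn b) ^ 2 := by
      intro b
      rw [← ih (c + χ v * sgn b)]
      refine expect_congr rfl fun g _ => ?_
      rw [sum_insert hv, ← add_assoc, Function.update_self]
      congr 2
      refine sum_congr rfl fun u hu => ?_
      rw [Function.update_of_ne (ne_of_mem_of_not_mem hu hv)]
    rw [h, h, show sgn true = -1 from rfl, show sgn false = 1 from rfl,
      card_insert_of_notMem hv]
    push_cast
    linear_combination hχ v

/-- A queried bit in `Λ` moves from the random sum to the known constant, which changes by at most 1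
in absolute value. At a leaf the character is fixed and the unread signs are still independent, so
they contribute their number and the constant at most `(s + t)²`. -/
theorem HasDepth.expect_sq_le {t : ℕ} {Z : (V → Bool) → α} (hZ : HasDepth t Z)
    (χ : α → V → ℝ) (hχ : ∀ a v, χ a v ^ 2 = 1) (Λ : Finset V) (c : α → ℝ) (s : ℝ)
    (hc : ∀ a, |c a| ≤ s) :
    𝔼 g : V → Bool, (c (Z g) + ∑ v ∈ Λ, χ (Z g) v * sgn (g v)) ^ 2 ≤ Λ.card + (s + t) ^ 2 := by
  induction hZ generalizing Λ c s with
  | const t a =>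
    refine (expect_sq_const (χ a) (hχ a) Λ (c a)).trans_le ?_
    have h1 := hc a
    have h2 : |c a| ≤ s + t := h1.trans (by simp)
    have := sq_le_sq' (by linarith [neg_abs_le (c a)] : -(s + t) ≤ c a)
      ((le_abs_self _).trans h2)
    linarith
  | @query t Z v _ ih =>
    rw [expect_eq_update v]
    have h : ∀ b, 𝔼 g : V → Bool, (c (Z (Function.update g v b)) +
        ∑ u ∈ Λ, χ (Z (Function.update g v b)) u * sgn (Function.update g v b u)) ^ 2
        ≤ Λ.card + (s + 1 + t) ^ 2 := by
      intro b
      by_cases hv : v ∈ Λ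
      · refine le_trans (le_of_eq (expect_congr rfl fun g _ => ?_))
          ((ih b (Λ.erase v) (fun a => c a + χ a v * sgn b) (s + 1) fun a => ?_).trans ?_)
        · rw [← add_sum_erase _ _ hv, ← add_assoc, Function.update_self]
          congr 2
          refine sum_congr rfl fun u hu => ?_
          rw [Function.update_of_ne (ne_of_mem_erase hu)]
        · refine (abs_add_le _ _).trans (add_le_add (hc a) ?_)
          rw [← sq_le_one_iff_abs_le_one, mul_pow, hχ, sgn_sq, one_mul]
        · have : ((Λ.erase v).card : ℝ) ≤ Λ.card := by exact_mod_cast card_erase_le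
          linarith
      · refine le_trans (le_of_eq (expect_congr rfl fun g _ => ?_))
          (ih b Λ c (s + 1) fun a => (hc a).trans (by linarith))
        congr 2
        refine sum_congr rfl fun u hu => ?_
        rw [Function.update_of_ne (ne_of_mem_of_not_mem hu hv)]
    have h1 := h true
    have h2 := h false
    push_cast
    rw [show s + ((t : ℝ) + 1) = s + 1 + t by ring]
    linarith

/-- A diagonal pair survives with probability `P` and an off-diagonal one with `P²`. Hence sampling
loses no information about the square of the full sum except the explicit diagonal term. -/
theorem setAvg_sq (Ks : List ℕ) (B : Finset V) (x : V → ℝ) (hx : ∀ v, x v ^ 2 = 1) :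
    setAvg Ks (fun Λ => (∑ v ∈ Λ ∩ B, x v) ^ 2) =
      (survival Ks - survival Ks ^ 2) * B.card + survival Ks ^ 2 * (∑ v ∈ B, x v) ^ 2 := by
  have h1 : ∀ Λ : Finset V, (∑ v ∈ Λ ∩ B, x v) ^ 2
      = ∑ u ∈ B, ∑ v ∈ B, x u * x v * if {u, v} ⊆ Λ then (1 : ℝ) else 0 := by
    intro Λ
    rw [inter_comm, ← filter_mem_eq_inter, sum_filter, sq, sum_mul_sum]
    refine sum_congr rfl fun u _ => sum_congr rfl fun v _ => ?_
    by_cases hu : u ∈ Λ <;> by_cases hv : v ∈ Λ <;> simp [hu, hv, insert_subset_iff]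
  simp only [h1]
  rw [setAvg_sum]
  simp only [setAvg_sum, setAvg_mul, setAvg_subset]
  have h2 : ∀ u ∈ B, ∑ v ∈ B, x u * x v * survival Ks ^ ({u, v} : Finset V).card
      = (survival Ks - survival Ks ^ 2) + survival Ks ^ 2 * (x u * ∑ v ∈ B, x v) := by
    intro u hu
    rw [← add_sum_erase _ _ hu, ← add_sum_erase _ (fun v => x v) hu]
    have : ∑ v ∈ B.erase u, x u * x v * survival Ks ^ ({u, v} : Finset V).card
        = survival Ks ^ 2 * (x u * ∑ v ∈ B.erase u, x v) := by
      rw [mul_sum, mul_sum]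
      refine sum_congr rfl fun v hv => ?_
      rw [card_pair (ne_of_mem_erase hv).symm]
      ring
    rw [this]
    have := hx u
    simp only [pair_eq_singleton, card_singleton, pow_one]
    linear_combination (survival Ks - survival Ks ^ 2) * this
  rw [sum_congr rfl h2, sum_add_distrib, sum_const, nsmul_eq_mul, ← mul_sum, ← sum_mul]
  ring

open Classical in
/-- A function that becomes a shallow decision tree under random restrictions does not find large
Fourier coefficients. -/
theorem expect_sq_le_of_restriction {Ks : List ℕ} {B : Finset V} {Z : (V → Bool) → α}
    {χ : α → V → ℝ} (hχ : ∀ a v, χ a v ^ 2 = 1) {t : ℕ} {η : ℝ} (hP : 0 < survival Ks)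
    (hη : setAvg Ks (fun Λ : Finset V => 𝔼 f : V → Bool,
      if HasDepth t fun g => Z (Λ.piecewise g f) then (0 : ℝ) else 1) ≤ η) :
    𝔼 f : V → Bool, (∑ v ∈ B, χ (Z f) v * sgn (f v)) ^ 2 ≤
      B.card + (t ^ 2 + B.card ^ 2 * η) / survival Ks ^ 2 := by
  set P := survival Ks with hPdef
  have hx : ∀ f v, (χ (Z f) v * sgn (f v)) ^ 2 = 1 := fun f v => by
    rw [mul_pow, hχ, sgn_sq, one_mul]
  -- The function and the random set are independent. With `f` and so `Z f` fixed, the average over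
  -- `Λ` is given exactly by `setAvg_sq`.
  have hlow : setAvg Ks (fun Λ : Finset V => 𝔼 f : V → Bool,
      (∑ v ∈ Λ ∩ B, χ (Z f) v * sgn (f v)) ^ 2) = (P - P ^ 2) * B.card +
      P ^ 2 * 𝔼 f : V → Bool, (∑ v ∈ B, χ (Z f) v * sgn (f v)) ^ 2 := by
    rw [setAvg_expect]
    simp only [setAvg_sq Ks B _ (hx _)]
    rw [expect_add_distrib, expect_const univ_nonempty, ← mul_expect]
  -- Here `Λ` is fixed and `f` is rerandomized on it: shallow restrictions give the tree bound, the
  -- others the trivial bound `|B|²`.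
  have hup : ∀ Λ : Finset V, 𝔼 f : V → Bool, (∑ v ∈ Λ ∩ B, χ (Z f) v * sgn (f v)) ^ 2 ≤
      (((Λ ∩ B).card : ℝ) + t ^ 2) + (B.card : ℝ) ^ 2 * 𝔼 f : V → Bool,
        if HasDepth t fun g => Z (Λ.piecewise g f) then (0 : ℝ) else 1 := by
    intro Λ
    rw [← expect_expect_piecewise Λ, mul_expect]
    have e : ∀ y : ℝ, y = 𝔼 f : V → Bool, y := fun y => (expect_const univ_nonempty y).symm
    rw [e (((Λ ∩ B).card : ℝ) + t ^ 2), ← expect_add_distrib]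
    refine expect_le_expect fun f _ => ?_
    split_ifs with hd
    · have := hd.expect_sq_le χ hχ (Λ ∩ B) (fun _ => 0) 0 (by simp)
      simp only [zero_add] at this
      refine le_trans (le_of_eq (expect_congr rfl fun g _ => ?_)) (this.trans (by simp))
      congr 1
      refine sum_congr rfl fun v hv => ?_
      rw [piecewise_eq_of_mem _ _ _ (mem_inter.1 hv).1]
    · refine expect_le_of_le fun g => ?_
      have hb : |∑ v ∈ Λ ∩ B, χ (Z (Λ.piecewise g f)) v * sgn (Λ.piecewise g f v)| ≤ B.card := by
        refine (abs_sum_le_sum_abs _ _).trans ?_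
        have : ∀ v, |χ (Z (Λ.piecewise g f)) v * sgn (Λ.piecewise g f v)| ≤ 1 := fun v => by
          rw [← sq_le_one_iff_abs_le_one, hx]
        refine (sum_le_sum fun v _ => this v).trans ?_
        simp only [sum_const, nsmul_eq_mul, mul_one]
        exact_mod_cast card_le_card inter_subset_right
      have h2 := sq_le_sq' (neg_le_of_abs_le hb) (le_of_abs_le hb)
      have : (0 : ℝ) ≤ (Λ ∩ B).card + t ^ 2 := add_nonneg (Nat.cast_nonneg _) (sq_nonneg _)
      linarith
  have hcard : setAvg Ks (fun Λ : Finset V => ((Λ ∩ B).card : ℝ)) = P * B.card := by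
    have h1 : ∀ Λ : Finset V, ((Λ ∩ B).card : ℝ) = ∑ v ∈ B, if {v} ⊆ Λ then (1 : ℝ) else 0 := by
      intro Λ
      simp only [singleton_subset_iff]
      rw [inter_comm, ← filter_mem_eq_inter, sum_boole]
    simp only [h1]
    rw [setAvg_sum]
    simp only [setAvg_subset, card_singleton, pow_one, sum_const, nsmul_eq_mul]
    rw [mul_comm]
  have h1 := setAvg_mono (Ks := Ks) hup
  rw [hlow, setAvg_add, setAvg_add, setAvg_const, setAvg_mul, hcard] at h1
  have h2 := mul_le_mul_of_nonneg_left hη (by positivity : (0 : ℝ) ≤ (B.card : ℝ) ^ 2)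
  -- Since `P|B| - (P - P²)|B| = P²|B|`, division by `P²` leaves exactly `|B|` as main term. The
  -- constant 1 in front of it is what separates the bound from the 3/2 needed for a catch.
  rw [← sub_le_iff_le_add', le_div_iff₀ (by positivity)]
  nlinarith

end SecondMoment
end BQPvsPH

namespace BQPvsPH
open Finset
open scoped BigOperators

/-! ## The block of the oracle that encodes the functions for `n` -/

/-- The string of the oracle that encodes the value of the `i`-th function at `x`. -/
def blockString (n : ℕ) (v : Fin n × (Fin n → Bool)) : List Bool :=
  List.replicate v.1 true ++ List.replicate (n - v.1) false ++ List.ofFn v.2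

theorem blockString_injective (n : ℕ) : Function.Injective (blockString n) := by
  rintro ⟨i, x⟩ ⟨j, y⟩ h
  simp only [blockString] at h
  have hlen : (List.replicate (i : ℕ) true ++ List.replicate (n - i) false).length
      = (List.replicate (j : ℕ) true ++ List.replicate (n - j) false).length := by
    simp
  obtain ⟨h1, h2⟩ := List.append_inj h hlen
  have h3 := congrArg (List.count true) h1
  simp only [List.count_append, List.count_replicate_self, List.count_replicate] at h3
  have h4 : i = j := Fin.ext (by simpa using h3)
  rw [h4, List.ofFn_injective h2]

theorem length_blockString {n : ℕ} (v : Fin n × (Fin n → Bool)) :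
    (blockString n v).length = 2 * n := by
  simp [blockString]; omega

/-- The oracle `A` with the functions for `n` replaced by `f`. -/
noncomputable def withBlock (n : ℕ) (A : Oracle) (f : Fin n × (Fin n → Bool) → Bool) : Oracle :=
  Function.extend (blockString n) f A

theorem withBlock_blockString {n : ℕ} (A : Oracle) (f : Fin n × (Fin n → Bool) → Bool)
    (v : Fin n × (Fin n → Bool)) : withBlock n A f (blockString n v) = f v :=
  (blockString_injective n).extend_apply _ _ _

theorem hasDepth_withBlock (n : ℕ) (A : Oracle) (s : List Bool) :
    HasDepth 1 fun f => withBlock n A f s := by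
  by_cases h : ∃ v, blockString n v = s
  · obtain ⟨v, rfl⟩ := h
    simp only [withBlock_blockString]
    exact .query v fun b => by simpa using .const _ _
  · simp only [withBlock, Function.extend_apply' _ _ _ h]
    exact .const _ _

/-- The functions encoded by the values of a block. -/
def blockFun {n : ℕ} (f : Fin n × (Fin n → Bool) → Bool) (i : Fin n) (x : Fin n → Bool) : ℝ :=
  sgn (f (i, x))

theorem oracleFun_withBlock {n : ℕ} (A : Oracle) (f : Fin n × (Fin n → Bool) → Bool) :
    oracleFun (withBlock n A f) n = blockFun f := by
  funext i x
  exact congrArg sgn (withBlock_blockString A f (i, x))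

theorem oracleFun_eq_blockFun (A : Oracle) (n : ℕ) :
    oracleFun A n = blockFun fun v => A (blockString n v) := rfl

/-- The concatenation of the rows of an array of bits. -/
def concat {n : ℕ} (z : Fin n → Fin n → Bool) : List Bool :=
  (List.ofFn fun i => List.ofFn (z i)).flatten

/-- The rows of an array of bits, given as a list. -/
def rows (n : ℕ) (y : List Bool) (i j : Fin n) : Bool := y.getD (i * n + j) false

theorem concat_eq_ofFn {n : ℕ} (z : Fin n → Fin n → Bool) :
    concat z = List.ofFn fun k : Fin (n * n) =>
      z (finProdFinEquiv.symm k).1 (finProdFinEquiv.symm k).2 := by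
  rw [List.ofFn_mul, concat]
  congr 2
  funext i
  congr 1
  funext j
  have : (⟨i * n + j, by
      calc (i : ℕ) * n + j < i * n + n := by omega
        _ = (i + 1) * n := by ring
        _ ≤ n * n := Nat.mul_le_mul_right _ i.2⟩ : Fin (n * n)) = finProdFinEquiv (i, j) := by
    ext; simp [finProdFinEquiv]; ring
  rw [this]
  simp

theorem rows_concat {n : ℕ} (z : Fin n → Fin n → Bool) : rows n (concat z) = z := by
  funext i j
  have h : (i : ℕ) * n + j < n * n := by
    calc (i : ℕ) * n + j < i * n + n := by omega
      _ = (i + 1) * n := by ring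
      _ ≤ n * n := Nat.mul_le_mul_right _ i.2
  rw [rows, concat_eq_ofFn, List.getD_eq_getElem _ _ (by simpa using h), List.getElem_ofFn]
  have : (⟨i * n + j, h⟩ : Fin (n * n)) = finProdFinEquiv (i, j) := by
    ext; simp [finProdFinEquiv]; ring
  rw [this]
  simp

theorem concat_injective (n : ℕ) : Function.Injective (concat (n := n)) :=
  Function.LeftInverse.injective rows_concat

theorem concat_mem_catches {A : Oracle} {n : ℕ} (z : Fin n → Fin n → Bool) :
    concat z ∈ catches A n ↔ IsCatch (oracleFun A n) z := by
  constructor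
  · rintro ⟨z', h, hz⟩
    rwa [concat_injective n h]
  · exact fun h => ⟨z, rfl, h⟩

/-! ## The success probability of machines with an oracle from the hierarchy -/

/-- Pointwise `x²` is at least 1 for `|x| ≥ 1` and gains another 3 for `|x| ≥ 2`, so a catch has at
least `3/4 + 3 · 1/4` per index on average. -/
theorem IsCatch.sum_sq_ge {n : ℕ} {f : Fin n → (Fin n → Bool) → ℝ} {z : Fin n → Fin n → Bool}
    (h : IsCatch f z) : 3 / 2 * (n : ℝ) ≤ ∑ i, fourier (f i) (z i) ^ 2 := by
  classical
  have h1 := h.1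
  have h2 := h.2
  rw [Set.ncard_eq_toFinset_card', Set.toFinset_ofPred, ← sum_boole] at h1 h2
  have : ∑ i, ((if 1 ≤ |fourier (f i) (z i)| then (1 : ℝ) else 0) +
      3 * if 2 ≤ |fourier (f i) (z i)| then (1 : ℝ) else 0) ≤ ∑ i, fourier (f i) (z i) ^ 2 := by
    refine sum_le_sum fun i _ => ?_
    rw [← sq_abs]
    split_ifs <;> nlinarith [abs_nonneg (fourier (f i) (z i))]
  rw [sum_add_distrib, ← mul_sum] at this
  linarith

theorem fourier_blockFun_sq {n : ℕ} (f : Fin n × (Fin n → Bool) → Bool) (i : Fin n)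
    (z : Fin n → Bool) : fourier (blockFun f i) z ^ 2 =
      (∑ v ∈ univ.filter fun v : Fin n × (Fin n → Bool) => v.1 = i,
        (-1) ^ dot v.2 z * sgn (f v)) ^ 2 / 2 ^ n := by
  have : ∑ v ∈ univ.filter (fun v : Fin n × (Fin n → Bool) => v.1 = i),
      (-1) ^ dot v.2 z * sgn (f v) = ∑ x, (-1) ^ dot x z * blockFun f i x := by
    rw [sum_filter, Fintype.sum_prod_type, sum_eq_single i]
    · simp [blockFun]
    · intro j _ hj; simp [hj]
    · simp
  rw [fourier, this, mul_pow, div_pow, Real.sq_sqrt (by positivity)]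
  ring

theorem card_block {n : ℕ} (i : Fin n) :
    (univ.filter fun v : Fin n × (Fin n → Bool) => v.1 = i).card = 2 ^ n := by
  have : (univ.filter fun v : Fin n × (Fin n → Bool) => v.1 = i)
      = ({i} : Finset (Fin n)) ×ˢ (univ : Finset (Fin n → Bool)) := by
    ext ⟨j, x⟩; simp [eq_comm]
  rw [this, card_product]
  simp

theorem ProbMachine.prob_eq_expect (M : ProbMachine) (A : Oracle) (x : List Bool)
    (S : Set (List Bool)) [DecidablePred (· ∈ S)] : M.prob A x S =
      𝔼 r : Fin (polyBound M.coins x.length) → Bool,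
        if M.machine.eval A x (List.ofFn r) ∈ S then (1 : ℝ) else 0 := by
  rw [ProbMachine.prob, Finset.expect_eq_sum_div_card, sum_boole]
  simp only [card_univ, Fintype.card_pi, Fintype.card_bool, prod_const, Fintype.card_fin]
  push_cast
  congr 2
  refine congrArg card (filter_congr_decidable _ _ _)

open Polynomial in
open Classical in
-- With the coins fixed, the output is a single function of the block that becomes a shallow tree
-- under restriction. Applied to each `f_i` with the character of the `i`-th row of the output, the
-- second moment bound limits the expected sum of squares, while every success contributes at least
-- `3n/2`.
theorem exists_bound_prob (S : PHMachine) (M : ProbMachine) : ∃ (p : ℕ[X]), ∀ (n : ℕ) (A : Oracle),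
    𝔼 f : Fin n × (Fin n → Bool) → Bool, M.prob (S.lang (withBlock n A f))
      (List.replicate n false) (catches (withBlock n A f) n) * (3 / 2 * n) ≤
      n * (1 + p.eval n / 2 ^ n) := by
  set q : ℕ[X] := X + (X ^ M.coins + C M.coins) with hq
  set τ : ℕ[X] := q ^ M.machine.k + C M.machine.k with hτ
  obtain ⟨d, κ, D, h⟩ := exists_restriction S (q + τ)
  -- The error term `(t² + |B|² η) / P²` with `t = τ d`, `|B| = 2^n`, `η = D / 4^n` and `1 / P ≤ κ`.
  -- The failure probability `4^{-n}` cancels the square of the block size.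
  refine ⟨((τ * d) ^ 2 + C D) * κ ^ 2, fun n A => ?_⟩
  obtain ⟨Ks, hKs, hV⟩ := h n
  have hη := hV (Fin n × (Fin n → Bool)) (withBlock n A) (hasDepth_withBlock n A)
  have hprod : 0 < (Ks.map (· + 1)).prod := List.prod_pos (by simp)
  have hP : 0 < survival Ks := inv_pos.2 (by exact_mod_cast hprod)
  have hPκ : (survival Ks)⁻¹ ≤ κ.eval n := by
    rw [survival, inv_inv]; exact_mod_cast hKs
  set l := List.replicate n false with hl
  have hln : l.length = n := List.length_replicate
  set t := (τ * d).eval n with ht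
  -- the Fourier coefficients found with fixed coins
  have hcoins : ∀ r : Fin (polyBound M.coins l.length) → Bool, ∀ i : Fin n,
      𝔼 f : Fin n × (Fin n → Bool) → Bool, fourier (blockFun f i)
        (rows n (M.machine.eval (S.lang (withBlock n A f)) l (List.ofFn r)) i) ^ 2 ≤
      1 + ((((τ * d) ^ 2 + C D) * κ ^ 2 : ℕ[X]).eval n : ℕ) / 2 ^ n := by
    intro r i
    have h1 := expect_sq_le_of_restriction (V := Fin n × (Fin n → Bool)) (Ks := Ks)
      (B := univ.filter fun v : Fin n × (Fin n → Bool) => v.1 = i)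
      (Z := fun f => M.machine.eval (S.lang (withBlock n A f)) l (List.ofFn r))
      (χ := fun y v => (-1) ^ dot v.2 (rows n y i)) (fun y v => by
        rw [← pow_mul, mul_comm, pow_mul]; simp) (t := t) hP
      (le_trans (setAvg_mono fun Λ => expect_le_expect fun f _ => by
        by_cases hS : Shallow S (withBlock n A) ((q + τ).eval n) (d.eval n) f Λ
        · have hd := hasDepth_eval (O := fun g => S.lang (withBlock n A (Λ.piecewise g f)))
            M.machine (x := l) (y := List.ofFn r) (l := q.eval n) (L := (q + τ).eval n)
            (by rw [List.length_ofFn]; simp [hq, hln, polyBound]) (by simp [hτ, polyBound]) hS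
          have e : polyBound M.machine.k (q.eval n) * d.eval n = t := by
            simp [ht, hτ, polyBound]
          rw [e] at hd
          rw [if_pos hS, if_pos hd]
        · rw [if_neg hS]
          split_ifs <;> norm_num) hη)
    simp only [fourier_blockFun_sq]
    rw [card_block] at h1
    rw [← Finset.expect_div, div_le_iff₀ (by positivity)]
    refine h1.trans ?_
    rw [add_mul, div_mul_cancel₀ _ (by positivity), one_mul]
    push_cast
    refine add_le_add_right ?_ _
    rw [div_eq_mul_inv]
    simp only [eval_mul, eval_add, eval_pow, eval_C]
    push_cast
    have e4 : ((2 : ℝ) ^ n) ^ 2 * (D / 4 ^ n) = D := by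
      rw [← pow_mul, mul_comm n 2, pow_mul]
      norm_num
      field_simp
    rw [e4, ← inv_pow, ht]
    simp only [eval_mul]
    push_cast
    refine mul_le_mul_of_nonneg_left (pow_le_pow_left₀ (by positivity) hPκ 2) (by positivity)
  calc _ = 𝔼 r : Fin (polyBound M.coins l.length) → Bool,
        𝔼 f : Fin n × (Fin n → Bool) → Bool,
        (if M.machine.eval (S.lang (withBlock n A f)) l (List.ofFn r) ∈ catches (withBlock n A f) n
          then (1 : ℝ) else 0) * (3 / 2 * n) := by
        rw [expect_comm]
        refine expect_congr rfl fun f _ => ?_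
        rw [M.prob_eq_expect, expect_mul]
    _ ≤ 𝔼 r : Fin (polyBound M.coins l.length) → Bool,
        𝔼 f : Fin n × (Fin n → Bool) → Bool, ∑ i, fourier (blockFun f i)
        (rows n (M.machine.eval (S.lang (withBlock n A f)) l (List.ofFn r)) i) ^ 2 := by
        refine expect_le_expect fun r _ => expect_le_expect fun f _ => ?_
        split_ifs with hc
        · obtain ⟨z, hz, hcatch⟩ := hc
          rw [oracleFun_withBlock] at hcatch
          have hz' : M.machine.eval (S.lang (withBlock n A f)) l (List.ofFn r) = concat z := hz
          rw [hz', rows_concat, one_mul]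
          exact hcatch.sum_sq_ge
        · rw [zero_mul]
          exact sum_nonneg fun i _ => sq_nonneg _
    _ ≤ _ := by
        refine expect_le_of_le fun r => ?_
        rw [expect_sum_comm]
        refine (sum_le_sum fun i _ => hcoins r i).trans ?_
        rw [sum_const, card_univ, Fintype.card_fin, nsmul_eq_mul]

open Polynomial in
theorem tendsto_eval_div_two_pow (p : ℕ[X]) :
    Filter.Tendsto (fun n : ℕ => ((p.eval n : ℕ) : ℝ) / 2 ^ n) Filter.atTop (nhds 0) := by
  have h1 := (Polynomial.tendsto_div_exp_atTop
    ((p.map (Nat.castRingHom ℝ)).comp (C (Real.log 2)⁻¹ * X)))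
  have h2 : Filter.Tendsto (fun n : ℕ => (n : ℝ) * Real.log 2) Filter.atTop Filter.atTop :=
    tendsto_natCast_atTop_atTop.atTop_mul_const (Real.log_pos one_lt_two)
  refine (h1.comp h2).congr fun n => ?_
  have hlog : Real.log 2 ≠ 0 := (Real.log_pos one_lt_two).ne'
  have h3 : (Real.log 2)⁻¹ * ((n : ℝ) * Real.log 2) = n := by field_simp
  simp only [Function.comp_apply, eval_comp, eval_mul, eval_C, eval_X, h3]
  rw [Real.exp_nat_mul, Real.exp_log two_pos, eval_natCast_map]
  simp

/-- On every background, a machine with an oracle from the hierarchy solves Fourier Fishing for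
random functions with probability at most `0.9`. -/
theorem eventually_expect_prob_le (S : PHMachine) (M : ProbMachine) :
    ∀ᶠ n : ℕ in Filter.atTop, ∀ A : Oracle,
      𝔼 f : Fin n × (Fin n → Bool) → Bool, M.prob (S.lang (withBlock n A f))
        (List.replicate n false) (catches (withBlock n A f) n) ≤ 0.9 := by
  obtain ⟨p, hp⟩ := exists_bound_prob S M
  -- An error below 0.3 suffices, because `1.3 / 1.5 < 0.9`.
  have h1 := (tendsto_eval_div_two_pow p).eventually (ge_mem_nhds (show (0 : ℝ) < 0.3 by norm_num))
  filter_upwards [h1, Filter.eventually_gt_atTop 0] with n hn hpos A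
  have h2 := hp n A
  rw [← expect_mul] at h2
  have h3 : (0 : ℝ) < n := by exact_mod_cast hpos
  nlinarith
end BQPvsPH

namespace BQPvsPH
open Finset MeasureTheory Filter
open scoped BigOperators

/-! ## The random oracle -/

instance : IsProbabilityMeasure randomOracle := by
  unfold randomOracle; infer_instance

/-- `F` depends only on the oracle at strings of length at most `L`. -/
def IsLocal {β : Type*} (L : ℕ) (F : Oracle → β) : Prop :=
  ∀ A B : Oracle, (∀ s : List Bool, s.length ≤ L → A s = B s) → F A = F B

theorem IsLocal.mono {β : Type*} {L L' : ℕ} {F : Oracle → β} (h : IsLocal L F) (hL : L ≤ L') :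
    IsLocal L' F := fun A B hAB => h A B fun s hs => hAB s (hs.trans hL)

theorem IsLocal.exists_factor {β : Type*} {L : ℕ} {F : Oracle → β} (h : IsLocal L F) :
    ∃ G : ({s : List Bool // s.length ≤ L} → Bool) → β, ∀ A, F A = G fun s => A s := by
  refine ⟨fun r => F fun s => if hs : s.length ≤ L then r ⟨s, hs⟩ else false, fun A => ?_⟩
  refine h _ _ fun s hs => ?_
  simp [hs]

instance (L : ℕ) : Finite {s : List Bool // s.length ≤ L} :=
  (List.finite_length_le Bool L).to_subtype

/-- A local function factors through finitely many bits, and every function on a finite discrete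
space is measurable. -/
theorem IsLocal.measurable {β : Type*} [MeasurableSpace β] {L : ℕ} {F : Oracle → β}
    (h : IsLocal L F) : Measurable F := by
  obtain ⟨G, hG⟩ := h.exists_factor
  have : F = G ∘ fun A s => A s := funext hG
  rw [this]
  exact (measurable_of_finite G).comp (measurable_pi_lambda _ fun s => measurable_pi_apply _)

theorem IsLocal.integrable {L : ℕ} {F : Oracle → ℝ} (h : IsLocal L F) :
    Integrable F randomOracle := by
  have hfin : (Set.range F).Finite := by
    obtain ⟨G, hG⟩ := h.exists_factor
    exact (Set.finite_range G).subset (by rintro _ ⟨A, rfl⟩; exact ⟨_, (hG A).symm⟩)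
  obtain ⟨C, hC⟩ := hfin.isBounded.exists_norm_le
  exact Integrable.of_bound h.measurable.aestronglyMeasurable C
    (ae_of_all _ fun A => hC _ ⟨A, rfl⟩)

/-- Flipping a fair bit leaves it fair, so the product measure is invariant under translation by any
oracle. -/
theorem measurePreserving_xor (h : Oracle) :
    MeasurePreserving (fun A : Oracle => fun s => xor (A s) (h s)) randomOracle randomOracle := by
  have hb : ∀ b : Bool, MeasurePreserving (fun a => xor a b)
      (PMF.uniformOfFintype Bool).toMeasure (PMF.uniformOfFintype Bool).toMeasure := by
    intro b
    refine ⟨measurable_of_finite _, ?_⟩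
    rw [PMF.toMeasure_map _ _ (measurable_of_finite _)]
    congr 1
    ext a
    rw [PMF.map_apply, tsum_bool]
    cases a <;> cases b <;> simp
  refine ⟨measurable_pi_lambda _ fun s =>
    (measurable_of_finite fun a => xor a (h s)).comp (measurable_pi_apply s), ?_⟩
  rw [randomOracle]
  have := Measure.infinitePi_map_pi (μ := fun _ : List Bool => (PMF.uniformOfFintype Bool).toMeasure)
    (f := fun s a => xor a (h s)) (fun s => measurable_of_finite _)
  rw [this]
  congr 1
  funext s
  exact (hb (h s)).map_eq

/-- The law of the random oracle does not change if the functions for `n` are replaced by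
independent uniformly random functions. -/
theorem integral_eq_integral_withBlock {L : ℕ} {F : Oracle → ℝ} (h : IsLocal L F) (n : ℕ) :
    ∫ A, F A ∂randomOracle =
      ∫ A, 𝔼 f : Fin n × (Fin n → Bool) → Bool, F (withBlock n A f) ∂randomOracle := by
  set ext : (Fin n × (Fin n → Bool) → Bool) → Oracle :=
    fun g => Function.extend (blockString n) g fun _ => false with hext
  have h1 : ∀ g, ∫ A, F (fun s => xor (A s) (ext g s)) ∂randomOracle = ∫ A, F A ∂randomOracle :=
    fun g => (measurePreserving_xor (ext g)).integral_comp' (f := ⟨⟨fun A s => xor (A s) (ext g s),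
      fun A s => xor (A s) (ext g s), fun A => by simp, fun A => by simp⟩,
        (measurePreserving_xor _).measurable, (measurePreserving_xor _).measurable⟩) F
  have h2 : ∀ g, Integrable (fun A => F fun s => xor (A s) (ext g s)) randomOracle := fun g =>
    IsLocal.integrable (L := L) fun A B hAB => h _ _ fun s hs => by rw [hAB s hs]
  -- Average the translation invariance over all translations supported on the block.
  have h3 : ∫ A, F A ∂randomOracle = ∫ A, 𝔼 g, F (fun s => xor (A s) (ext g s)) ∂randomOracle := by
    simp only [Finset.expect_eq_sum_div_card]
    rw [integral_div, integral_finsetSum _ fun g _ => h2 g]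
    simp only [h1]
    rw [sum_const, nsmul_eq_mul, mul_div_cancel_left₀]
    simp
  rw [h3]
  congr 1
  funext A
  have hinv : Function.Involutive fun (g : Fin n × (Fin n → Bool) → Bool) v =>
      xor (A (blockString n v)) (g v) := fun g => by funext v; simp
  -- For fixed `A` the translated block `A ⊕ g` runs through all blocks as `g` does.
  refine Fintype.expect_equiv hinv.toPerm _ _ fun g => ?_
  congr 1
  funext s
  by_cases hs : ∃ v, blockString n v = s
  · obtain ⟨v, rfl⟩ := hs
    rw [withBlock_blockString, hext]
    simp only [(blockString_injective n).extend_apply]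
    rfl
  · simp only [hext, withBlock, Function.extend_apply' _ _ _ hs, Bool.xor_false]

/-! ## Countability of the set of machines -/

instance : Countable Instr := by
  let φ : Instr → (ℕ × Bool) ⊕ (ℕ × ℕ × ℕ × ℕ) ⊕ (ℕ × ℕ × ℕ)
    | .push s b => .inl (s, b)
    | .pop s e f t => .inr (.inl (s, e, f, t))
    | .query s f t => .inr (.inr (s, f, t))
  refine Function.Injective.countable (f := φ) ?_
  rintro (_ | _ | _) (_ | _ | _) h <;> simp_all [φ]

instance : Countable Machine := by
  refine Function.Injective.countable (f := fun M : Machine => (M.program, M.k)) ?_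
  rintro ⟨_, _⟩ ⟨_, _⟩ h
  simp_all

instance : Countable NPMachine := by
  refine Function.Injective.countable (f := fun M : NPMachine => (M.verifier, M.wit)) ?_
  rintro ⟨_, _⟩ ⟨_, _⟩ h
  simp_all

instance : Countable ProbMachine := by
  refine Function.Injective.countable (f := fun M : ProbMachine => (M.machine, M.coins)) ?_
  rintro ⟨_, _⟩ ⟨_, _⟩ h
  simp_all

/-- The machines of the levels of a machine of the hierarchy. -/
def PHMachine.toList : PHMachine → List NPMachine × Machine
  | .base M => ([], M)
  | .next N S => (N :: S.toList.1, S.toList.2)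

theorem PHMachine.toList_injective : Function.Injective PHMachine.toList := by
  intro S S' h
  induction S generalizing S' with
  | base M => cases S' <;> simp_all [PHMachine.toList]
  | next N S ih =>
    cases S' with
    | base M => simp [PHMachine.toList] at h
    | next N' S' =>
      simp only [PHMachine.toList, Prod.mk.injEq, List.cons.injEq] at h
      rw [h.1.1, ih (Prod.ext h.1.2 h.2)]

instance : Countable PHMachine := PHMachine.toList_injective.countable

/-- The oracle machines underlying a language in `PH A` are chosen after `A`; naming them by one of
countably many oracle-free objects allows the almost sure statement to be quantified over all of
them at once. -/
theorem exists_lang_eq_of_mem_PH {A B : Oracle} (h : B ∈ PH A) : ∃ S : PHMachine, B = S.lang A := by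
  obtain ⟨k, hk⟩ := h
  induction k generalizing B with
  | zero =>
    obtain ⟨M, hM⟩ := hk
    refine ⟨.base M, funext fun x => ?_⟩
    rw [Bool.eq_iff_iff, hM, PHMachine.lang_base]
    simp [Machine.Accepts]
  | succ k ih =>
    obtain ⟨C, hC, N, hN⟩ := hk
    obtain ⟨S, rfl⟩ := ih hC
    refine ⟨.next N S, funext fun x => ?_⟩
    rw [Bool.eq_iff_iff, hN, PHMachine.lang_next]

/-! ## Failure infinitely often -/

theorem catches_congr {A B : Oracle} {n : ℕ}
    (h : ∀ s : List Bool, s.length ≤ 2 * n → A s = B s) : catches A n = catches B n := by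
  have : oracleFun A n = oracleFun B n := by
    simp only [oracleFun_eq_blockFun]
    congr 1
    funext v
    exact h _ (length_blockString v).le
  simp only [catches, this]

theorem exists_isLocal_prob (S : PHMachine) (M : ProbMachine) (n : ℕ) :
    ∃ L, IsLocal L fun A => M.prob (S.lang A) (List.replicate n false) (catches A n) := by
  set x := List.replicate n false with hx
  set l := x.length + polyBound M.coins x.length with hl
  obtain ⟨L, hL⟩ := S.exists_lang_congr (l + polyBound M.machine.k l)
  refine ⟨max L (2 * n), fun A B h => ?_⟩
  have h1 := hL A B fun s hs => h s (hs.trans (le_max_left _ _))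
  have h2 : catches A n = catches B n := catches_congr fun s hs => h s (hs.trans (le_max_right _ _))
  have h3 : ∀ r : Fin (polyBound M.coins x.length) → Bool,
      M.machine.eval (S.lang A) x (List.ofFn r) = M.machine.eval (S.lang B) x (List.ofFn r) := by
    intro r
    refine M.machine.eval_congr _ _ fun s hs => h1 s ?_
    rwa [List.length_ofFn] at hs
  classical
  simp only [M.prob_eq_expect]
  exact expect_congr rfl fun r _ => if_congr (by rw [h3, h2]) rfl rfl

theorem withBlock_eq_of_length {n : ℕ} (A : Oracle) (f : Fin n × (Fin n → Bool) → Bool)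
    {s : List Bool} (hs : s.length < 2 * n) : withBlock n A f s = A s :=
  Function.extend_apply' _ _ _ fun ⟨v, hv⟩ => by
    have := length_blockString v
    rw [hv] at this
    omega

/-- Local events that have, given the rest of the oracle, probability at most `ρ < 1` over the
functions for `n` do not occur for all large `n`. -/
theorem ae_frequently_lt {s : ℕ → Oracle → ℝ} {a b : ℝ} (hs : ∀ n A, 0 ≤ s n A)
    (hloc : ∀ n, ∃ L, IsLocal L (s n)) (hab : a < b) (ha : 0 ≤ a)
    (hle : ∀ᶠ n in atTop, ∀ A : Oracle,
      𝔼 f : Fin n × (Fin n → Bool) → Bool, s n (withBlock n A f) ≤ a) :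
    ∀ᵐ A ∂randomOracle, ∃ᶠ n in atTop, s n A < b := by
  classical
  have hb : 0 < b := ha.trans_lt hab
  choose L hL using hloc
  obtain ⟨n₀, hn₀⟩ := eventually_atTop.1 hle
  have key : ∀ N, ∀ᵐ A ∂randomOracle, ∃ n ≥ N, s n A < b := by
    intro N
    -- blocks that are so far apart that the earlier events do not depend on the later blocks
    obtain ⟨u, hu0, hus⟩ : ∃ u : ℕ → ℕ, u 0 = max N n₀ ∧ ∀ k, u (k + 1) = u k + L (u k) + 1 :=
      ⟨fun k => Nat.rec (max N n₀) (fun _ m => m + L m + 1) k, rfl, fun _ => rfl⟩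
    have humono : Monotone u := monotone_nat_of_le_succ fun k => by rw [hus]; omega
    have huN : ∀ k, N ≤ u k := fun k => (le_max_left _ _).trans (hu0 ▸ humono (Nat.zero_le k))
    have hun : ∀ k, n₀ ≤ u k := fun k => (le_max_right _ _).trans (hu0 ▸ humono (Nat.zero_le k))
    have huL : ∀ {j k}, j < k → L (u j) < u k := fun {j k} hjk =>
      lt_of_lt_of_le (by rw [hus]; omega) (humono hjk)
    -- The indicator that the `k`-th chosen block is solved with probability at least `b`. By
    -- Markov's inequality its conditional expectation is at most `a / b < 1`.
    let I : ℕ → Oracle → ℝ := fun k A => if b ≤ s (u k) A then 1 else 0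
    have hI0 : ∀ k A, 0 ≤ I k A := fun k A => by simp only [I]; split_ifs <;> norm_num
    have hIloc : ∀ k, IsLocal (L (u k)) (I k) := fun k A B h => by simp only [I, hL (u k) A B h]
    have hIle : ∀ (k : ℕ) (A : Oracle), 𝔼 f : Fin (u k) × (Fin (u k) → Bool) → Bool,
        I k (withBlock (u k) A f) ≤ a / b := by
      intro k A
      rw [le_div_iff₀ hb, expect_mul]
      refine le_trans ?_ (hn₀ (u k) (hun k) A)
      refine expect_le_expect fun f _ => ?_
      simp only [I]
      split_ifs with h
      · simpa using h
      · simpa using hs _ _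
    let G : ℕ → Oracle → ℝ := fun K A => ∏ k ∈ range K, I k A
    have hG0 : ∀ K A, 0 ≤ G K A := fun K A => prod_nonneg fun k _ => hI0 k A
    have hGloc : ∀ K, IsLocal (u K) (G K) := fun K A B h => by
      refine prod_congr rfl fun k hk => (hIloc k).mono ?_ A B h
      exact (huL (mem_range.1 hk)).le
    have hint : ∀ K, ∫ A, G K A ∂randomOracle ≤ (a / b) ^ K := by
      intro K
      induction K with
      | zero => simp [G]
      | succ K ih =>
        -- Redraw only the last block: the earlier factors do not see it, and the last one
        -- contributes a factor `a / b` whatever the rest of the oracle is.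
        rw [integral_eq_integral_withBlock (hGloc (K + 1)) (u K)]
        have h1 : ∀ A, 𝔼 f : Fin (u K) × (Fin (u K) → Bool) → Bool,
            G (K + 1) (withBlock (u K) A f) ≤ (a / b) * G K A := by
          intro A
          have h2 : ∀ f, G (K + 1) (withBlock (u K) A f) = G K A * I K (withBlock (u K) A f) := by
            intro f
            simp only [G]
            rw [prod_range_succ]
            congr 1
            refine prod_congr rfl fun k hk => hIloc k _ _ fun s hs => ?_
            refine withBlock_eq_of_length A f ?_
            have := huL (mem_range.1 hk)
            omega
          simp only [h2]
          rw [← mul_expect, mul_comm]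
          exact mul_le_mul_of_nonneg_right (hIle K A) (hG0 K A)
        refine (integral_mono_of_nonneg (ae_of_all _ fun A => expect_nonneg fun f _ => hG0 _ _)
          ((hGloc K).integrable.const_mul _) (ae_of_all _ h1)).trans ?_
        rw [integral_const_mul, pow_succ']
        exact mul_le_mul_of_nonneg_left ih (by positivity)
    have hE : MeasurableSet {A : Oracle | ∀ k, I k A = 1} := by
      rw [Set.ofPred_forall]
      exact MeasurableSet.iInter fun k => (hIloc k).measurable (measurableSet_singleton 1)
    have hzero : randomOracle.real {A : Oracle | ∀ k, I k A = 1} ≤ 0 := by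
      refine ge_of_tendsto' (tendsto_pow_atTop_nhds_zero_of_lt_one (r := a / b) (by positivity)
        ((div_lt_one hb).2 hab)) fun K => ?_
      refine le_trans ?_ (hint K)
      rw [← integral_indicator_one hE]
      refine integral_mono_of_nonneg (ae_of_all _ fun A => ?_) (hGloc K).integrable
        (ae_of_all _ fun A => ?_)
      · exact Set.indicator_nonneg (fun _ _ => zero_le_one) A
      · by_cases hA : A ∈ {A : Oracle | ∀ k, I k A = 1}
        · rw [Set.indicator_of_mem hA]
          have : ∀ k, I k A = 1 := hA
          simp [G, this]
        · rw [Set.indicator_of_notMem hA]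
          exact hG0 K A
    have hnull : randomOracle {A : Oracle | ∀ k, I k A = 1} = 0 := by
      rw [← measureReal_eq_zero_iff]
      exact le_antisymm hzero measureReal_nonneg
    filter_upwards [measure_eq_zero_iff_ae_notMem.1 hnull] with A hA
    simp only [not_forall] at hA
    obtain ⟨k, hk⟩ := hA
    refine ⟨u k, huN k, lt_of_not_ge fun h => hk ?_⟩
    simp only [I, h, if_true]
  filter_upwards [ae_all_iff.2 key] with A hA
  exact frequently_atTop.2 hA

theorem ProbMachine.prob_nonneg (M : ProbMachine) (A : Oracle) (x : List Bool)
    (S : Set (List Bool)) : 0 ≤ M.prob A x S := by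
  unfold ProbMachine.prob; positivity

/-- Each pair of a hierarchy machine and a probabilistic machine has its own null set, and there are
countably many pairs. -/
theorem ae_frequently_prob_lt : ∀ᵐ A ∂randomOracle, ∀ B ∈ PH A, ∀ M : ProbMachine,
    ∃ᶠ n : ℕ in atTop, M.prob B (List.replicate n false) (catches A n) < 0.99 := by
  have h : ∀ (S : PHMachine) (M : ProbMachine), ∀ᵐ A ∂randomOracle,
      ∃ᶠ n : ℕ in atTop, M.prob (S.lang A) (List.replicate n false) (catches A n) < 0.99 :=
    fun S M => ae_frequently_lt (fun n A => M.prob_nonneg _ _ _) (exists_isLocal_prob S M)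
      (by norm_num) (by norm_num) (eventually_expect_prob_le S M)
  have h2 := ae_all_iff.2 fun S => ae_all_iff.2 (h S)
  filter_upwards [h2] with A hA B hB M
  obtain ⟨S, rfl⟩ := exists_lang_eq_of_mem_PH hB
  exact hA S M

theorem eventually_integral_prob_lt (S : PHMachine) (M : ProbMachine) : ∀ᶠ n : ℕ in atTop,
    Integrable (fun A => M.prob (S.lang A) (List.replicate n false) (catches A n)) randomOracle ∧
    ∫ A, M.prob (S.lang A) (List.replicate n false) (catches A n) ∂randomOracle < 0.99 := by
  filter_upwards [eventually_expect_prob_le S M] with n hn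
  obtain ⟨L, hL⟩ := exists_isLocal_prob S M n
  refine ⟨hL.integrable, ?_⟩
  rw [integral_eq_integral_withBlock hL n]
  have h1 := integral_mono_of_nonneg (μ := randomOracle) (ae_of_all _ fun A =>
    expect_nonneg (s := univ) fun f _ => M.prob_nonneg (S.lang (withBlock n A f)) _ _)
    (integrable_const (0.9 : ℝ)) (ae_of_all _ hn)
  refine h1.trans_lt ?_
  rw [integral_const]
  norm_num
end BQPvsPH

namespace BQPvsPH
open Finset MeasureTheory Filter ProbabilityTheory
open scoped BigOperators Topology

/-! ## Truncated second moments of normalized sums of random signs -/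

theorem expect_prod_pi {ι κ 𝕜 : Type*} [Fintype ι] [DecidableEq ι] [Fintype κ]
    [Field 𝕜] [CharZero 𝕜] (φ : ι → κ → 𝕜) :
    𝔼 f : ι → κ, ∏ i, φ i (f i) = ∏ i, 𝔼 a, φ i a := by
  simp only [Finset.expect_eq_sum_div_card, Finset.prod_div_distrib]
  rw [← Fintype.piFinset_univ, ← Finset.prod_univ_sum]
  simp

/-- The law of the normalized sum of the signs of `V`. -/
noncomputable def signSumLaw (V : Type*) [Fintype V] [DecidableEq V] : Measure ℝ :=
  (PMF.uniformOfFintype (V → Bool)).toMeasure.map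
    fun f => (Real.sqrt (Fintype.card V))⁻¹ * ∑ v, sgn (f v)

instance (V : Type*) [Fintype V] [DecidableEq V] : IsProbabilityMeasure (signSumLaw V) :=
  Measure.isProbabilityMeasure_map (measurable_of_finite _).aemeasurable

theorem integral_uniform {α E : Type*} [Fintype α] [Nonempty α] [MeasurableSpace α]
    [MeasurableSingletonClass α] [NormedAddCommGroup E] [NormedSpace ℝ E] [CompleteSpace E]
    (h : α → E) : ∫ a, h a ∂(PMF.uniformOfFintype α).toMeasure =
      (Fintype.card α : ℝ)⁻¹ • ∑ a, h a := by
  rw [PMF.integral_eq_sum, Finset.smul_sum]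
  simp

theorem charFun_signSumLaw (V : Type*) [Fintype V] [DecidableEq V] (t : ℝ) :
    charFun (signSumLaw V) t =
      charFun ((PMF.uniformOfFintype Bool).toMeasure.map sgn)
        ((Real.sqrt (Fintype.card V))⁻¹ * t) ^ Fintype.card V := by
  rw [charFun_apply_real, charFun_apply_real, signSumLaw,
    integral_map (measurable_of_finite _).aemeasurable (by fun_prop),
    integral_map (measurable_of_finite _).aemeasurable (by fun_prop),
    integral_uniform, integral_uniform]
  set s := (Real.sqrt (Fintype.card V))⁻¹ with hs
  have h1 := expect_prod_pi (𝕜 := ℂ) (fun (_ : V) (b : Bool) =>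
    Complex.exp (((s * t : ℝ) : ℂ) * (sgn b : ℂ) * Complex.I))
  simp only [Finset.expect_eq_sum_div_card, Finset.prod_const, Finset.card_univ] at h1
  have h2 : ∀ f : V → Bool, Complex.exp ((t : ℂ) * ((s * ∑ v, sgn (f v) : ℝ) : ℂ) * Complex.I)
      = ∏ v, Complex.exp (((s * t : ℝ) : ℂ) * (sgn (f v) : ℂ) * Complex.I) := by
    intro f
    rw [← Complex.exp_sum]
    congr 1
    push_cast
    rw [Finset.mul_sum, Finset.mul_sum, Finset.sum_mul]
    refine Finset.sum_congr rfl fun v _ => ?_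
    ring
  simp only [h2]
  rw [Complex.real_smul, Complex.real_smul]
  push_cast at h1 ⊢
  rw [inv_mul_eq_div, h1, inv_mul_eq_div]

/-- The central limit theorem for fair signs, via characteristic functions, along the subsequence of
`2^n` summands. -/
theorem tendsto_signSumLaw :
    Tendsto (β := ProbabilityMeasure ℝ) (fun n : ℕ => ⟨signSumLaw (Fin n → Bool), inferInstance⟩)
      atTop (𝓝 ⟨gaussianReal 0 1, inferInstance⟩) := by
  refine ProbabilityMeasure.tendsto_iff_tendsto_charFun.2 fun t => ?_
  have h1 := tendsto_charFun_inv_sqrt_mul_pow (P := (PMF.uniformOfFintype Bool).toMeasure)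
    (X := sgn) (measurable_of_finite _).aemeasurable
    (by rw [integral_uniform]; simp [sgn]) (by rw [integral_uniform]; simp [sgn]) t
  have h2 : Tendsto (fun n : ℕ => 2 ^ n) atTop atTop := tendsto_pow_atTop_atTop_of_one_lt one_lt_two
  have h3 := h1.comp h2
  simp only [ProbabilityMeasure.coe_mk, charFun_signSumLaw, charFun_gaussianReal]
  convert h3 using 2 with n
  · simp
  · congr 1; push_cast; ring

/-- A continuous function between `x ^ 2` on `[-t, t]` and `x ^ 2` on `[-T, T]`. -/
noncomputable def cutSq (t T x : ℝ) : ℝ :=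
  min (x ^ 2) (max 0 (t ^ 2 * (T - |x|) / (T - t)))

theorem cutSq_nonneg (t T x : ℝ) : 0 ≤ cutSq t T x := le_min (sq_nonneg x) (le_max_left _ _)

theorem cutSq_of_abs_le {t T x : ℝ} (hT : t < T) (hx : |x| ≤ t) :
    cutSq t T x = x ^ 2 := by
  refine min_eq_left (le_trans ?_ (le_max_right _ _))
  have h1 : x ^ 2 ≤ t ^ 2 := by rw [← sq_abs]; exact pow_le_pow_left₀ (abs_nonneg x) hx 2
  rw [le_div_iff₀ (by linarith)]
  exact mul_le_mul h1 (by linarith) (by linarith) (by positivity)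

theorem cutSq_le_indicator {t T : ℝ} (hT : t < T) (x : ℝ) :
    cutSq t T x ≤ Set.indicator (Set.Icc (-T) T) (fun x => x ^ 2) x := by
  by_cases hx : x ∈ Set.Icc (-T) T
  · rw [Set.indicator_of_mem hx]; exact min_le_left _ _
  · rw [Set.indicator_of_notMem hx]
    refine (min_le_right _ _).trans (max_le le_rfl ?_)
    have : T < |x| := lt_of_not_ge fun h => hx (abs_le.1 h)
    exact div_nonpos_of_nonpos_of_nonneg (mul_nonpos_of_nonneg_of_nonpos (sq_nonneg t)
      (by linarith)) (by linarith)

theorem continuous_cutSq (t T : ℝ) : Continuous (cutSq t T) := by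
  unfold cutSq; fun_prop

theorem cutSq_le (t T x : ℝ) (hT : t < T) : cutSq t T x ≤ T ^ 2 := by
  refine (cutSq_le_indicator hT x).trans ?_
  by_cases hx : x ∈ Set.Icc (-T) T
  · rw [Set.indicator_of_mem hx]
    exact sq_le_sq' hx.1 hx.2
  · rw [Set.indicator_of_notMem hx]; positivity

/-- The sum of the signs of a random Boolean function, normalized: its Fourier coefficient at `0`. -/
noncomputable def meanSign {n : ℕ} (f : (Fin n → Bool) → Bool) : ℝ :=
  (Real.sqrt (2 ^ n))⁻¹ * ∑ x, sgn (f x)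

/-- Weak convergence handles only bounded continuous functions. `cutSq` lies between the squares
truncated at `t` and at `T`, so a little room between the two absorbs the discontinuity. -/
theorem eventually_expect_truncated_lt {t T c : ℝ} (hT : t < T)
    (hc : ∫ x, Set.indicator (Set.Icc (-T) T) (fun x => x ^ 2) x ∂gaussianReal 0 1 < c) :
    ∀ᶠ n : ℕ in atTop, 𝔼 f : (Fin n → Bool) → Bool,
      (if t ≤ |meanSign f| then 0 else meanSign f ^ 2) < c := by
  let h : BoundedContinuousFunction ℝ ℝ := BoundedContinuousFunction.ofNormedAddCommGroup
    (cutSq t T) (continuous_cutSq t T) (T ^ 2) fun x => by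
      rw [Real.norm_of_nonneg (cutSq_nonneg t T x)]; exact cutSq_le t T x hT
  have h1 := ProbabilityMeasure.tendsto_iff_forall_integral_tendsto.1 tendsto_signSumLaw h
  have h2 : ∫ x, h x ∂gaussianReal 0 1 < c := by
    refine lt_of_le_of_lt (integral_mono_of_nonneg (ae_of_all _ fun x => cutSq_nonneg t T x) ?_
      (ae_of_all _ fun x => cutSq_le_indicator hT x)) hc
    refine Integrable.of_bound (Measurable.aestronglyMeasurable (by
      exact (measurable_id.pow_const 2).indicator measurableSet_Icc)) (T ^ 2) (ae_of_all _ fun x => ?_)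
    by_cases hx : x ∈ Set.Icc (-T) T
    · rw [Set.indicator_of_mem hx, Real.norm_of_nonneg (sq_nonneg x)]
      exact sq_le_sq' hx.1 hx.2
    · rw [Set.indicator_of_notMem hx, norm_zero]; positivity
  filter_upwards [h1.eventually (gt_mem_nhds h2)] with n hn
  refine lt_of_le_of_lt ?_ hn
  simp only [ProbabilityMeasure.coe_mk]
  rw [signSumLaw, integral_map (measurable_of_finite _).aemeasurable (by fun_prop),
    integral_uniform, Finset.expect_eq_sum_div_card, smul_eq_mul, inv_mul_eq_div]
  rw [Finset.card_univ]
  refine div_le_div_of_nonneg_right (Finset.sum_le_sum fun f _ => ?_) (by positivity)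
  have e : (Real.sqrt (Fintype.card (Fin n → Bool)))⁻¹ * ∑ x, sgn (f x) = meanSign f := by
    simp [meanSign]
  rw [e]
  split_ifs with hf
  · exact cutSq_nonneg _ _ _
  · exact (cutSq_of_abs_le hT (le_of_not_ge hf)).ge

/-! ### Numerical bounds for truncated Gaussian second moments -/

/-- Taylor's formula with nine terms. The remainder is at most `2 u^9 / 9!` for `u ≤ 10 / 2`, and
`9! / 2 = 181440`. -/
theorem exp_neg_le_sum {u : ℝ} (h0 : 0 ≤ u) (h1 : u ≤ 5) :
    Real.exp (-u) ≤ ∑ k ∈ range 9, (-u) ^ k / k.factorial + u ^ 9 / 181440 := by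
  have h := Complex.exp_bound' (x := ((-u : ℝ) : ℂ)) (n := 9) (by
    rw [Complex.norm_real, Real.norm_eq_abs, abs_neg, abs_of_nonneg h0]
    push_cast
    linarith)
  have e : Complex.exp ((-u : ℝ) : ℂ) - ∑ m ∈ range 9, ((-u : ℝ) : ℂ) ^ m / m.factorial
      = ((Real.exp (-u) - ∑ m ∈ range 9, (-u) ^ m / m.factorial : ℝ) : ℂ) := by
    push_cast; rfl
  rw [e, Complex.norm_real, Complex.norm_real, Real.norm_eq_abs, Real.norm_eq_abs, abs_neg,
    abs_of_nonneg h0] at h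
  have h2 := (abs_le.1 h).2
  have h3 : u ^ 9 / ((9 : ℕ).factorial : ℝ) * 2 = u ^ 9 / 181440 := by
    norm_num [Nat.factorial]; ring
  linarith

theorem gaussian_truncated_le {T : ℝ} (hT0 : 0 ≤ T) (hT : T ≤ 3) :
    ∫ x, Set.indicator (Set.Icc (-T) T) (fun x => x ^ 2) x ∂gaussianReal 0 1 ≤
      0.3991 * (2 * (∑ k ∈ range 9, (-1 / 2) ^ k / k.factorial * (T ^ (2 * k + 3) / (2 * k + 3)) +
        T ^ 21 / 21 / 512 / 181440)) := by
  rw [integral_gaussianReal_eq_integral_smul one_ne_zero]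
  have e1 : ∀ x : ℝ, gaussianPDFReal 0 1 x • Set.indicator (Set.Icc (-T) T) (fun x => x ^ 2) x
      = Set.indicator (Set.Icc (-T) T) (fun x => (Real.sqrt (2 * Real.pi))⁻¹ *
        (x ^ 2 * Real.exp (-(x ^ 2 / 2)))) x := by
    intro x
    by_cases hx : x ∈ Set.Icc (-T) T
    · rw [Set.indicator_of_mem hx, Set.indicator_of_mem hx, gaussianPDFReal]
      simp [neg_div]; ring
    · rw [Set.indicator_of_notMem hx, Set.indicator_of_notMem hx, smul_zero]
  simp only [e1]
  rw [integral_indicator measurableSet_Icc, integral_Icc_eq_integral_Ioc,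
    ← intervalIntegral.integral_of_le (by linarith), intervalIntegral.integral_const_mul]
  -- The value `1 / √(2π)` is about 0.39894.
  have hpi : (Real.sqrt (2 * Real.pi))⁻¹ ≤ 0.3991 := by
    rw [inv_le_comm₀ (by positivity) (by norm_num)]
    refine Real.le_sqrt_of_sq_le ?_
    have := Real.pi_gt_d2
    norm_num
    linarith
  have hpoly : ∫ x in -T..T, x ^ 2 * Real.exp (-(x ^ 2 / 2)) ≤
      ∫ x in -T..T, (∑ k ∈ range 9, (-1 / 2) ^ k / k.factorial * x ^ (2 * k + 2) +
        x ^ 20 / 512 / 181440) := by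
    refine intervalIntegral.integral_mono_on (by linarith)
      (by apply Continuous.intervalIntegrable; fun_prop)
      (by apply Continuous.intervalIntegrable; fun_prop) fun x hx => ?_
    have hx2 : x ^ 2 ≤ T ^ 2 := sq_le_sq' hx.1 hx.2
    have := exp_neg_le_sum (u := x ^ 2 / 2) (by positivity) (by nlinarith)
    refine (mul_le_mul_of_nonneg_left this (sq_nonneg x)).trans (le_of_eq ?_)
    rw [mul_add, Finset.mul_sum]
    congr 1
    · refine Finset.sum_congr rfl fun k _ => ?_
      rw [show -(x ^ 2 / 2) = (-1 / 2) * x ^ 2 by ring, mul_pow, ← pow_mul, pow_add]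
      ring
    · ring
  have hval : ∫ x in -T..T, (∑ k ∈ range 9, (-1 / 2 : ℝ) ^ k / k.factorial * x ^ (2 * k + 2) +
        x ^ 20 / 512 / 181440) =
      2 * (∑ k ∈ range 9, (-1 / 2) ^ k / k.factorial * (T ^ (2 * k + 3) / (2 * k + 3)) +
        T ^ 21 / 21 / 512 / 181440) := by
    rw [intervalIntegral.integral_add (by apply Continuous.intervalIntegrable; fun_prop)
      (by apply Continuous.intervalIntegrable; fun_prop), intervalIntegral.integral_finsetSum
      (fun k _ => by apply Continuous.intervalIntegrable; fun_prop)]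
    simp only [intervalIntegral.integral_const_mul, intervalIntegral.integral_div, integral_pow]
    rw [mul_add, Finset.mul_sum]
    congr 1
    · refine Finset.sum_congr rfl fun k _ => ?_
      have : (-T) ^ (2 * k + 2 + 1) = -T ^ (2 * k + 3) := by
        rw [Odd.neg_pow ⟨k + 1, by ring⟩]
      rw [this]
      push_cast
      ring
    · norm_num; ring
  have hnn : 0 ≤ ∫ x in -T..T, x ^ 2 * Real.exp (-(x ^ 2 / 2)) :=
    intervalIntegral.integral_nonneg (by linarith) fun x _ => by positivity
  rw [← hval]
  exact mul_le_mul hpi hpoly hnn (by norm_num)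

/-- What matters is to stay below 1/4, so that more than 3/4 of the size-biased mass lies at `|x| ≥
1`; the next bound must likewise stay below 3/4. -/
theorem gaussian_truncated_one_lt :
    ∫ x, Set.indicator (Set.Icc (-1.01) 1.01) (fun x : ℝ => x ^ 2) x ∂gaussianReal 0 1 < 0.21 := by
  refine (gaussian_truncated_le (by norm_num) (by norm_num)).trans_lt ?_
  simp only [Finset.sum_range_succ, Finset.sum_range_zero, Nat.factorial]
  norm_num

theorem gaussian_truncated_two_lt :
    ∫ x, Set.indicator (Set.Icc (-2.01) 2.01) (fun x : ℝ => x ^ 2) x ∂gaussianReal 0 1 < 0.745 := by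
  refine (gaussian_truncated_le (by norm_num) (by norm_num)).trans_lt ?_
  simp only [Finset.sum_range_succ, Finset.sum_range_zero, Nat.factorial]
  norm_num
end BQPvsPH

namespace BQPvsPH
open Finset MeasureTheory Filter ProbabilityTheory
open scoped BigOperators Topology

/-! ## Sampling from the squared Fourier coefficients -/

theorem neg_one_pow_mul_sgn (m : ℕ) (b : Bool) :
    (-1 : ℝ) ^ m * sgn b = sgn (xor b (decide (Odd m))) := by
  rcases Nat.even_or_odd m with h | h
  · rw [h.neg_one_pow, decide_eq_false (Nat.not_odd_iff_even.2 h)]; simp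
  · rw [h.neg_one_pow, decide_eq_true h]; cases b <;> simp [sgn]

/-- Multiplication by a character permutes the Boolean functions and moves the coefficient at `z` to
the one at zero. -/
theorem expect_fourier_eq {n : ℕ} (G : ℝ → ℝ) (z : Fin n → Bool) :
    𝔼 f : (Fin n → Bool) → Bool, G (fourier (fun x => sgn (f x)) z) =
      𝔼 f : (Fin n → Bool) → Bool, G (meanSign f) := by
  have hinv : Function.Involutive fun (f : (Fin n → Bool) → Bool) x =>
      xor (f x) (decide (Odd (dot x z))) := fun f => by funext x; simp
  refine Fintype.expect_equiv hinv.toPerm _ _ fun f => ?_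
  congr 1
  simp only [fourier, meanSign, neg_one_pow_mul_sgn, one_div]
  rfl

theorem expect_meanSign_sq (n : ℕ) : 𝔼 f : (Fin n → Bool) → Bool, meanSign f ^ 2 = 1 := by
  have := expect_sq_const (V := Fin n → Bool) (fun _ => 1) (by simp) univ 0
  simp only [zero_add, one_mul] at this
  simp only [meanSign, mul_pow, inv_pow]
  rw [← mul_expect, this, Real.sq_sqrt (by positivity)]
  simp

/-- The sampling weights turn the common law of the coefficients into its size-biased version; the
`2^n` equal contributions cancel the normalization. -/
theorem expect_sum_fourier {n : ℕ} (G : ℝ → ℝ) :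
    𝔼 f : (Fin n → Bool) → Bool, ∑ z, fourier (fun x => sgn (f x)) z ^ 2 / 2 ^ n *
      G (fourier (fun x => sgn (f x)) z) =
      𝔼 f : (Fin n → Bool) → Bool, meanSign f ^ 2 * G (meanSign f) := by
  rw [expect_sum_comm]
  have h : ∀ z, 𝔼 f : (Fin n → Bool) → Bool, fourier (fun x => sgn (f x)) z ^ 2 / 2 ^ n *
      G (fourier (fun x => sgn (f x)) z) =
      (𝔼 f : (Fin n → Bool) → Bool, meanSign f ^ 2 * G (meanSign f)) / 2 ^ n := by
    intro z
    rw [← expect_fourier_eq (fun y => y ^ 2 * G y) z, expect_div]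
    exact expect_congr rfl fun f _ => by ring
  have hcard : ((univ : Finset (Fin n → Bool)).card : ℝ) = 2 ^ n := by simp
  simp only [h, sum_const, nsmul_eq_mul, hcard]
  field_simp

/-- A Chernoff bound for the number of large Fourier coefficients. -/
theorem expect_few_large_le {n m : ℕ} {t a w : ℝ} (hw : 0 < w) (hw1 : w ≤ 1)
    (ha : 𝔼 f : (Fin n → Bool) → Bool, (if t ≤ |meanSign f| then 0 else meanSign f ^ 2) ≤ 1 - a) :
    𝔼 f : Fin n × (Fin n → Bool) → Bool, ∑ z : Fin n → Fin n → Bool,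
      (∏ i, fourier (blockFun f i) (z i) ^ 2 / 2 ^ n) *
        (if 4 * (univ.filter fun i => t ≤ |fourier (blockFun f i) (z i)|).card < m * n
          then 1 else 0) ≤
      ((1 - a * (1 - w ^ 4)) / w ^ m) ^ n := by
  -- Exponential Markov: if `4 X < m n` for the number `X` of large coefficients, then `w^(4X) /
  -- w^(mn) ≥ 1`. The factor 4 keeps the thresholds `3n/4` and `n/4` integral.
  have h1 : ∀ (f : Fin n × (Fin n → Bool) → Bool) (z : Fin n → Fin n → Bool),
      (∏ i, fourier (blockFun f i) (z i) ^ 2 / 2 ^ n) *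
        (if 4 * (univ.filter fun i => t ≤ |fourier (blockFun f i) (z i)|).card < m * n
          then (1 : ℝ) else 0) ≤
      ∏ i, fourier (blockFun f i) (z i) ^ 2 / 2 ^ n *
        ((if t ≤ |fourier (blockFun f i) (z i)| then w ^ 4 else 1) / w ^ m) := by
    intro f z
    rw [prod_mul_distrib]
    refine mul_le_mul_of_nonneg_left ?_ (prod_nonneg fun i _ => by positivity)
    rw [prod_div_distrib, prod_const, prod_ite, prod_const, prod_const_one, mul_one, ← pow_mul,
      ← pow_mul, card_univ, Fintype.card_fin]
    split_ifs with h
    · rw [le_div_iff₀ (by positivity), one_mul]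
      exact pow_le_pow_of_le_one hw.le hw1 h.le
    · positivity
  refine (expect_le_expect fun f _ => sum_le_sum fun z _ => h1 f z).trans ?_
  have h2 : ∀ f : Fin n × (Fin n → Bool) → Bool, ∑ z : Fin n → Fin n → Bool,
      ∏ i, fourier (blockFun f i) (z i) ^ 2 / 2 ^ n *
        ((if t ≤ |fourier (blockFun f i) (z i)| then w ^ 4 else 1) / w ^ m) =
      ∏ i, ∑ z : Fin n → Bool, fourier (blockFun f i) z ^ 2 / 2 ^ n *
        ((if t ≤ |fourier (blockFun f i) z| then w ^ 4 else 1) / w ^ m) := by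
    intro f
    rw [prod_univ_sum, Fintype.piFinset_univ]
  simp only [h2]
  -- The `n` functions of a block are independent, so the expectation of the product is the `n`-th
  -- power of one expectation.
  rw [Fintype.expect_equiv (Equiv.curry (Fin n) (Fin n → Bool) Bool)
    (fun f : Fin n × (Fin n → Bool) → Bool => ∏ i, ∑ z : Fin n → Bool,
      fourier (blockFun f i) z ^ 2 / 2 ^ n *
        ((if t ≤ |fourier (blockFun f i) z| then w ^ 4 else 1) / w ^ m))
    (fun g : Fin n → (Fin n → Bool) → Bool => ∏ i, ∑ z : Fin n → Bool,
      fourier (fun x => sgn (g i x)) z ^ 2 / 2 ^ n *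
        ((if t ≤ |fourier (fun x => sgn (g i x)) z| then w ^ 4 else 1) / w ^ m)) fun f => rfl]
  rw [expect_prod_pi (fun (_ : Fin n) (g : (Fin n → Bool) → Bool) => ∑ z : Fin n → Bool,
      fourier (fun x => sgn (g x)) z ^ 2 / 2 ^ n *
        ((if t ≤ |fourier (fun x => sgn (g x)) z| then w ^ 4 else 1) / w ^ m))]
  rw [prod_const, card_univ, Fintype.card_fin]
  refine pow_le_pow_left₀ (expect_nonneg fun f _ => sum_nonneg fun z _ => by
    split_ifs <;> positivity) ?_ n
  rw [expect_sum_fourier fun y => (if t ≤ |y| then w ^ 4 else 1) / w ^ m]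
  have h3 : ∀ f : (Fin n → Bool) → Bool,
      meanSign f ^ 2 * ((if t ≤ |meanSign f| then w ^ 4 else 1) / w ^ m) =
      (meanSign f ^ 2 * w ^ 4 + (if t ≤ |meanSign f| then 0 else meanSign f ^ 2) * (1 - w ^ 4))
        / w ^ m := by
    intro f
    split_ifs <;> ring
  simp only [h3]
  rw [← expect_div, expect_add_distrib, ← expect_mul, ← expect_mul, expect_meanSign_sq]
  have h4 : 0 ≤ 1 - w ^ 4 := sub_nonneg.2 (pow_le_one₀ hw.le hw1)
  refine div_le_div_of_nonneg_right ?_ (by positivity)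
  nlinarith [mul_le_mul_of_nonneg_right ha h4]

open Classical in
/-- Sampling a string for each function according to the squares of the Fourier coefficients
fails to solve Fourier Fishing for random functions with exponentially small probability. -/
theorem eventually_expect_not_isCatch_le : ∃ ρ : ℝ, 0 < ρ ∧ ρ < 1 ∧ ∀ᶠ n : ℕ in atTop,
    𝔼 f : Fin n × (Fin n → Bool) → Bool, ∑ z : Fin n → Fin n → Bool,
      (∏ i, fourier (blockFun f i) (z i) ^ 2 / 2 ^ n) *
        (if IsCatch (blockFun f) z then 0 else 1) ≤ 2 * ρ ^ n := by
  -- The two Chernoff factors are about 0.9964 and 0.99995; the second is tight because 0.255 barely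
  -- exceeds 1/4.
  refine ⟨0.99997, by norm_num, by norm_num, ?_⟩
  have h1 := eventually_expect_truncated_lt (t := 1) (T := 1.01) (by norm_num)
    gaussian_truncated_one_lt
  have h2 := eventually_expect_truncated_lt (t := 2) (T := 2.01) (by norm_num)
    gaussian_truncated_two_lt
  filter_upwards [h1, h2] with n hn1 hn2
  have c1 := expect_few_large_le (m := 3) (t := 1) (a := 0.79) (w := 0.97) (by norm_num)
    (by norm_num) (by refine hn1.le.trans ?_; norm_num)
  have c2 := expect_few_large_le (m := 1) (t := 2) (a := 0.255) (w := 0.99) (by norm_num)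
    (by norm_num) (by refine hn2.le.trans ?_; norm_num)
  have hsplit : ∀ (f : Fin n × (Fin n → Bool) → Bool) (z : Fin n → Fin n → Bool),
      (∏ i, fourier (blockFun f i) (z i) ^ 2 / 2 ^ n) *
        (if IsCatch (blockFun f) z then (0 : ℝ) else 1) ≤
      (∏ i, fourier (blockFun f i) (z i) ^ 2 / 2 ^ n) *
        (if 4 * (univ.filter fun i => 1 ≤ |fourier (blockFun f i) (z i)|).card < 3 * n
          then 1 else 0) +
      (∏ i, fourier (blockFun f i) (z i) ^ 2 / 2 ^ n) *
        (if 4 * (univ.filter fun i => 2 ≤ |fourier (blockFun f i) (z i)|).card < 1 * n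
          then 1 else 0) := by
    intro f z
    rw [← mul_add]
    refine mul_le_mul_of_nonneg_left ?_ (prod_nonneg fun i _ => by positivity)
    by_cases h3 : 4 * (univ.filter fun i => 1 ≤ |fourier (blockFun f i) (z i)|).card < 3 * n
    · rw [if_pos h3]; split_ifs <;> norm_num
    by_cases h4 : 4 * (univ.filter fun i => 2 ≤ |fourier (blockFun f i) (z i)|).card < 1 * n
    · rw [if_pos h4]; split_ifs <;> norm_num
    rw [if_neg h3, if_neg h4, if_pos, add_zero]
    push Not at h3 h4
    constructor
    · rw [Set.ncard_eq_toFinset_card', Set.toFinset_ofPred]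
      have : (3 * n : ℝ) ≤ 4 * (univ.filter fun i => 1 ≤ |fourier (blockFun f i) (z i)|).card := by
        exact_mod_cast h3
      linarith
    · rw [Set.ncard_eq_toFinset_card', Set.toFinset_ofPred]
      have : (1 * n : ℝ) ≤ 4 * (univ.filter fun i => 2 ≤ |fourier (blockFun f i) (z i)|).card := by
        exact_mod_cast h4
      linarith
  refine (expect_le_expect fun f _ => sum_le_sum fun z _ => hsplit f z).trans ?_
  simp only [sum_add_distrib]
  rw [expect_add_distrib, two_mul]
  refine add_le_add (c1.trans ?_) (c2.trans ?_)
  · exact pow_le_pow_left₀ (by norm_num) (by norm_num) n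
  · exact pow_le_pow_left₀ (by norm_num) (by norm_num) n
end BQPvsPH

namespace BQPvsPH
open Finset MeasureTheory Filter
open scoped BigOperators Topology

/-! ## Unitarity of quantum circuits -/

theorem sum_eq_sum_update {m : ℕ} (q : Fin m) (F : (Fin m → Bool) → ℝ) :
    ∑ w, F w = (∑ w, (F (Function.update w q false) + F (Function.update w q true))) / 2 := by
  have h := expect_eq_update q F
  simp only [Finset.expect_eq_sum_div_card] at h
  have hc : ((univ : Finset (Fin m → Bool)).card : ℝ) ≠ 0 := by simp
  field_simp at h
  rw [sum_add_distrib]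
  linarith

theorem norm_sq_hadamard (a b : ℂ) :
    ‖(a + 1 * b) / (Real.sqrt 2 : ℂ)‖ ^ 2 + ‖(a + (-1) * b) / (Real.sqrt 2 : ℂ)‖ ^ 2
      = ‖a‖ ^ 2 + ‖b‖ ^ 2 := by
  have h := parallelogram_law_with_norm ℝ a b
  rw [one_mul, neg_one_mul, ← sub_eq_add_neg, norm_div, norm_div, div_pow, div_pow,
    Complex.norm_real, Real.norm_of_nonneg (Real.sqrt_nonneg 2), Real.sq_sqrt zero_le_two]
  linarith

/-- Hadamard gates preserve the norm by the parallelogram law on each pair of assignments, phases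
trivially, and the remaining gates because they permute the assignments. -/
theorem Gate.sum_norm_sq {m : ℕ} (A : Oracle) (g : Gate m) (ψ : (Fin m → Bool) → ℂ) :
    ∑ w, ‖g.apply A ψ w‖ ^ 2 = ∑ w, ‖ψ w‖ ^ 2 := by
  cases g with
  | hadamard q =>
    rw [sum_eq_sum_update q, sum_eq_sum_update q (fun w => ‖ψ w‖ ^ 2)]
    congr 1
    refine sum_congr rfl fun w _ => ?_
    simp only [Gate.apply, Function.update_idem, Function.update_self, if_true, Bool.false_eq_true,
      if_false]
    exact norm_sq_hadamard _ _
  | phaseT q =>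
    refine sum_congr rfl fun w _ => ?_
    have : ‖Complex.exp (Real.pi / 4 * Complex.I)‖ = 1 := by
      have := Complex.norm_exp_ofReal_mul_I (Real.pi / 4)
      push_cast at this
      exact this
    simp only [Gate.apply, norm_mul]
    split_ifs <;> simp [this]
  | cnot c t =>
    by_cases h : c = t
    · simp [Gate.apply, h]
    · have hinv : Function.Involutive fun w : Fin m → Bool =>
          Function.update w t (xor (w t) (w c)) := by
        intro w
        simp [Function.update_of_ne h]
      simp only [Gate.apply, if_neg h]
      exact Equiv.sum_comp hinv.toPerm fun w => ‖ψ w‖ ^ 2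
  | query qs t =>
    by_cases h : t ∈ qs
    · simp [Gate.apply, h]
    · have hmap : ∀ (w : Fin m → Bool) b, qs.map (Function.update w t b) = qs.map w := by
        intro w b
        refine List.map_congr_left fun q hq => ?_
        rw [Function.update_of_ne (ne_of_mem_of_not_mem hq h)]
      have hinv : Function.Involutive fun w : Fin m → Bool =>
          Function.update w t (xor (w t) (A (qs.map w))) := by
        intro w
        simp [hmap]
      simp only [Gate.apply, if_neg h]
      exact Equiv.sum_comp hinv.toPerm fun w => ‖ψ w‖ ^ 2

/-- The action of a list of gates. -/
noncomputable def runGates {m : ℕ} (A : Oracle) (l : List (Gate m)) (ψ : (Fin m → Bool) → ℂ) :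
    (Fin m → Bool) → ℂ :=
  l.foldl (fun ψ g => g.apply A ψ) ψ

theorem runGates_append {m : ℕ} (A : Oracle) (l l' : List (Gate m)) (ψ : (Fin m → Bool) → ℂ) :
    runGates A (l ++ l') ψ = runGates A l' (runGates A l ψ) := List.foldl_append

theorem runGates_cons {m : ℕ} (A : Oracle) (g : Gate m) (l : List (Gate m))
    (ψ : (Fin m → Bool) → ℂ) : runGates A (g :: l) ψ = runGates A l (g.apply A ψ) := rfl

theorem Circuit.sum_norm_sq_state (C : Circuit) (A : Oracle) : ∑ w, ‖C.state A w‖ ^ 2 = 1 := by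
  have h : ∀ (l : List (Gate (C.last + 1))) ψ,
      ∑ w, ‖runGates A l ψ w‖ ^ 2 = ∑ w, ‖ψ w‖ ^ 2 := by
    intro l
    induction l with
    | nil => intro ψ; rfl
    | cons g l ih => intro ψ; rw [runGates_cons, ih, g.sum_norm_sq]
  refine (h C.gates _).trans ?_
  rw [sum_eq_single (fun _ => false)]
  · simp
  · intro w _ hw; simp [hw]
  · simp

theorem QuantumMachine.prob_univ (Q : QuantumMachine) (A : Oracle) (x : List Bool) :
    Q.prob A x Set.univ = 1 := by
  simp only [QuantumMachine.prob, Set.mem_univ, if_true]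
  exact Circuit.sum_norm_sq_state _ _

theorem QuantumMachine.prob_mono (Q : QuantumMachine) (A : Oracle) (x : List Bool)
    {S S' : Set (List Bool)} (h : S ⊆ S') : Q.prob A x S ≤ Q.prob A x S' := by
  refine sum_le_sum fun w _ => ?_
  split_ifs with h1 h2
  · exact le_rfl
  · exact absurd (h h1) h2
  · positivity
  · exact le_rfl

theorem QuantumMachine.prob_nonneg (Q : QuantumMachine) (A : Oracle) (x : List Bool)
    (S : Set (List Bool)) : 0 ≤ Q.prob A x S :=
  sum_nonneg fun w _ => by split_ifs <;> positivity

/-! ## Product states -/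

section ProductStates

variable {m : ℕ}

/-- A product state. -/
noncomputable def prodState (φ : Fin m → Bool → ℂ) (w : Fin m → Bool) : ℂ := ∏ q, φ q (w q)

/-- The Hadamard matrix on one qubit. -/
noncomputable def had (φ : Bool → ℂ) (b : Bool) : ℂ :=
  (φ false + (if b then -1 else 1) * φ true) / (Real.sqrt 2 : ℂ)

/-- The matrix `T` on one qubit. -/
noncomputable def phase (φ : Bool → ℂ) (b : Bool) : ℂ :=
  (if b then Complex.exp (Real.pi / 4 * Complex.I) else 1) * φ b

theorem prodState_eq (φ : Fin m → Bool → ℂ) (q : Fin m) (w : Fin m → Bool) :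
    prodState φ w = φ q (w q) * ∏ r ∈ univ.erase q, φ r (w r) :=
  (mul_prod_erase univ (fun r => φ r (w r)) (mem_univ q)).symm

theorem prodState_update (φ : Fin m → Bool → ℂ) (q : Fin m) (w : Fin m → Bool) (b : Bool) :
    prodState φ (Function.update w q b) = φ q b * ∏ r ∈ univ.erase q, φ r (w r) := by
  rw [prodState_eq φ q, Function.update_self]
  congr 1
  exact prod_congr rfl fun r hr => by rw [Function.update_of_ne (ne_of_mem_erase hr)]

theorem prodState_update_left (φ : Fin m → Bool → ℂ) (q : Fin m) (χ : Bool → ℂ) (w : Fin m → Bool) :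
    prodState (Function.update φ q χ) w = χ (w q) * ∏ r ∈ univ.erase q, φ r (w r) := by
  rw [prodState_eq _ q, Function.update_self]
  congr 1
  exact prod_congr rfl fun r hr => by rw [Function.update_of_ne (ne_of_mem_erase hr)]

theorem hadamard_prodState (A : Oracle) (q : Fin m) (φ : Fin m → Bool → ℂ) :
    (Gate.hadamard q).apply A (prodState φ) = prodState (Function.update φ q (had (φ q))) := by
  funext w
  rw [prodState_update_left]
  simp only [Gate.apply, prodState_update, had]
  ring

theorem phaseT_prodState (A : Oracle) (q : Fin m) (φ : Fin m → Bool → ℂ) :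
    (Gate.phaseT q).apply A (prodState φ) = prodState (Function.update φ q (phase (φ q))) := by
  funext w
  rw [prodState_update_left]
  simp only [Gate.apply, prodState_eq φ q, phase]
  ring

/-- Hadamard gates on all qubits. -/
def layer (m : ℕ) : List (Gate m) := (List.finRange m).map Gate.hadamard

theorem runGates_hadamard_prodState (A : Oracle) (l : List (Fin m)) (hl : l.Nodup)
    (φ : Fin m → Bool → ℂ) : runGates A (l.map Gate.hadamard) (prodState φ) =
      prodState fun q => if q ∈ l then had (φ q) else φ q := by
  induction l generalizing φ with
  | nil => simp [runGates]
  | cons q l ih =>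
    rw [List.nodup_cons] at hl
    rw [List.map_cons, runGates_cons, hadamard_prodState, ih hl.2]
    congr 1
    funext r
    by_cases hr : r = q
    · subst hr; simp [hl.1]
    · simp [hr]

theorem runGates_layer_prodState (A : Oracle) (φ : Fin m → Bool → ℂ) :
    runGates A (layer m) (prodState φ) = prodState fun q => had (φ q) := by
  rw [layer, runGates_hadamard_prodState A _ (List.nodup_finRange m)]
  simp

theorem runGates_hadamard_sum {ι : Type*} (s : Finset ι) (A : Oracle) (l : List (Fin m))
    (c : ι → ℂ) (Ψ : ι → (Fin m → Bool) → ℂ) :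
    runGates A (l.map Gate.hadamard) (fun w => ∑ i ∈ s, c i * Ψ i w) =
      fun w => ∑ i ∈ s, c i * runGates A (l.map Gate.hadamard) (Ψ i) w := by
  induction l generalizing Ψ with
  | nil => rfl
  | cons q l ih =>
    simp only [List.map_cons, runGates_cons]
    rw [← ih]
    congr 1
    funext w
    simp only [Gate.apply, mul_sum, ← sum_add_distrib, sum_div]
    exact sum_congr rfl fun i _ => by ring

/-- The layer is linear, and on a basis state, which is a product state, it acts qubit by qubit. -/
theorem runGates_layer (A : Oracle) (ψ : (Fin m → Bool) → ℂ) (w : Fin m → Bool) :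
    runGates A (layer m) ψ w =
      ∑ u, ψ u * ∏ q, (if u q && w q then -1 else 1) / (Real.sqrt 2 : ℂ) := by
  have h : ψ = fun w => ∑ u, ψ u * prodState (fun q b => if u q = b then 1 else 0) w := by
    funext w
    rw [sum_eq_single w]
    · simp [prodState]
    · intro u _ hu
      obtain ⟨q, hq⟩ := Function.ne_iff.1 hu
      rw [prodState_eq _ q, if_neg hq, zero_mul, mul_zero]
    · simp
  conv_lhs => rw [h, layer, runGates_hadamard_sum]
  refine sum_congr rfl fun u _ => ?_
  congr 1
  have := congrFun (runGates_layer_prodState A fun q b => if u q = b then (1 : ℂ) else 0) w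
  rw [layer] at this
  rw [this, prodState]
  refine prod_congr rfl fun q _ => ?_
  cases hu : u q <;> cases hw : w q <;> simp [had]

/-- Phase kickback: a state that changes sign when the target is flipped turns the added answer into
a sign. As the target is not queried, the new state has the same antisymmetry. -/
theorem runGates_query (A : Oracle) (t : Fin m) (L : List (List (Fin m))) (hL : ∀ qs ∈ L, t ∉ qs)
    (ψ : (Fin m → Bool) → ℂ) (hψ : ∀ w, ψ (Function.update w t (!w t)) = -ψ w) :
    runGates A (L.map fun qs => Gate.query qs t) ψ =
      fun w => (L.map fun qs => (sgn (A (qs.map w)) : ℂ)).prod * ψ w := by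
  induction L generalizing ψ with
  | nil => simp [runGates]
  | cons qs L ih =>
    have hqs : t ∉ qs := hL qs (by simp)
    have hmap : ∀ (w : Fin m → Bool) b, qs.map (Function.update w t b) = qs.map w := by
      intro w b
      refine List.map_congr_left fun q hq => ?_
      rw [Function.update_of_ne (ne_of_mem_of_not_mem hq hqs)]
    have h1 : (Gate.query qs t).apply A ψ = fun w => (sgn (A (qs.map w)) : ℂ) * ψ w := by
      funext w
      simp only [Gate.apply, if_neg hqs]
      cases A (qs.map w)
      · simp [sgn]
      · simp [sgn, hψ]
    rw [List.map_cons, runGates_cons, h1, ih (fun qs' h => hL qs' (by simp [h]))]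
    · funext w
      rw [List.map_cons, List.prod_cons]
      ring
    · intro w
      rw [hmap, hψ]
      ring

end ProductStates
end BQPvsPH

namespace BQPvsPH
open Finset MeasureTheory Filter
open scoped BigOperators Topology

/-! ## The circuit for Fourier Fishing -/

/-- The qubits: three auxiliary ones (a constant `0`, a constant `1` and the target of the queries)
and an `n × n` array. -/
def qubitEquiv (n : ℕ) : Fin 3 ⊕ Fin n × Fin n ≃ Fin (n * n + 2 + 1) :=
  (Equiv.sumCongr (Equiv.refl _) finProdFinEquiv).trans
    (finSumFinEquiv.trans (finCongr (by omega)))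

theorem qubitEquiv_inl {n : ℕ} (a : Fin 3) : ((qubitEquiv n (.inl a) : Fin _) : ℕ) = a := by
  simp [qubitEquiv]

theorem qubitEquiv_inr {n : ℕ} (i j : Fin n) :
    ((qubitEquiv n (.inr (i, j)) : Fin _) : ℕ) = 3 + (i * n + j) := by
  simp [qubitEquiv, finProdFinEquiv]; ring

/-- The gates that prepare the auxiliary qubits after the first layer of Hadamard gates. -/
def auxGates (n : ℕ) : List (Gate (n * n + 2 + 1)) :=
  let q := fun a : Fin 3 => qubitEquiv n (.inl a)
  [.hadamard (q 0), .phaseT (q 1), .phaseT (q 1), .phaseT (q 1), .phaseT (q 1), .hadamard (q 1),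
    .phaseT (q 2), .phaseT (q 2), .phaseT (q 2), .phaseT (q 2)]

/-- The qubits that are queried to evaluate the `i`-th function. -/
def queryQubits (n : ℕ) (i : Fin n) : List (Fin (n * n + 2 + 1)) :=
  List.replicate i (qubitEquiv n (.inl 1)) ++ List.replicate (n - i) (qubitEquiv n (.inl 0)) ++
    List.ofFn fun j => qubitEquiv n (.inr (i, j))

/-- The gates of the circuit for Fourier Fishing. -/
def fishingGates (n : ℕ) : List (Gate (n * n + 2 + 1)) :=
  layer _ ++ auxGates n ++
    ((List.ofFn (queryQubits n)).map fun qs => Gate.query qs (qubitEquiv n (.inl 2))) ++ layer _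

/-- The states of the auxiliary qubits during the queries. -/
noncomputable def auxState (a : Fin 3) (b : Bool) : ℂ :=
  if a = 0 then (if b then 0 else 1) else if a = 1 then (if b then 1 else 0)
  else (if b then -1 else 1) / (Real.sqrt 2 : ℂ)

theorem sqrt_two_mul_self : (Real.sqrt 2 : ℂ) * (Real.sqrt 2 : ℂ) = 2 := by
  rw [← Complex.ofReal_mul, Real.mul_self_sqrt zero_le_two]; norm_num

theorem phase_four (φ : Bool → ℂ) :
    phase (phase (phase (phase φ))) = fun b => (if b then -1 else 1) * φ b := by
  have h : Complex.exp (Real.pi / 4 * Complex.I) ^ 4 = -1 := by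
    rw [← Complex.exp_nat_mul, ← Complex.exp_pi_mul_I]
    congr 1
    push_cast
    ring
  funext b
  simp only [phase]
  cases b
  · simp
  · simp only [if_true]
    linear_combination φ true * h

/-- After the first layer every qubit is in the state `|+⟩`. A second Hadamard gate takes auxiliary
qubit 0 back to `|0⟩`. Four `T` gates make a `Z`, which turns `|+⟩` into `|-⟩`: the query target
stays there, and a Hadamard gate takes auxiliary qubit 1 on to `|1⟩`. -/
theorem runGates_aux (n : ℕ) (A : Oracle) :
    runGates A (layer _ ++ auxGates n) (Pi.single (fun _ => false) 1) =
      prodState fun q => Sum.elim auxState (fun _ _ => 1 / (Real.sqrt 2 : ℂ))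
        ((qubitEquiv n).symm q) := by
  have h0 : (Pi.single (fun _ => false) 1 : (Fin (n * n + 2 + 1) → Bool) → ℂ)
      = prodState fun _ b => if b then 0 else 1 := by
    funext w
    by_cases hw : w = fun _ => false
    · subst hw; simp [prodState]
    · obtain ⟨q, hq⟩ := Function.ne_iff.1 hw
      rw [Pi.single_eq_of_ne hw, prodState_eq _ q]
      simp only [Bool.not_eq_false] at hq
      simp [hq]
  have h2 : (Real.sqrt 2 : ℂ) ≠ 0 := by
    intro h; have := sqrt_two_mul_self; rw [h] at this; norm_num at this
  rw [runGates_append, h0, runGates_layer_prodState]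
  simp only [auxGates, runGates_cons, hadamard_prodState, phaseT_prodState, Function.update_self,
    Function.update_idem, phase_four]
  show prodState _ = _
  congr 1
  have hne : ∀ {a b : Fin 3}, a ≠ b → qubitEquiv n (.inl a) ≠ qubitEquiv n (.inl b) := fun h h' =>
    h (Sum.inl_injective ((qubitEquiv n).injective h'))
  funext q
  obtain ⟨q, rfl⟩ := (qubitEquiv n).surjective q
  rw [Equiv.symm_apply_apply]
  have h3 := sqrt_two_mul_self
  rcases q with a | ⟨i, j⟩
  · fin_cases a
    · simp only [Fin.zero_eta]
      rw [Function.update_of_ne (hne (by decide)), Function.update_of_ne (hne (by decide)),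
        Function.update_self]
      funext b
      cases b
      · simp [had, auxState]; field_simp; linear_combination -h3
      · simp [had, auxState]
    · simp only [Fin.mk_one]
      rw [Function.update_of_ne (hne (by decide)), Function.update_self,
        Function.update_of_ne (hne (by decide))]
      funext b
      cases b
      · simp [had, auxState]
      · simp [had, auxState]; field_simp; linear_combination -h3
    · simp only [Fin.reduceFinMk]
      rw [Function.update_self, Function.update_of_ne (hne (by decide)),
        Function.update_of_ne (hne (by decide))]
      funext b
      cases b <;> simp [had, auxState, neg_div]
  · have hne' : ∀ a, qubitEquiv n (.inr (i, j)) ≠ qubitEquiv n (.inl a) := fun a h' => by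
      simpa using (qubitEquiv n).injective h'
    rw [Function.update_of_ne (hne' _), Function.update_of_ne (hne' _),
      Function.update_of_ne (hne' _)]
    funext b
    simp [had]

/-- The amplitude factor of the auxiliary qubits. -/
noncomputable def auxAmp (s : Fin 3 → Bool) : ℂ := ∏ a, had (auxState a) (s a)

theorem sum_norm_sq_auxAmp : ∑ s, ‖auxAmp s‖ ^ 2 = 1 := by
  have h1 : ∀ a, ∑ b, ‖had (auxState a) b‖ ^ 2 = 1 := by
    intro a
    have := norm_sq_hadamard (auxState a false) (auxState a true)
    simp only [had, Fintype.sum_bool, if_true, Bool.false_eq_true, if_false]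
    rw [add_comm, this]
    fin_cases a
    · simp [auxState]
    · simp [auxState]
    · simp [auxState]; norm_num
  simp only [auxAmp, norm_prod, ← prod_pow]
  have := prod_univ_sum (fun _ : Fin 3 => (univ : Finset Bool))
    (fun a b => ‖had (auxState a) b‖ ^ 2)
  rw [Fintype.piFinset_univ] at this
  rw [← this]
  exact prod_eq_one fun a _ => h1 a

/-- Assignments of the qubits. -/
def assignEquiv (n : ℕ) :
    (Fin 3 → Bool) × (Fin n → Fin n → Bool) ≃ (Fin (n * n + 2 + 1) → Bool) :=
  (Equiv.prodCongr (Equiv.refl _) (Equiv.curry (Fin n) (Fin n) Bool).symm).trans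
    ((Equiv.sumArrowEquivProdArrow _ _ _).symm.trans
      (Equiv.arrowCongr (qubitEquiv n) (Equiv.refl _)))

theorem assignEquiv_inl {n : ℕ} (p : (Fin 3 → Bool) × (Fin n → Fin n → Bool)) (a : Fin 3) :
    assignEquiv n p (qubitEquiv n (.inl a)) = p.1 a := by
  simp [assignEquiv, Equiv.sumArrowEquivProdArrow]

theorem assignEquiv_inr {n : ℕ} (p : (Fin 3 → Bool) × (Fin n → Fin n → Bool)) (i j : Fin n) :
    assignEquiv n p (qubitEquiv n (.inr (i, j))) = p.2 i j := by
  simp [assignEquiv, Equiv.sumArrowEquivProdArrow]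

theorem prod_qubits {n : ℕ} (F : Fin (n * n + 2 + 1) → ℂ) :
    ∏ q, F q = (∏ a, F (qubitEquiv n (.inl a))) * ∏ i, ∏ j, F (qubitEquiv n (.inr (i, j))) := by
  rw [← (qubitEquiv n).prod_comp, Fintype.prod_sum_type, Fintype.prod_prod_type]

theorem map_queryQubits {n : ℕ} (p : (Fin 3 → Bool) × (Fin n → Fin n → Bool)) (i : Fin n)
    (h0 : p.1 0 = false) (h1 : p.1 1 = true) :
    (queryQubits n i).map (assignEquiv n p) = blockString n (i, p.2 i) := by
  simp only [queryQubits, List.map_append, List.map_replicate, assignEquiv_inl, h0, h1, blockString,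
    List.map_ofFn]
  congr 2
  funext j
  exact assignEquiv_inr p i j

theorem sum_prod_dot {n : ℕ} (f : (Fin n → Bool) → Bool) (z : Fin n → Bool) :
    ∑ x : Fin n → Bool, (∏ j, (1 / (Real.sqrt 2 : ℂ)) *
      ((if x j && z j then -1 else 1) / (Real.sqrt 2 : ℂ))) * (sgn (f x) : ℂ) =
      ((fourier (fun x => sgn (f x)) z / Real.sqrt (2 ^ n) : ℝ) : ℂ) := by
  have h1 : ∀ x : Fin n → Bool, ∏ j, (1 / (Real.sqrt 2 : ℂ)) *
      ((if x j && z j then -1 else 1) / (Real.sqrt 2 : ℂ)) =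
      (1 / 2 ^ n) * (-1) ^ dot x z := by
    intro x
    have h2 : ∀ j, (1 / (Real.sqrt 2 : ℂ)) * ((if x j && z j then -1 else 1) / (Real.sqrt 2 : ℂ))
        = (1 / 2) * (if x j = true ∧ z j = true then -1 else 1) := by
      intro j
      rw [div_mul_div_comm, one_mul, sqrt_two_mul_self]
      cases x j <;> cases z j <;> simp; norm_num
    simp only [h2]
    rw [prod_mul_distrib, prod_ite, prod_const, prod_const, prod_const_one, mul_one, dot]
    simp
  have h3 : Real.sqrt (2 ^ n) * Real.sqrt (2 ^ n) = 2 ^ n := Real.mul_self_sqrt (by positivity)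
  simp only [h1]
  rw [fourier, one_div_mul_eq_div, div_div, h3]
  push_cast
  rw [sum_div]
  exact sum_congr rfl fun x _ => by ring

/-- Between the layers each row `x` of the array carries the sign `f_i(x)`, so the final layer
computes a Fourier transform in every row. The final layer also acts on the auxiliary qubits, but
these stay unentangled and only contribute a separate factor of total weight 1. -/
theorem runGates_fishing {n : ℕ} (A : Oracle)
    (p : (Fin 3 → Bool) × (Fin n → Fin n → Bool)) :
    runGates A (fishingGates n) (Pi.single (fun _ => false) 1) (assignEquiv n p) =
      auxAmp p.1 * ∏ i, ((fourier (oracleFun A n i) (p.2 i) / Real.sqrt (2 ^ n) : ℝ) : ℂ) := by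
  rw [fishingGates, runGates_append, runGates_append, runGates_aux, runGates_layer]
  have hq2 : ∀ qs ∈ List.ofFn (queryQubits n), qubitEquiv n (.inl 2) ∉ qs := by
    intro qs hqs
    obtain ⟨i, rfl⟩ := (List.mem_ofFn' _ _).1 hqs
    simp [queryQubits, (qubitEquiv n).injective.eq_iff]
  rw [runGates_query A _ _ hq2]
  · rw [← (assignEquiv n).sum_comp, Fintype.sum_prod_type]
    -- only the assignments with the right constants contribute
    have hterm : ∀ (s : Fin 3 → Bool) (d : Fin n → Fin n → Bool),
        ((List.ofFn (queryQubits n)).map fun qs =>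
          (sgn (A (qs.map (assignEquiv n (s, d)))) : ℂ)).prod *
        prodState (fun q => Sum.elim auxState (fun _ _ => 1 / (Real.sqrt 2 : ℂ))
          ((qubitEquiv n).symm q)) (assignEquiv n (s, d)) *
        ∏ q, (if assignEquiv n (s, d) q && assignEquiv n p q then -1 else 1) / (Real.sqrt 2 : ℂ) =
        (∏ a, auxState a (s a) * ((if s a && p.1 a then -1 else 1) / (Real.sqrt 2 : ℂ))) *
        ∏ i, ((∏ j, (1 / (Real.sqrt 2 : ℂ)) *
          ((if d i j && p.2 i j then -1 else 1) / (Real.sqrt 2 : ℂ))) *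
          (sgn (A (blockString n (i, d i))) : ℂ)) := by
      intro s d
      rw [prodState, prod_qubits, prod_qubits]
      simp only [Equiv.symm_apply_apply, assignEquiv_inl, assignEquiv_inr, Sum.elim_inl,
        Sum.elim_inr, prod_mul_distrib]
      by_cases hs : s 0 = false ∧ s 1 = true
      · rw [List.map_ofFn, List.prod_ofFn]
        simp only [Function.comp_apply, map_queryQubits (s, d) _ hs.1 hs.2]
        ring
      · have : ∏ a, auxState a (s a) = 0 := by
          rw [Fin.prod_univ_three]
          cases h0 : s 0 <;> cases h1 : s 1 <;> simp_all [auxState]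
        rw [this]
        ring
    simp only [hterm]
    simp only [← mul_sum]
    rw [← sum_mul]
    congr 1
    · have := prod_univ_sum (fun _ : Fin 3 => (univ : Finset Bool))
        (fun a b => auxState a b * ((if b && p.1 a then -1 else 1) / (Real.sqrt 2 : ℂ)))
      rw [Fintype.piFinset_univ] at this
      rw [← this, auxAmp]
      refine prod_congr rfl fun a _ => ?_
      rw [Fintype.sum_bool, had]
      simp only [Bool.true_and, Bool.false_and, Bool.false_eq_true, if_false]
      ring
    · have := prod_univ_sum (fun _ : Fin n => (univ : Finset (Fin n → Bool)))
        (fun i x => (∏ j, (1 / (Real.sqrt 2 : ℂ)) *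
          ((if x j && p.2 i j then -1 else 1) / (Real.sqrt 2 : ℂ))) *
          (sgn (A (blockString n (i, x))) : ℂ))
      rw [Fintype.piFinset_univ] at this
      rw [← this]
      refine prod_congr rfl fun i _ => ?_
      exact sum_prod_dot (fun x => A (blockString n (i, x))) (p.2 i)
  · intro w
    rw [prodState_update, prodState_eq _ (qubitEquiv n (.inl 2)) w, ← neg_mul]
    congr 1
    rw [Equiv.symm_apply_apply]
    cases w (qubitEquiv n (.inl 2)) <;> simp [auxState, neg_div]

open Classical in
/-- The output distribution of an algorithm that writes down the circuit for Fourier Fishing and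
outputs the array. -/
theorem QuantumMachine.prob_fishing {Q : QuantumMachine} {A : Oracle} {n : ℕ} {x : List Bool}
    (hpre : readCircuit (Q.pre.eval A x []) = ⟨n * n + 2, fishingGates n⟩)
    (hpost : ∀ p, Q.post.eval A x (List.ofFn (assignEquiv n p)) = concat p.2)
    (S : Set (List Bool)) :
    Q.prob A x S = ∑ z : Fin n → Fin n → Bool,
      (∏ i, fourier (oracleFun A n i) (z i) ^ 2 / 2 ^ n) * if concat z ∈ S then 1 else 0 := by
  rw [QuantumMachine.prob, hpre, ← (assignEquiv n).sum_comp, Fintype.sum_prod_type, sum_comm]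
  refine sum_congr rfl fun z _ => ?_
  have h1 : ∀ s, ‖(⟨n * n + 2, fishingGates n⟩ : Circuit).state A (assignEquiv n (s, z))‖ ^ 2 =
      ‖auxAmp s‖ ^ 2 * ∏ i, fourier (oracleFun A n i) (z i) ^ 2 / 2 ^ n := by
    intro s
    have := runGates_fishing A (s, z)
    rw [Circuit.state]
    change ‖runGates A (fishingGates n) (Pi.single (fun _ => false) 1) (assignEquiv n (s, z))‖ ^ 2 = _
    rw [this, norm_mul, mul_pow, norm_prod, ← prod_pow]
    congr 1
    refine prod_congr rfl fun i _ => ?_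
    rw [Complex.norm_real, Real.norm_eq_abs, sq_abs, div_pow, Real.sq_sqrt (by positivity)]
  simp only [hpost, h1]
  split_ifs with h
  · rw [← sum_mul, sum_norm_sq_auxAmp, one_mul, mul_one]
  · simp
end BQPvsPH

namespace BQPvsPH

/-! ## Structured programs -/

/-- Structured programs for the stack machines: `loop s p q` pops bits from stack `s` until it is
empty and runs `p` after a bit `false` and `q` after a bit `true`. -/
inductive Prog where
  | skip
  | push (s : ℕ) (b : Bool)
  | drop (s : ℕ)
  | seq (p q : Prog)
  | loop (s : ℕ) (p q : Prog)

/-- The length of the compiled program. -/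
def Prog.len : Prog → ℕ
  | .skip => 0
  | .push _ _ => 1
  | .drop _ => 1
  | .seq p q => p.len + q.len
  | .loop _ p q => p.len + q.len + 3

/-- The program compiled for the position `o`. -/
def Prog.code : Prog → ℕ → List Instr
  | .skip, _ => []
  | .push s b, _ => [.push s b]
  | .drop s, o => [.pop s (o + 1) (o + 1) (o + 1)]
  | .seq p q, o => p.code o ++ q.code (o + p.len)
  | .loop s p q, o =>
    let i := Instr.pop s (o + (p.len + q.len + 3)) (o + 1) (o + 1 + (p.len + 1))
    i :: (p.code (o + 1) ++ i :: (q.code (o + 1 + (p.len + 1)) ++ [i]))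

theorem Prog.length_code (p : Prog) (o : ℕ) : (p.code o).length = p.len := by
  induction p generalizing o with
  | skip => rfl
  | push s b => rfl
  | drop s => rfl
  | seq p q hp hq => simp [Prog.code, Prog.len, hp, hq]
  | loop s p q hp hq => simp [Prog.code, Prog.len, hp, hq]; omega

/-- The code `c` is at position `o` of `P`. -/
def CodeAt (P : List Instr) (o : ℕ) (c : List Instr) : Prop :=
  ∃ l r, P = l ++ c ++ r ∧ l.length = o

theorem CodeAt.left {P : List Instr} {o : ℕ} {c c' : List Instr} (h : CodeAt P o (c ++ c')) :
    CodeAt P o c := by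
  obtain ⟨l, r, rfl, hl⟩ := h
  exact ⟨l, c' ++ r, by simp, hl⟩

theorem CodeAt.right {P : List Instr} {o : ℕ} {c c' : List Instr} (h : CodeAt P o (c ++ c')) :
    CodeAt P (o + c.length) c' := by
  obtain ⟨l, r, rfl, hl⟩ := h
  exact ⟨l ++ c, r, by simp, by simp [hl]⟩

theorem CodeAt.getElem? {P : List Instr} {o : ℕ} {i : Instr} {c : List Instr}
    (h : CodeAt P o (i :: c)) : P[o]? = some i := by
  obtain ⟨l, r, rfl, hl⟩ := h
  subst hl
  simp

theorem CodeAt.tail {P : List Instr} {o : ℕ} {i : Instr} {c : List Instr}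
    (h : CodeAt P o (i :: c)) : CodeAt P (o + 1) c :=
  CodeAt.right (c := [i]) h

/-- From the stacks `σ` the program arrives at the stacks `σ'` within `T` steps. -/
def Runs (p : Prog) (σ σ' : ℕ → List Bool) (T : ℕ) : Prop :=
  ∀ (A : Oracle) (P : List Instr) (o : ℕ), CodeAt P o (p.code o) →
    ∃ t ≤ T, (step A P)^[t] ⟨o, σ⟩ = ⟨o + p.len, σ'⟩

theorem Runs.mono {p : Prog} {σ σ' : ℕ → List Bool} {T T' : ℕ} (h : Runs p σ σ' T) (hT : T ≤ T') :
    Runs p σ σ' T' := fun A P o hc =>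
  let ⟨t, ht, h'⟩ := h A P o hc
  ⟨t, ht.trans hT, h'⟩

theorem runs_skip (σ : ℕ → List Bool) : Runs .skip σ σ 0 := fun _ _ _ _ => ⟨0, le_rfl, rfl⟩

theorem runs_push (s : ℕ) (b : Bool) (σ : ℕ → List Bool) :
    Runs (.push s b) σ (Function.update σ s (b :: σ s)) 1 := by
  intro A P o hc
  refine ⟨1, le_rfl, ?_⟩
  simp [step, hc.getElem?, Prog.len]

theorem runs_drop {s : ℕ} {b : Bool} {l : List Bool} {σ : ℕ → List Bool} (h : σ s = b :: l) :
    Runs (.drop s) σ (Function.update σ s l) 1 := by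
  intro A P o hc
  refine ⟨1, le_rfl, ?_⟩
  cases b <;> simp [step, hc.getElem?, Prog.len, h]

theorem Runs.seq {p q : Prog} {σ σ' σ'' : ℕ → List Bool} {T T' : ℕ} (hp : Runs p σ σ' T)
    (hq : Runs q σ' σ'' T') : Runs (.seq p q) σ σ'' (T + T') := by
  intro A P o hc
  obtain ⟨t, ht, h⟩ := hp A P o hc.left
  have h2 := hc.right
  rw [Prog.length_code] at h2
  obtain ⟨t', ht', h'⟩ := hq A P (o + p.len) h2
  refine ⟨t' + t, by omega, ?_⟩
  rw [Function.iterate_add_apply, h, h', Prog.len, add_assoc]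

/-- From each of the pop instructions of a loop, the loop arrives at `σ'` within `T` steps. -/
def LoopRuns (s : ℕ) (p q : Prog) (σ σ' : ℕ → List Bool) (T : ℕ) : Prop :=
  ∀ (A : Oracle) (P : List Instr) (o : ℕ), CodeAt P o ((Prog.loop s p q).code o) → ∀ j,
    P[j]? = some (.pop s (o + (p.len + q.len + 3)) (o + 1) (o + 1 + (p.len + 1))) →
    ∃ t ≤ T, (step A P)^[t] ⟨j, σ⟩ = ⟨o + (p.len + q.len + 3), σ'⟩

theorem LoopRuns.runs {s : ℕ} {p q : Prog} {σ σ' : ℕ → List Bool} {T : ℕ}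
    (h : LoopRuns s p q σ σ' T) : Runs (.loop s p q) σ σ' T :=
  fun A P o hc => h A P o hc o hc.getElem?

theorem loopRuns_nil {s : ℕ} (p q : Prog) {σ : ℕ → List Bool} (h : σ s = []) :
    LoopRuns s p q σ σ 1 := by
  intro A P o _ j hj
  refine ⟨1, le_rfl, ?_⟩
  simp [step, hj, h]

/-- The compiled loop has the same pop instruction at its entry and after each body. A body
therefore falls through to a valid loop test, and no unconditional jump is needed. -/
theorem loopRuns_cons {s : ℕ} {p q : Prog} {b : Bool} {l : List Bool} {σ σ' σ'' : ℕ → List Bool}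
    {T T' : ℕ} (h : σ s = b :: l)
    (hb : Runs (if b then q else p) (Function.update σ s l) σ' T)
    (hl : LoopRuns s p q σ' σ'' T') : LoopRuns s p q σ σ'' (T + T' + 1) := by
  intro A P o hc j hj
  have hp : CodeAt P (o + 1) (p.code (o + 1)) := hc.tail.left
  have hc2 := hc.tail.right
  rw [Prog.length_code] at hc2
  have hq : CodeAt P (o + 1 + (p.len + 1)) (q.code (o + 1 + (p.len + 1))) := hc2.tail.left
  have hc3 := hc2.tail.right
  rw [Prog.length_code] at hc3
  cases b
  · obtain ⟨t, ht, h1⟩ := hb A P (o + 1) hp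
    obtain ⟨t', ht', h2⟩ := hl A P o hc _ hc2.getElem?
    refine ⟨t' + (t + 1), by omega, ?_⟩
    rw [Function.iterate_add_apply, Function.iterate_succ_apply]
    simp only [step, hj, h]
    simp only [Bool.false_eq_true, if_false] at h1
    rw [← h2, ← h1]
  · obtain ⟨t, ht, h1⟩ := hb A P (o + 1 + (p.len + 1)) hq
    obtain ⟨t', ht', h2⟩ := hl A P o hc _ hc3.getElem?
    refine ⟨t' + (t + 1), by omega, ?_⟩
    rw [Function.iterate_add_apply, Function.iterate_succ_apply]
    simp only [step, hj, h]
    simp only [if_true] at h1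
    rw [← h2]
    congr 1

/-- A number in unary. -/
def unary (n : ℕ) : List Bool := List.replicate n false

/-- A loop over a unary counter. -/
theorem runs_loop {s N T : ℕ} {p : Prog} (G : ℕ → List Bool → ℕ → List Bool)
    (hs : ∀ k a, G k a s = a) (hu : ∀ k a b, Function.update (G k a) s b = G k b)
    (hp : ∀ k, k < N → Runs p (G k (unary (N - 1 - k))) (G (k + 1) (unary (N - 1 - k))) T) :
    Runs (.loop s p p) (G 0 (unary N)) (G N []) (N * (T + 1) + 1) := by
  -- Induction on the number `j` of rounds still to come; `N - j` rounds are done.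
  have h : ∀ j ≤ N, LoopRuns s p p (G (N - j) (unary j)) (G N []) (j * (T + 1) + 1) := by
    intro j
    induction j with
    | zero =>
      intro _
      rw [Nat.zero_mul]
      exact loopRuns_nil p p (hs _ _)
    | succ j ih =>
      intro hj
      have h1 := hp (N - (j + 1)) (by omega)
      have e1 : N - 1 - (N - (j + 1)) = j := by omega
      have e2 : N - (j + 1) + 1 = N - j := by omega
      rw [e1, e2] at h1
      have h2 := loopRuns_cons (s := s) (p := p) (q := p) (b := false) (l := unary j)
        (σ := G (N - (j + 1)) (unary (j + 1))) (by rw [hs]; rfl) (by rw [hu]; exact h1)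
        (ih (by omega))
      convert h2 using 1
      ring
  have := h N le_rfl
  rw [Nat.sub_self] at this
  exact this.runs

/-- Run `p` as many times as stack `r` is high, using stack `t` to restore it. -/
def each (r t : ℕ) (p : Prog) : Prog :=
  .seq (.loop r (.seq (.push t false) p) (.seq (.push t false) p))
    (.loop t (.push r false) (.push r false))

/-- `G k a b` describes the stacks after `k` rounds, with `a` on the counter and `b` on its copy.
The body must work for all `a` and `b`, as both change from round to round. -/
theorem runs_each {r t N T : ℕ} {p : Prog} (G : ℕ → List Bool → List Bool → ℕ → List Bool)
    (hr : ∀ k a b, G k a b r = a) (ht : ∀ k a b, G k a b t = b)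
    (hur : ∀ k a b c, Function.update (G k a b) r c = G k c b)
    (hut : ∀ k a b c, Function.update (G k a b) t c = G k a c)
    (hp : ∀ k, k < N → ∀ a b, Runs p (G k a b) (G (k + 1) a b) T) :
    Runs (each r t p) (G 0 (unary N) []) (G N (unary N) []) (N * (T + 2) + 1 + (N * 2 + 1)) := by
  have h1 := runs_loop (s := r) (N := N) (T := T + 1) (p := .seq (.push t false) p)
    (fun k a => G k a (unary k)) (fun k a => hr _ _ _) (fun k a b => hur _ _ _ _) (fun k hk => by
      have h := runs_push t false (G k (unary (N - 1 - k)) (unary k))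
      rw [hut, ht] at h
      have := h.seq (hp k hk (unary (N - 1 - k)) (false :: unary k))
      exact this.mono (add_comm _ _).le)
  have h2 := runs_loop (s := t) (N := N) (T := 1) (p := .push r false)
    (fun k b => G N (unary k) b) (fun k a => ht _ _ _) (fun k a b => hut _ _ _ _) (fun k hk => by
      have h := runs_push r false (G N (unary k) (unary (N - 1 - k)))
      rw [hur, hr] at h
      exact h)
  exact h1.seq h2

/-- Move stack `r` onto stack `t`. -/
def move (r t : ℕ) : Prog := .loop r (.push t false) (.push t true)

theorem runs_move {r t : ℕ} (G : List Bool → List Bool → ℕ → List Bool)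
    (hr : ∀ a b, G a b r = a) (ht : ∀ a b, G a b t = b)
    (hur : ∀ a b c, Function.update (G a b) r c = G c b)
    (hut : ∀ a b c, Function.update (G a b) t c = G a c) (l l' : List Bool) :
    Runs (move r t) (G l l') (G [] (l.reverse ++ l')) (2 * l.length + 1) := by
  have h : LoopRuns r (.push t false) (.push t true) (G l l') (G [] (l.reverse ++ l'))
      (2 * l.length + 1) := by
    induction l generalizing l' with
    | nil => exact loopRuns_nil _ _ (hr _ _)
    | cons b l ih =>
      have h1 := runs_push t b (G l l')
      rw [hut, ht] at h1
      have h2 := loopRuns_cons (s := r) (p := .push t false) (q := .push t true) (b := b) (l := l)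
        (σ := G (b :: l) l') (σ' := G l (b :: l')) (T := 1) (hr _ _)
        (by rw [hur]; cases b <;> exact h1) (ih (b :: l'))
      convert h2 using 1
      · simp
      · simp; ring
  exact h.runs

/-- The machine that runs a structured program. -/
def Prog.machine (p : Prog) (k : ℕ) : Machine := ⟨p.code 0, k⟩

/-- After the last instruction the configuration is fixed, so the time left on the clock does no
harm. -/
theorem Prog.machine_eval {p : Prog} {k T : ℕ} {σ : ℕ → List Bool} {A : Oracle} {x y : List Bool}
    (h : Runs p (startConfig x y).stack σ T) (hT : T ≤ polyBound k (x.length + y.length)) :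
    (p.machine k).eval A x y = σ 2 := by
  obtain ⟨t, ht, h1⟩ := h A (p.code 0) 0 ⟨[], [], by simp, rfl⟩
  have hhalt : ∀ j, (step A (p.code 0))^[j] ⟨0 + p.len, σ⟩ = ⟨0 + p.len, σ⟩ := by
    intro j
    refine Function.iterate_fixed ?_ j
    rw [step, List.getElem?_eq_none (by rw [Prog.length_code]; exact (Nat.zero_add _).ge)]
  obtain ⟨j, hj⟩ := Nat.exists_eq_add_of_le (ht.trans hT)
  rw [Machine.eval]
  change ((step A (p.code 0))^[polyBound k (x.length + y.length)]
    ⟨0, (startConfig x y).stack⟩).stack 2 = σ 2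
  rw [hj, add_comm, Function.iterate_add_apply, h1, hhalt]
end BQPvsPH

namespace BQPvsPH

/-! ## Programs for Fourier Fishing -/

/-- The contents of the stacks, given as a list. -/
def regs (l : List (List Bool)) : ℕ → List Bool := fun s => l.getD s []

theorem regs_update {l : List (List Bool)} {i : ℕ} {x : List Bool} (h : i < l.length) :
    Function.update (regs l) i x = regs (l.set i x) := by
  funext s
  by_cases hs : s = i
  · subst hs
    simp [regs, h]
  · rw [Function.update_of_ne hs]
    simp [regs, List.getElem?_set_ne (Ne.symm hs)]

theorem runs_push_regs {l : List (List Bool)} (i : ℕ) (b : Bool) (h : i < l.length) :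
    Runs (.push i b) (regs l) (regs (l.set i (b :: l.getD i []))) 1 := by
  have := runs_push i b (regs l)
  rwa [regs_update h] at this

theorem runs_drop_regs {l : List (List Bool)} {i : ℕ} {b : Bool} {m : List Bool}
    (h : i < l.length) (hi : l.getD i [] = b :: m) :
    Runs (.drop i) (regs l) (regs (l.set i m)) 1 := by
  have := runs_drop (σ := regs l) (s := i) hi
  rwa [regs_update h] at this

theorem startConfig_stack (x y : List Bool) :
    (startConfig x y).stack = regs [x, y, [], [], [], [], [], []] := by
  funext s
  simp only [startConfig, regs]
  match s with
  | 0 => rfl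
  | 1 => rfl
  | 2 => rfl
  | 3 => rfl
  | 4 => rfl
  | 5 => rfl
  | 6 => rfl
  | 7 => rfl
  | s + 8 => simp

/-- The encoding of a list of numbers that `readNumbers` decodes. -/
def enc (l : List ℕ) : List Bool := l.flatMap fun a => List.replicate a true ++ [false]

theorem enc_append (l l' : List ℕ) : enc (l ++ l') = enc l ++ enc l' := List.flatMap_append

theorem enc_cons_append (a : ℕ) (l : List ℕ) (t : List Bool) :
    enc (a :: l) ++ t = enc [a] ++ (enc l ++ t) := by
  simp [enc]

theorem readNumbers_enc (l : List ℕ) : readNumbers 0 (enc l) = l := by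
  have h : ∀ a b t, readNumbers b (List.replicate a true ++ false :: t)
      = (b + a) :: readNumbers 0 t := by
    intro a
    induction a with
    | zero => intro b t; rfl
    | succ a ih =>
      intro b t
      rw [List.replicate_succ, List.cons_append, readNumbers, ih]
      congr 1
      omega
  induction l with
  | nil => rfl
  | cons a l ih =>
    have : enc (a :: l) = List.replicate a true ++ false :: enc l := by simp [enc]
    rw [this, h, ih, Nat.zero_add]

/-- Push a list of bits on stack `2`. -/
def pushAll : List Bool → Prog
  | [] => .skip
  | b :: l => .seq (pushAll l) (.push 2 b)

theorem runs_pushAll (l t : List Bool) (x₀ x₁ x₃ x₄ x₅ x₆ x₇ : List Bool) :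
    Runs (pushAll l) (regs [x₀, x₁, t, x₃, x₄, x₅, x₆, x₇])
      (regs [x₀, x₁, l ++ t, x₃, x₄, x₅, x₆, x₇]) l.length := by
  induction l with
  | nil => exact runs_skip _
  | cons b l ih => exact ih.seq (runs_push_regs 2 b (by simp))

/-- Push the number on stack `4` on stack `2`. -/
def emit : Prog := .seq (.push 2 false) (each 4 7 (.push 2 true))

/-- The output is read from the top of its stack, so the terminating `false` has to be pushed before
the ones. -/
theorem runs_emit (a : ℕ) (t x₀ x₁ x₃ x₅ x₆ : List Bool) :
    Runs emit (regs [x₀, x₁, t, x₃, unary a, x₅, x₆, []])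
      (regs [x₀, x₁, enc [a] ++ t, x₃, unary a, x₅, x₆, []]) (5 * a + 3) := by
  have h := (runs_push_regs (l := [x₀, x₁, t, x₃, unary a, x₅, x₆, []]) 2 false (by simp)).seq
    (runs_each (r := 4) (t := 7) (N := a) (T := 1) (p := .push 2 true)
      (fun k u v => regs [x₀, x₁, List.replicate k true ++ (false :: t), x₃, u, x₅, x₆, v])
      (fun _ _ _ => rfl) (fun _ _ _ => rfl) (fun _ _ _ _ => regs_update (by simp))
      (fun _ _ _ _ => regs_update (by simp)) (fun k _ u v => runs_push_regs 2 true (by simp)))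
  have e : enc [a] ++ t = List.replicate a true ++ (false :: t) := by simp [enc]
  rw [e]
  exact h.mono (by omega)

/-- Write `n * n + 3` on stack `4`. -/
def setCounter : Prog :=
  .seq (each 0 3 (.push 7 false)) <| .seq (each 0 3 (each 7 1 (.push 4 false))) <|
    .seq (.loop 7 .skip .skip) <| .seq (.push 4 false) <| .seq (.push 4 false) (.push 4 false)

theorem runs_setCounter (n : ℕ) (t x₅ x₆ : List Bool) :
    Runs setCounter (regs [unary n, [], t, [], [], x₅, x₆, []])
      (regs [unary n, [], t, [], unary (n * n + 3), x₅, x₆, []]) (5 * n * n + 20 * n + 20) := by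
  have h1 := runs_each (r := 0) (t := 3) (N := n) (T := 1) (p := .push 7 false)
    (fun k u v => regs [u, [], t, v, [], x₅, x₆, unary k])
    (fun _ _ _ => rfl) (fun _ _ _ => rfl) (fun _ _ _ _ => regs_update (by simp))
    (fun _ _ _ _ => regs_update (by simp)) (fun k _ u v => runs_push_regs 7 false (by simp))
  have h2 := fun (k : ℕ) (u v : List Bool) =>
    runs_each (r := 7) (t := 1) (N := n) (T := 1) (p := .push 4 false)
      (fun j u' v' => regs [u, v', t, v, unary (n * k + j), x₅, x₆, u'])
      (fun _ _ _ => rfl) (fun _ _ _ => rfl) (fun _ _ _ _ => regs_update (by simp))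
      (fun _ _ _ _ => regs_update (by simp)) (fun j _ u v => runs_push_regs 4 false (by simp))
  have h3 := runs_each (r := 0) (t := 3) (N := n) (p := each 7 1 (.push 4 false))
    (fun k u v => regs [u, [], t, v, unary (n * k), x₅, x₆, unary n])
    (fun _ _ _ => rfl) (fun _ _ _ => rfl) (fun _ _ _ _ => regs_update (by simp))
    (fun _ _ _ _ => regs_update (by simp)) (fun k _ u v => h2 k u v)
  have h4 := runs_loop (s := 7) (N := n) (T := 0) (p := .skip)
    (fun _ u => regs [unary n, [], t, [], unary (n * n), x₅, x₆, u])
    (fun _ _ => rfl) (fun _ _ _ => regs_update (by simp)) (fun _ _ => runs_skip _)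
  have h5 := fun a => runs_push_regs
    (l := [unary n, [], t, [], unary a, x₅, x₆, []]) 4 false (by simp)
  have h := h1.seq (h3.seq (h4.seq ((h5 (n * n)).seq ((h5 (n * n + 1)).seq (h5 (n * n + 2))))))
  exact h.mono (by nlinarith)

/-- Write a layer of Hadamard gates for the first qubits, their number being on stack `4`. -/
def writeLayer : Prog := .loop 4 (.seq emit (.push 2 false)) (.seq emit (.push 2 false))

/-- The numbers that describe a layer of Hadamard gates for `m` qubits. -/
def layerNumbers (m : ℕ) : List ℕ := (List.range m).flatMap fun q => [0, q]

theorem drop_range_sub_succ {m k : ℕ} (h : k < m) :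
    (List.range m).drop (m - (k + 1)) = (m - 1 - k) :: (List.range m).drop (m - k) := by
  have e : m - (k + 1) = m - 1 - k := by omega
  rw [e, List.drop_eq_getElem_cons (by simp; omega), List.getElem_range]
  congr 2
  omega

/-- The popped counter equals the index of the current qubit. Indices are written in descending
order, each followed by a single `false`, which encodes the gate code 0 and lands in front of it. -/
theorem runs_writeLayer (m : ℕ) (t x₀ x₁ x₃ x₅ x₆ : List Bool) :
    Runs writeLayer (regs [x₀, x₁, t, x₃, unary m, x₅, x₆, []])
      (regs [x₀, x₁, enc (layerNumbers m) ++ t, x₃, [], x₅, x₆, []]) (m * (5 * m + 5) + 1) := by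
  have h := runs_loop (s := 4) (N := m) (T := 5 * m + 4) (p := .seq emit (.push 2 false))
    (fun k u => regs [x₀, x₁, enc (((List.range m).drop (m - k)).flatMap fun q => [0, q]) ++ t,
      x₃, u, x₅, x₆, []])
    (fun _ _ => rfl) (fun _ _ _ => regs_update (by simp)) (fun k hk => by
      rw [drop_range_sub_succ hk]
      have h1 := runs_emit (m - 1 - k)
        (enc (((List.range m).drop (m - k)).flatMap fun q => [0, q]) ++ t) x₀ x₁ x₃ x₅ x₆
      rw [List.flatMap_cons, List.cons_append, List.singleton_append, enc_cons_append 0,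
        enc_cons_append (m - 1 - k)]
      exact (h1.seq (runs_push_regs 2 false (by simp))).mono
        (show 5 * (m - 1 - k) + 3 + 1 ≤ 5 * m + 4 by omega))
  simp only [Nat.sub_zero, Nat.sub_self, List.drop_zero] at h
  rw [List.drop_of_length_le (by simp)] at h
  exact h

/-- Write the positions of a row of the array, which ends before the number on stack `4`. -/
def writeRow : Prog := each 0 3 (.seq (.drop 4) emit)

theorem runs_writeRow {n b : ℕ} (hb : b + n ≤ n * n + 3) (t x₅ x₆ : List Bool) :
    Runs writeRow (regs [unary n, [], t, [], unary (b + n), x₅, x₆, []])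
      (regs [unary n, [], enc ((List.range n).map fun j => b + j) ++ t, [], unary b, x₅, x₆, []])
      (n * (5 * n * n + 21) + 1 + (n * 2 + 1)) := by
  have h := runs_each (r := 0) (t := 3) (N := n) (T := 5 * n * n + 19) (p := .seq (.drop 4) emit)
    (fun k u v => regs [u, [], enc (((List.range n).drop (n - k)).map fun j => b + j) ++ t, v,
      unary (b + (n - k)), x₅, x₆, []])
    (fun _ _ _ => rfl) (fun _ _ _ => rfl) (fun _ _ _ _ => regs_update (by simp))
    (fun _ _ _ _ => regs_update (by simp)) (fun k hk u v => by
      rw [drop_range_sub_succ hk]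
      have e : b + (n - k) = b + (n - 1 - k) + 1 := by omega
      have e' : b + (n - (k + 1)) = b + (n - 1 - k) := by omega
      rw [e, e']
      have h1 := runs_emit (b + (n - 1 - k))
        (enc (((List.range n).drop (n - k)).map fun j => b + j) ++ t) u [] v x₅ x₆
      rw [List.map_cons, enc_cons_append]
      refine (Runs.seq (runs_drop_regs (b := false) (by simp) rfl) h1).mono ?_
      have : b + (n - 1 - k) ≤ n * n + 3 := by omega
      nlinarith)
  simp only [Nat.sub_zero, Nat.sub_self, List.drop_zero] at h
  rw [List.drop_of_length_le (by simp)] at h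
  exact h

/-- The numbers that describe the query for the `i`-th function. -/
def queryNumbers (n i : ℕ) : List ℕ :=
  [3, 2, 2 * n] ++ (List.replicate i 1 ++ (List.replicate (n - i) 0 ++
    (List.range n).map fun j => 3 + n * i + j))

/-- Write the numbers of the query for the `i`-th function, with `i` on stack `5` and `n - i - 1`
on stack `6`. -/
def writeQuery : Prog :=
  .seq (.push 6 false) <| .seq writeRow <| .seq (each 6 3 (.push 2 false)) <|
    .seq (each 5 3 (.seq (.push 2 false) (.push 2 true))) <| .seq (.push 2 false) <|
      .seq (each 0 3 (.seq (.push 2 true) (.push 2 true))) (pushAll (enc [3, 2]))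

/-- Everything is pushed in reverse: the row of the array, then `n - i` zeros and `i` ones for the
constant qubits, then the number `2 * n` of queried qubits, and last the gate code 3 with target 2.
Stack 6 grows and stack 4 moves down by one row, ready for the preceding query. -/
theorem runs_writeQuery {n i : ℕ} (hi : i < n) (t : List Bool) :
    Runs writeQuery (regs [unary n, [], t, [], unary (3 + n * i + n), unary i,
        unary (n - 1 - i), []])
      (regs [unary n, [], enc (queryNumbers n i) ++ t, [], unary (3 + n * i), unary i,
        unary (n - i), []])
      (5 * n * n * n + 100 * n + 100) := by
  have e : n - i = n - 1 - i + 1 := by omega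
  have hb : 3 + n * i + n ≤ n * n + 3 := by nlinarith
  have h1 : Runs _ _ (regs [unary n, [], t, [], unary (3 + n * i + n), unary i,
      unary (n - 1 - i + 1), []]) 1 :=
    runs_push_regs (l := [unary n, [], t, [], unary (3 + n * i + n), unary i,
        unary (n - 1 - i), []]) 6 false (by simp)
  rw [← e] at h1
  have h2 := runs_writeRow hb t (unary i) (unary (n - 1 - i + 1))
  rw [← e] at h2
  generalize hrow : enc ((List.range n).map fun j => 3 + n * i + j) ++ t = t2 at h2
  have h3 := runs_each (r := 6) (t := 3) (N := n - i) (T := 1) (p := .push 2 false)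
    (fun k u v => regs [unary n, [], enc (List.replicate k 0) ++ t2, v, unary (3 + n * i), unary i,
      u, []])
    (fun _ _ _ => rfl) (fun _ _ _ => rfl) (fun _ _ _ _ => regs_update (by simp))
    (fun _ _ _ _ => regs_update (by simp)) (fun k _ u v => runs_push_regs 2 false (by simp))
  generalize hzero : enc (List.replicate (n - i) 0) ++ t2 = t3 at h3
  have h4 := runs_each (r := 5) (t := 3) (N := i) (T := 2)
    (p := .seq (.push 2 false) (.push 2 true))
    (fun k u v => regs [unary n, [], enc (List.replicate k 1) ++ t3, v, unary (3 + n * i), u,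
      unary (n - i), []])
    (fun _ _ _ => rfl) (fun _ _ _ => rfl) (fun _ _ _ _ => regs_update (by simp))
    (fun _ _ _ _ => regs_update (by simp)) (fun k _ u v =>
      (runs_push_regs 2 false (by simp)).seq (runs_push_regs 2 true (by simp)))
  generalize hone : enc (List.replicate i 1) ++ t3 = t4 at h4
  have h5 := runs_push_regs (l := [unary n, [], t4, [], unary (3 + n * i), unary i,
        unary (n - i), []]) 2 false (by simp)
  have h6 := runs_each (r := 0) (t := 3) (N := n) (T := 2)
    (p := .seq (.push 2 true) (.push 2 true))
    (fun k u v => regs [u, [], List.replicate (2 * k) true ++ (false :: t4), v,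
      unary (3 + n * i), unary i, unary (n - i), []])
    (fun _ _ _ => rfl) (fun _ _ _ => rfl) (fun _ _ _ _ => regs_update (by simp))
    (fun _ _ _ _ => regs_update (by simp)) (fun k _ u v =>
      (runs_push_regs 2 true (by simp)).seq (runs_push_regs 2 true (by simp)))
  have h7 := runs_pushAll (enc [3, 2]) (List.replicate (2 * n) true ++ (false :: t4))
    (unary n) [] [] (unary (3 + n * i)) (unary i) (unary (n - i)) []
  have h := h1.seq (h2.seq (h3.seq (h4.seq (h5.seq (h6.seq h7)))))
  have et : enc (queryNumbers n i) ++ t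
      = enc [3, 2] ++ (List.replicate (2 * n) true ++ (false :: t4)) := by
    rw [← hone, ← hzero, ← hrow, queryNumbers, enc_append, enc_append, enc_append]
    simp [enc]
  rw [et]
  refine h.mono ?_
  have : (enc [3, 2]).length = 7 := rfl
  rw [this]
  have : n - i ≤ n := Nat.sub_le _ _
  nlinarith

end BQPvsPH

/-! ### The program that writes the complete circuit -/

namespace BQPvsPH
open Filter

theorem runs_loop_writeQuery (n : ℕ) (t : List Bool) :
    Runs (.loop 5 writeQuery writeQuery)
      (regs [unary n, [], t, [], unary (n * n + 3), unary n, [], []])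
      (regs [unary n, [], enc ((List.range n).flatMap (queryNumbers n)) ++ t, [], unary 3, [],
        unary n, []])
      (n * (5 * n * n * n + 100 * n + 100 + 1) + 1) := by
  have h := runs_loop (s := 5) (N := n) (T := 5 * n * n * n + 100 * n + 100) (p := writeQuery)
    (fun k u => regs [unary n, [],
      enc (((List.range n).drop (n - k)).flatMap (queryNumbers n)) ++ t, [],
      unary (3 + n * (n - k)), u, unary k, []])
    (fun _ _ => rfl) (fun _ _ _ => regs_update (by simp)) (fun k hk => by
      have h1 := runs_writeQuery (show n - 1 - k < n by omega)
        (enc (((List.range n).drop (n - k)).flatMap (queryNumbers n)) ++ t)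
      have e1 : 3 + n * (n - 1 - k) + n = 3 + n * (n - k) := by
        have : n - k = n - 1 - k + 1 := by omega
        rw [this]; ring
      have e2 : n - 1 - (n - 1 - k) = k := by omega
      have e3 : n - (n - 1 - k) = k + 1 := by omega
      have e4 : n - (k + 1) = n - 1 - k := by omega
      rw [e1, e2, e3] at h1
      rw [drop_range_sub_succ hk, List.flatMap_cons, enc_append, List.append_assoc, e4]
      exact h1)
  simp only [Nat.sub_zero, Nat.sub_self, List.drop_zero] at h
  rw [List.drop_of_length_le (by simp), add_comm 3 (n * n)] at h
  exact h

/-- The numbers that describe the preparation of the auxiliary qubits. -/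
def auxNumbers : List ℕ := [0, 0, 1, 1, 1, 1, 1, 1, 1, 1, 0, 1, 1, 2, 1, 2, 1, 2, 1, 2]

/-- The program that writes down the circuit for Fourier Fishing. -/
def fishingProg : Prog :=
  .seq setCounter <| .seq writeLayer <| .seq setCounter <| .seq (each 0 3 (.push 5 false)) <|
    .seq (.loop 5 writeQuery writeQuery) <| .seq (.loop 4 .skip .skip) <|
    .seq (pushAll (enc auxNumbers)) <| .seq setCounter <| .seq writeLayer <| .seq setCounter <|
    .seq (.drop 4) emit

/-- The numbers that describe the circuit for Fourier Fishing. -/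
def fishingNumbers (n : ℕ) : List ℕ :=
  (n * n + 2) :: (layerNumbers (n * n + 3) ++ (auxNumbers ++
    ((List.range n).flatMap (queryNumbers n) ++ layerNumbers (n * n + 3))))

/-- The circuit is written from its last layer back to its first number. Stack 0 keeps `n`, stack 2
takes the output, stack 4 counts qubits, and stacks 5 and 6 hold the position in the list of
queries. -/
theorem runs_fishingProg (n : ℕ) : ∃ σ, σ 2 = enc (fishingNumbers n) ∧
    Runs fishingProg (regs [unary n, [], [], [], [], [], [], []]) σ
      (1000 * (n * n * n * n) + 1000) := by
  have hC := fun t x₅ x₆ => runs_setCounter n t x₅ x₆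
  have hL := fun t x₅ x₆ => runs_writeLayer (n * n + 3) t (unary n) [] [] x₅ x₆
  have hI := fun (t : List Bool) => runs_each (r := 0) (t := 3) (N := n) (T := 1)
    (p := .push 5 false)
    (fun k u v => regs [u, [], t, v, unary (n * n + 3), unary k, [], []])
    (fun _ _ _ => rfl) (fun _ _ _ => rfl) (fun _ _ _ _ => regs_update (by simp))
    (fun _ _ _ _ => regs_update (by simp)) (fun k _ u v => runs_push_regs 5 false (by simp))
  have hE := fun (t : List Bool) => runs_loop (s := 4) (N := 3) (T := 0) (p := .skip)
    (fun _ u => regs [unary n, [], t, [], u, [], unary n, []])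
    (fun _ _ => rfl) (fun _ _ _ => regs_update (by simp)) (fun _ _ => runs_skip _)
  have hA := fun t => runs_pushAll (enc auxNumbers) t (unary n) [] [] [] [] (unary n) []
  have hD := fun (t : List Bool) => runs_drop_regs
    (l := [unary n, [], t, [], unary (n * n + 3), [], unary n, []]) (i := 4) (b := false)
    (m := unary (n * n + 2)) (by simp) rfl
  have hF := fun t => runs_emit (n * n + 2) t (unary n) [] [] [] (unary n)
  set m := n * n + 3 with hm
  have h := (hC [] [] []).seq <| (hL [] [] []).seq <| (hC _ [] []).seq <| (hI _).seq <|
    (runs_loop_writeQuery n _).seq <| (hE _).seq <| (hA _).seq <| (hC _ _ _).seq <|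
    (hL _ _ _).seq <| (hC _ _ _).seq <| (hD _).seq (hF _)
  refine ⟨_, ?_, h.mono ?_⟩
  · show enc [n * n + 2] ++ (enc (layerNumbers m) ++ (enc auxNumbers ++ (enc
      ((List.range n).flatMap (queryNumbers n)) ++ (enc (layerNumbers m) ++ [])))) = _
    simp only [fishingNumbers, ← enc_append, ← hm, List.append_nil, List.singleton_append]
  · have e : (enc auxNumbers).length = 41 := rfl
    rw [e, hm]
    have h1 : n ≤ n * n := Nat.le_mul_self n
    have h2 : n * n ≤ n * n * (n * n) := Nat.le_mul_self _
    nlinarith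

/-! ### Decoding the written numbers -/

theorem readGates_flatMap_hadamard (m : ℕ) [NeZero m] (L l : List ℕ) :
    readGates m (L.flatMap (fun q => [0, q]) ++ l) =
      (L.map fun q => Gate.hadamard (Fin.ofNat m q)) ++ readGates m l := by
  induction L with
  | nil => rfl
  | cons q L ih =>
    rw [List.flatMap_cons, List.append_assoc, List.cons_append, List.cons_append, List.nil_append,
      readGates, ih, List.map_cons, List.cons_append]

theorem map_ofNat_range {m : ℕ} [NeZero m] {α : Type*} (g : Fin m → α) :
    ((List.range m).map fun q => g (Fin.ofNat m q)) = (List.finRange m).map g := by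
  rw [← List.map_coe_finRange_eq_range, List.map_map]
  congr 1
  funext i
  simp

theorem readGates_layerNumbers (m : ℕ) [NeZero m] (l : List ℕ) :
    readGates m (layerNumbers m ++ l) = layer m ++ readGates m l := by
  rw [layerNumbers, readGates_flatMap_hadamard, map_ofNat_range Gate.hadamard, layer]

theorem ofNat_qubit_inl {n : ℕ} (a : Fin 3) :
    Fin.ofNat (n * n + 2 + 1) a = qubitEquiv n (.inl a) := by
  apply Fin.ext
  rw [Fin.val_ofNat, qubitEquiv_inl, Nat.mod_eq_of_lt]
  omega

theorem ofNat_qubit_inr {n : ℕ} (i j : Fin n) :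
    Fin.ofNat (n * n + 2 + 1) (3 + n * i + j) = qubitEquiv n (.inr (i, j)) := by
  have := qubitEquiv_inr i j
  rw [← add_assoc, mul_comm (i : ℕ)] at this
  rw [← this]
  simp

theorem readGates_auxNumbers (n : ℕ) (l : List ℕ) :
    readGates (n * n + 2 + 1) (auxNumbers ++ l) = auxGates n ++ readGates (n * n + 2 + 1) l := by
  have h0 : Fin.ofNat (n * n + 2 + 1) 0 = qubitEquiv n (.inl 0) := ofNat_qubit_inl 0
  have h1 : Fin.ofNat (n * n + 2 + 1) 1 = qubitEquiv n (.inl 1) := ofNat_qubit_inl 1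
  have h2 : Fin.ofNat (n * n + 2 + 1) 2 = qubitEquiv n (.inl 2) := ofNat_qubit_inl 2
  simp only [auxNumbers, List.cons_append, List.nil_append, readGates, h0, h1, h2, auxGates]

theorem readGates_queryNumbers {n : ℕ} (i : Fin n) (l : List ℕ) :
    readGates (n * n + 2 + 1) (queryNumbers n i ++ l) =
      .query (queryQubits n i) (qubitEquiv n (.inl 2)) :: readGates (n * n + 2 + 1) l := by
  have h2 : Fin.ofNat (n * n + 2 + 1) 2 = qubitEquiv n (.inl 2) := ofNat_qubit_inl 2
  have h0 : Fin.ofNat (n * n + 2 + 1) 0 = qubitEquiv n (.inl 0) := ofNat_qubit_inl 0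
  have h1 : Fin.ofNat (n * n + 2 + 1) 1 = qubitEquiv n (.inl 1) := ofNat_qubit_inl 1
  set r : List ℕ := List.replicate i 1 ++ (List.replicate (n - i) 0 ++
    (List.range n).map fun j => 3 + n * i + j) with hr
  have hlen : r.length = 2 * n := by simp [hr]; omega
  have e : queryNumbers n i ++ l = 3 :: 2 :: (2 * n) :: (r ++ l) := rfl
  rw [e, readGates, List.take_left' hlen, List.drop_left' hlen, h2]
  congr 2
  rw [hr, queryQubits, List.map_append, List.map_append, List.map_replicate, List.map_replicate,
    h0, h1, List.append_assoc, List.map_map]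
  congr 2
  rw [List.ofFn_eq_map, ← List.map_coe_finRange_eq_range, List.map_map]
  congr 1
  funext j
  exact ofNat_qubit_inr i j

theorem readCircuit_fishing (n : ℕ) :
    readCircuit (enc (fishingNumbers n)) = ⟨n * n + 2, fishingGates n⟩ := by
  rw [readCircuit, readNumbers_enc, fishingNumbers]
  simp only
  congr 1
  have hq : ∀ (L : List (Fin n)) (l : List ℕ),
      readGates (n * n + 2 + 1) ((L.map Fin.val).flatMap (queryNumbers n) ++ l) =
        ((L.map (queryQubits n)).map fun qs => Gate.query qs (qubitEquiv n (.inl 2))) ++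
          readGates (n * n + 2 + 1) l := by
    intro L l
    induction L with
    | nil => rfl
    | cons i L ih =>
      rw [List.map_cons, List.flatMap_cons, List.append_assoc, readGates_queryNumbers, ih]
      rfl
  have hn : readGates (n * n + 2 + 1) [] = [] := by simp [readGates]
  have hlast := readGates_layerNumbers (n * n + 2 + 1) []
  rw [hn, List.append_nil, List.append_nil] at hlast
  rw [readGates_layerNumbers (n * n + 2 + 1), readGates_auxNumbers,
    ← List.map_coe_finRange_eq_range, hq, hlast, fishingGates, List.ofFn_eq_map]
  simp only [List.append_assoc]

/-- The program that drops three bits of the second input and outputs the rest. -/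
def outputProg : Prog :=
  .seq (.drop 1) <| .seq (.drop 1) <| .seq (.drop 1) <| .seq (move 1 3) (move 3 2)

/-- The auxiliary qubits come first in the measurement outcome. A move reverses a stack, so two
moves restore the order. -/
theorem runs_outputProg (x l : List Bool) (a b c : Bool) :
    ∃ σ, σ 2 = l ∧ Runs outputProg (regs [x, a :: b :: c :: l, [], [], [], [], [], []]) σ
      (4 * l.length + 5) := by
  have hD := fun (u : List Bool) (b : Bool) => runs_drop_regs
    (l := [x, b :: u, [], [], [], [], [], []]) (i := 1) (b := b) (m := u) (by simp) rfl
  have h1 := runs_move (r := 1) (t := 3) (fun u v => regs [x, u, [], v, [], [], [], []])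
    (fun _ _ => rfl) (fun _ _ => rfl) (fun _ _ _ => regs_update (by simp))
    (fun _ _ _ => regs_update (by simp)) l []
  have h2 := runs_move (r := 3) (t := 2) (fun u v => regs [x, [], v, u, [], [], [], []])
    (fun _ _ => rfl) (fun _ _ => rfl) (fun _ _ _ => regs_update (by simp))
    (fun _ _ _ => regs_update (by simp)) (l.reverse ++ []) []
  have h := (hD (b :: c :: l) a).seq <| (hD (c :: l) b).seq <| (hD l c).seq <| h1.seq h2
  refine ⟨_, ?_, h.mono ?_⟩
  · show (l.reverse ++ []).reverse ++ [] = l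
    simp
  · simp; omega

/-- The quantum algorithm for Fourier Fishing. -/
def fishingMachine : QuantumMachine := ⟨fishingProg.machine 5, outputProg.machine 5⟩

/-- From `n = 2000` on, the clock `n^5 + 5` covers the `1000 n^4 + 1000` steps of the program. -/
theorem fishingMachine_pre {n : ℕ} (hn : 2000 ≤ n) (A : Oracle) :
    readCircuit (fishingMachine.pre.eval A (List.replicate n false) []) =
      ⟨n * n + 2, fishingGates n⟩ := by
  obtain ⟨σ, hσ, h⟩ := runs_fishingProg n
  have : fishingMachine.pre.eval A (List.replicate n false) [] = σ 2 := by
    refine Prog.machine_eval (by rw [startConfig_stack]; exact h) ?_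
    simp only [polyBound, List.length_replicate, List.length_nil, add_zero]
    have h4 : 1 ≤ n ^ 4 := Nat.one_le_pow _ _ (by omega)
    calc 1000 * (n * n * n * n) + 1000 ≤ 2000 * n ^ 4 := by ring_nf; ring_nf at h4; omega
      _ ≤ n * n ^ 4 := Nat.mul_le_mul_right _ hn
      _ ≤ n ^ 5 + 5 := by rw [pow_succ' n 4]; omega
  rw [this, hσ, readCircuit_fishing]

theorem fishingMachine_post {n : ℕ} (hn : 2000 ≤ n) (A : Oracle)
    (p : (Fin 3 → Bool) × (Fin n → Fin n → Bool)) :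
    fishingMachine.post.eval A (List.replicate n false) (List.ofFn (assignEquiv n p)) =
      concat p.2 := by
  have h3 : List.ofFn (assignEquiv n p) = p.1 0 :: p.1 1 :: p.1 2 :: concat p.2 := by
    have e : n * n + 2 + 1 = 3 + n * n := by omega
    rw [List.ofFn_congr e, List.ofFn_add, concat_eq_ofFn]
    have h' : ∀ v : Fin (n * n), assignEquiv n p (Fin.cast e.symm (Fin.natAdd 3 v)) =
        p.2 (finProdFinEquiv.symm v).1 (finProdFinEquiv.symm v).2 := by
      intro v
      rw [← assignEquiv_inr p]
      refine congrArg _ ?_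
      apply Fin.ext
      rw [qubitEquiv_inr]
      have := congrArg Fin.val (finProdFinEquiv.apply_symm_apply v)
      simp only [finProdFinEquiv_apply_val] at this
      simp only [Fin.val_cast, Fin.val_natAdd]
      rw [← this]; ring
    simp only [h']
    rfl
  obtain ⟨σ, hσ, h⟩ := runs_outputProg (List.replicate n false) (concat p.2) (p.1 0) (p.1 1) (p.1 2)
  rw [← h3, ← startConfig_stack] at h
  rw [← hσ]
  refine Prog.machine_eval h ?_
  have hl : (concat p.2).length = n * n := by rw [concat_eq_ofFn, List.length_ofFn]
  simp only [polyBound, List.length_replicate, List.length_ofFn, hl]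
  calc 4 * (n * n) + 5 ≤ n + (n * n + 2 + 1) ^ 2 := by nlinarith
    _ ≤ (n + (n * n + 2 + 1)) ^ 2 := by nlinarith
    _ ≤ (n + (n * n + 2 + 1)) ^ 5 + 5 :=
      (Nat.pow_le_pow_right (n := n + (n * n + 2 + 1)) (by omega) (show 2 ≤ 5 by norm_num)).trans
        (Nat.le_add_right _ _)

end BQPvsPH

/-! ### The success probability of the quantum algorithm -/

namespace BQPvsPH
open Finset MeasureTheory Filter
open scoped BigOperators Topology

/-- The success probability of the quantum algorithm for Fourier Fishing. -/
noncomputable def fishingProb (n : ℕ) (A : Oracle) : ℝ :=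
  fishingMachine.prob A (List.replicate n false) (catches A n)

theorem fishingProb_le_one (n : ℕ) (A : Oracle) : fishingProb n A ≤ 1 := by
  rw [← fishingMachine.prob_univ A (List.replicate n false)]
  exact fishingMachine.prob_mono _ _ (Set.subset_univ _)

open Classical in
/-- The probability that samples from the Fourier distributions are no catch. -/
noncomputable def missProb {n : ℕ} (f : Fin n → (Fin n → Bool) → ℝ) : ℝ :=
  ∑ z : Fin n → Fin n → Bool, (∏ i, fourier (f i) (z i) ^ 2 / 2 ^ n) *
    (if IsCatch f z then 0 else 1)

theorem one_sub_fishingProb {n : ℕ} (hn : 2000 ≤ n) (A : Oracle) :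
    1 - fishingProb n A = missProb (oracleFun A n) := by
  have h := fun S => QuantumMachine.prob_fishing (fishingMachine_pre hn A)
    (fishingMachine_post hn A) S
  rw [fishingProb, ← fishingMachine.prob_univ A (List.replicate n false), h, h,
    ← sum_sub_distrib, missProb]
  refine sum_congr rfl fun z _ => ?_
  rw [← mul_sub]
  congr 1
  by_cases hz : IsCatch (oracleFun A n) z <;> simp [concat_mem_catches, hz]

theorem isLocal_one_sub_fishingProb {n : ℕ} (hn : 2000 ≤ n) :
    IsLocal (2 * n) fun A => 1 - fishingProb n A := by
  intro A B h
  have : oracleFun A n = oracleFun B n := by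
    simp only [oracleFun_eq_blockFun]
    congr 1
    funext v
    exact h _ (length_blockString v).le
  simp only [one_sub_fishingProb hn, this]

theorem eventually_integral_one_sub_fishingProb_le : ∃ ρ : ℝ, 0 < ρ ∧ ρ < 1 ∧ ∀ᶠ n : ℕ in atTop,
    Integrable (fishingProb n) randomOracle ∧
    ∫ A, (1 - fishingProb n A) ∂randomOracle ≤ 2 * ρ ^ n := by
  obtain ⟨ρ, h0, h1, h⟩ := eventually_expect_not_isCatch_le
  refine ⟨ρ, h0, h1, ?_⟩
  filter_upwards [h, eventually_ge_atTop 2000] with n hn hn2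
  have hloc := isLocal_one_sub_fishingProb hn2
  refine ⟨?_, ?_⟩
  · have := (integrable_const (1 : ℝ)).sub hloc.integrable
    refine this.congr (ae_of_all _ fun A => ?_)
    simp
  · rw [integral_eq_integral_withBlock hloc n]
    simp only [one_sub_fishingProb hn2, oracleFun_withBlock]
    rw [integral_const, probReal_univ, one_smul]
    exact hn

/-- With `r = √ρ`, the mean failure probability is at most `2 r^(2n)`. By Markov's inequality it
exceeds `r^n` only with probability `2 r^n` over the oracle, which is summable, and Borel–Cantelli
applies. The constant is `c = -log r`. -/
theorem exists_fishing_bounds : ∃ c : ℝ, 0 < c ∧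
    (∀ᶠ n : ℕ in atTop, 1 - Real.exp (-c * n) ≤ ∫ A, fishingProb n A ∂randomOracle) ∧
    ∀ᵐ A ∂randomOracle, ∀ᶠ n : ℕ in atTop, 1 - Real.exp (-c * n) ≤ fishingProb n A := by
  obtain ⟨ρ, h0, h1, h⟩ := eventually_integral_one_sub_fishingProb_le
  set r := Real.sqrt ρ with hr
  have hr0 : 0 < r := Real.sqrt_pos.2 h0
  have hr1 : r < 1 := by rw [hr, Real.sqrt_lt' one_pos]; simpa using h1
  have hρ : ρ = r * r := (Real.mul_self_sqrt h0.le).symm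
  have hexp : ∀ n : ℕ, Real.exp (-(-Real.log r) * n) = r ^ n := fun n => by
    rw [neg_neg, mul_comm, Real.exp_nat_mul, Real.exp_log hr0]
  refine ⟨-Real.log r, neg_pos.2 (Real.log_neg hr0 hr1), ?_, ?_⟩
  -- Once `r^n < 1/2`, the factor 2 is absorbed: `2 r^n r^n ≤ r^n`.
  · have h2 : ∀ᶠ n : ℕ in atTop, r ^ n < 1 / 2 :=
      (tendsto_pow_atTop_nhds_zero_of_lt_one hr0.le hr1).eventually_lt_const (by norm_num)
    filter_upwards [h, h2] with n ⟨hi, hn⟩ hn2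
    rw [integral_sub (integrable_const _) hi, integral_const, probReal_univ, one_smul, hρ,
      mul_pow] at hn
    rw [hexp]
    have := pow_pos hr0 n
    nlinarith
  · obtain ⟨n₀, hn₀⟩ := eventually_atTop.1 h
    set E : ℕ → Set Oracle := fun n => {A | n₀ ≤ n ∧ r ^ n ≤ 1 - fishingProb n A} with hE
    have hle : ∀ n, randomOracle (E n) ≤ ENNReal.ofReal (2 * r ^ n) := by
      intro n
      by_cases hn : n₀ ≤ n
      · obtain ⟨hi, h3⟩ := hn₀ n hn
        have hrn := pow_pos hr0 n
        have hm := mul_meas_ge_le_integral_of_nonneg (μ := randomOracle)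
          (f := fun A => 1 - fishingProb n A)
          (ae_of_all _ fun A => sub_nonneg.2 (fishingProb_le_one n A))
          ((integrable_const _).sub hi) (r ^ n)
        have hEn : E n = {A | r ^ n ≤ 1 - fishingProb n A} := by simp [hE, hn]
        rw [hEn, ← ofReal_measureReal]
        refine ENNReal.ofReal_le_ofReal ?_
        rw [hρ, mul_pow] at h3
        refine le_of_mul_le_mul_left ((hm.trans h3).trans_eq ?_) hrn
        ring
      · simp [hE, hn]
    have hsum : ∑' n, randomOracle (E n) ≠ ⊤ := by
      refine ne_top_of_le_ne_top ?_ (ENNReal.tsum_le_tsum hle)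
      exact ((summable_geometric_of_lt_one hr0.le hr1).mul_left 2).tsum_ofReal_ne_top
    filter_upwards [ae_eventually_notMem hsum] with A hA
    filter_upwards [hA, eventually_ge_atTop n₀] with n hn hn2
    rw [hexp]
    have : ¬ r ^ n ≤ 1 - fishingProb n A := fun h => hn ⟨hn2, h⟩
    linarith

/-! ### Fourier Fishing in the two complexity classes -/

theorem nonempty_fourierFishing (A : Oracle) (x : List Bool) : (FourierFishing A x).Nonempty := by
  by_cases h : ∃ n, x = List.replicate n false ∧ (catches A n).Nonempty
  · obtain ⟨n, rfl, y, hy⟩ := h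
    refine ⟨y, fun m hm _ => ?_⟩
    have : n = m := by simpa using congrArg List.length hm
    rwa [← this]
  · exact ⟨[], fun n hn hc => (h ⟨n, hn, hc⟩).elim⟩

theorem catches_subset_fourierFishing (A : Oracle) (n : ℕ) :
    catches A n ⊆ FourierFishing A (List.replicate n false) := by
  intro y hy m hm _
  have : n = m := by simpa using congrArg List.length hm
  rwa [← this]

theorem fourierFishing_mem_FBQP {A : Oracle} {c : ℝ} (hc : 0 < c)
    (h : ∀ᶠ n : ℕ in atTop, 1 - Real.exp (-c * n) ≤ fishingProb n A) :
    FourierFishing A ∈ FBQP A := by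
  obtain ⟨n₀, hn₀⟩ := eventually_atTop.1 h
  -- For the finitely many small lengths the error 1 demands nothing.
  refine ⟨nonempty_fourierFishing A, fishingMachine,
    fun n => if n < n₀ then 1 else Real.exp (-c * n), ?_, fun x => ?_⟩
  · have h1 : Tendsto (fun n : ℕ => Real.exp (-c * n)) atTop (𝓝 0) := by
      refine Real.tendsto_exp_atBot.comp ?_
      exact tendsto_natCast_atTop_atTop.const_mul_atTop_of_neg (neg_neg_of_pos hc)
    refine h1.congr' ?_
    filter_upwards [eventually_ge_atTop n₀] with n hn
    rw [if_neg hn.not_gt]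
  · beta_reduce
    split_ifs with hx
    · rw [sub_self]
      exact fishingMachine.prob_nonneg _ _ _
    · by_cases hx2 : x = List.replicate x.length false
      · have h2 := fishingMachine.prob_mono A x (catches_subset_fourierFishing A x.length)
        rw [← hx2] at h2
        refine (hn₀ x.length (not_lt.1 hx)).trans ?_
        rw [fishingProb, ← hx2]
        exact h2
      · have : FourierFishing A x = Set.univ := by
          refine Set.eq_univ_of_forall fun y n hn => (hx2 ?_).elim
          rw [hn, List.length_replicate]
        rw [this, fishingMachine.prob_univ]
        exact sub_le_self _ (Real.exp_pos _).le

theorem fourierFishing_notMem_FBPPwithPH {A : Oracle} {c : ℝ} (hc : 0 < c)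
    (h : ∀ᶠ n : ℕ in atTop, 1 - Real.exp (-c * n) ≤ fishingProb n A)
    (h2 : ∀ B ∈ PH A, ∀ M : ProbMachine,
      ∃ᶠ n : ℕ in atTop, M.prob B (List.replicate n false) (catches A n) < 0.99) :
    FourierFishing A ∉ FBPPwithPH A := by
  rintro ⟨B, hB, _, M, ε, hε, hM⟩
  have h3 : ∀ᶠ n : ℕ in atTop, ε n < 0.01 := hε.eventually_lt_const (by norm_num)
  obtain ⟨n, hn, hn1, hn2, hn3⟩ :=
    ((h2 B hB M).and_eventually (h.and (h3.and (eventually_ge_atTop 1)))).exists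
  -- If there were no solution, every output would be valid and the classical machine would succeed
  -- trivially. The quantum algorithm's positive success probability excludes this.
  have hne : (catches A n).Nonempty := by
    rw [Set.nonempty_iff_ne_empty]
    intro he
    have h0 : fishingProb n A = 0 := by simp [fishingProb, he, QuantumMachine.prob]
    rw [h0, sub_nonpos, Real.one_le_exp_iff] at hn1
    have : (1 : ℝ) ≤ n := by exact_mod_cast hn3
    nlinarith
  have heq : FourierFishing A (List.replicate n false) = catches A n :=
    (catches_subset_fourierFishing A n).antisymm' fun y hy => hy n rfl hne
  have h4 := hM (List.replicate n false)
  rw [heq, List.length_replicate] at h4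
  norm_num at hn hn2
  linarith

end BQPvsPH

/-! ### The theorem -/

theorem mainTheorem1 :
    (∃ (Q : BQPvsPH.QuantumMachine) (c : ℝ), 0 < c ∧
      (∀ᶠ n : ℕ in Filter.atTop,
        1 - Real.exp (-c * n) ≤
          ∫ A, Q.prob A (List.replicate n false) (BQPvsPH.catches A n)
            ∂BQPvsPH.randomOracle) ∧
      (∀ᵐ A ∂BQPvsPH.randomOracle, ∀ᶠ n : ℕ in Filter.atTop,
        1 - Real.exp (-c * n) ≤
          Q.prob A (List.replicate n false) (BQPvsPH.catches A n))) ∧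
    (∀ (S : BQPvsPH.PHMachine) (M : BQPvsPH.ProbMachine),
      ∀ᶠ n : ℕ in Filter.atTop,
        MeasureTheory.Integrable
          (fun A => M.prob (S.lang A) (List.replicate n false) (BQPvsPH.catches A n))
          BQPvsPH.randomOracle ∧
        ∫ A, M.prob (S.lang A) (List.replicate n false) (BQPvsPH.catches A n)
          ∂BQPvsPH.randomOracle < 0.99) ∧
    (∀ᵐ A ∂BQPvsPH.randomOracle, ∀ B ∈ BQPvsPH.PH A, ∀ M : BQPvsPH.ProbMachine,
      ∃ᶠ n : ℕ in Filter.atTop,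
        M.prob B (List.replicate n false) (BQPvsPH.catches A n) < 0.99) ∧
    (∀ᵐ A ∂BQPvsPH.randomOracle,
      BQPvsPH.FourierFishing A ∈ BQPvsPH.FBQP A ∧
      BQPvsPH.FourierFishing A ∉ BQPvsPH.FBPPwithPH A) ∧
    (∀ᵐ A ∂BQPvsPH.randomOracle,
      ¬ BQPvsPH.FBQP A ⊆ BQPvsPH.FBPPwithPH A) := by
  obtain ⟨c, hc, hint, hae⟩ := BQPvsPH.exists_fishing_bounds
  have hPH := BQPvsPH.ae_frequently_prob_lt
  have hFF : ∀ᵐ A ∂BQPvsPH.randomOracle, BQPvsPH.FourierFishing A ∈ BQPvsPH.FBQP A ∧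
      BQPvsPH.FourierFishing A ∉ BQPvsPH.FBPPwithPH A := by
    filter_upwards [hae, hPH] with A h1 h2
    exact ⟨BQPvsPH.fourierFishing_mem_FBQP hc h1,
      BQPvsPH.fourierFishing_notMem_FBPPwithPH hc h1 h2⟩
  exact ⟨⟨BQPvsPH.fishingMachine, c, hc, hint, hae⟩, BQPvsPH.eventually_integral_prob_lt, hPH,
    hFF, hFF.mono fun A hA hsub => hA.2 (hsub hA.1)⟩
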